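/- **Theorem (Coupling of the $\beta$-Hermite ensembles).** Let $\beta>0$. For real $\kappa>0$ let $\chi_\kappa$ be the law of the square root of a chi-square variable with $\kappa$ degrees of freedom (a Gamma variable with shape $\kappa/2$ and rate $1/2$). Let $J_\beta$ be the random semi-infinite Jacobi matrix: symmetric, tridiagonal, with independent entries on and above the diagonal, with diagonal entries $a_0,a_1,\dots\sim N(0,2/\beta)$ and with off-diagonal entries $b_k\sim \chi_{k\beta}/\sqrt\beta$, $k=1,2,\dots$. For $n\ge 0$ let $T_n$ be the $n\times n$ $\beta$-Hermite tridiagonal model: the random symmetric tridiagonal matrix with independent entries on and above the diagonal, with diagonal entries $N(0,2/(n\beta))$ and with $(i,i+1)$ entry distributed as $\chi_{(n-i)\beta}/\sqrt{n\beta}$, $1\le i\le n-1$. Such a $J_\beta$ exists, and for every realization of $J_\beta$ on a probability space there is a random probability measure $\mu_\beta$ on $\mathbb R$, defined on the same space, with the following properties. 1. Almost surely, $J_\beta$ with domain $\{v\in\ell^2(\mathbb N): J_\beta v\in\ell^2(\mathbb N)\}$ is a self-adjoint operator on complex $\ell^2(\mathbb N)$, and $\mu_\beta$ is its spectral measure at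 the first coordinate vector $e$, that is, $\langle e,(J_\beta-z)^{-1}e\rangle=\int (x-z)^{-1}\,d\mu_\beta(x)$ for all $z\in\mathbb C\setminus\mathbb R$. 2. Almost surely, $\mu_\beta$ has infinite support and finite moments of all orders. 3. For every $n$, the top-left $n\times n$ minor of $J_\beta$, with the order of the coordinates reversed and divided by $\sqrt n$, is a $\beta$-Hermite tridiagonal model $T_n$. 4. Almost surely, for every $n$ there is exactly one orthonormal polynomial $p_n$ of $\mu_\beta$ (degree $n$, positive leading coefficient, $\int p_n^2\,d\mu_\beta=1$, orthogonal in $L^2(\mu_\beta)$ to all polynomials of lower degree). For every $n$, almost surely $p_n$ has $n$ distinct real zeros, and they are distributed as the $n$-point $\beta$-Hermite ensemble: the increasingly ordered zeros have the same joint law as the increasingly ordered eigenvalues of $\sqrt n\,T_n$, and this law has on $\{\lambda_1<\dots<\lambda_n\}$ a density proportional to $$\exp\Big(-\frac\beta4\sum_{i=1}^n\lambda_i^2\Big)\prod_{i<j}|\lambda_i-\lambda_j|^\beta .$$ -/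

import Mathlib

open MeasureTheory ProbabilityTheory Polynomial
open scoped ENNReal NNReal

namespace BetaHermite

/-- The `χ_κ` distribution with real parameter `κ > 0`: the law of the square root of a
chi-square variable with `κ` degrees of freedom, i.e. of a gamma variable with shape `κ / 2` and
rate `1 / 2`. For integral `κ` this is the law of the length of a standard normal vector
in dimension `κ`. -/
noncomputable def chiMeasure (κ : ℝ) : Measure ℝ :=
  (gammaMeasure (κ / 2) (1 / 2)).map Real.sqrt

/-! ### Jacobi matrices -/

/-- The top-left `n × n` minor of the semi-infinite Jacobi matrix with diagonal
`a 0, a 1, …` and off-diagonal `b 0, b 1, …`. -/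
def jacobiMinor (a b : ℕ → ℝ) (n : ℕ) : Matrix (Fin n) (Fin n) ℝ :=
  fun i j =>
    if (i : ℕ) = j then a i
    else if (i : ℕ) + 1 = j then b i
    else if (j : ℕ) + 1 = i then b j
    else 0

/-- The formal action of the semi-infinite Jacobi matrix on complex sequences. -/
noncomputable def jacobiAction (a b : ℕ → ℝ) : (ℕ → ℂ) →ₗ[ℂ] (ℕ → ℂ) where
  toFun v k :=
    match k with
    | 0 => (a 0 : ℂ) * v 0 + (b 0 : ℂ) * v 1
    | m + 1 => (b m : ℂ) * v m + (a (m + 1) : ℂ) * v (m + 1) + (b (m + 1) : ℂ) * v (m + 2)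
  map_add' v w := by
    funext k
    cases k <;> simp only [Pi.add_apply] <;> ring
  map_smul' c v := by
    funext k
    cases k <;> simp only [Pi.smul_apply, smul_eq_mul, RingHom.id_apply] <;> ring

/-- The Hilbert space `ℓ²(ℕ)` over the complex numbers. -/
abbrev EllTwo : Type := lp (fun _ : ℕ => ℂ) 2

/-- The operator on `ℓ²(ℕ)` given by the Jacobi matrix `J`, on its maximal domain
`{v ∈ ℓ² : J v ∈ ℓ²}`. It is the adjoint of `J` restricted to finitely supported sequences, hence
it is self-adjoint if and only if the latter operator is essentially self-adjoint. -/
noncomputable def jacobiOperator (a b : ℕ → ℝ) : EllTwo →ₗ.[ℂ] EllTwo where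
  domain :=
    { carrier := {v | Memℓp (jacobiAction a b (v : ℕ → ℂ)) 2}
      zero_mem' := by
        change Memℓp (jacobiAction a b 0) 2
        rw [map_zero]
        exact zero_memℓp
      add_mem' := fun {v w} hv hw => by
        change Memℓp (jacobiAction a b ((v : ℕ → ℂ) + (w : ℕ → ℂ))) 2
        rw [map_add]
        exact Memℓp.add hv hw
      smul_mem' := fun c v hv => by
        change Memℓp (jacobiAction a b (c • (v : ℕ → ℂ))) 2
        rw [map_smul]
        exact Memℓp.const_smul hv c }
  toFun :=
    { toFun := fun v => ⟨jacobiAction a b ((v : EllTwo) : ℕ → ℂ), v.2⟩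
      map_add' := fun v w => by
        apply lp.ext
        exact map_add (jacobiAction a b) _ _
      map_smul' := fun c v => by
        apply lp.ext
        exact map_smul (jacobiAction a b) _ _ }

/-- The first coordinate vector of `ℓ²(ℕ)`. -/
noncomputable def firstVector : EllTwo := lp.single 2 0 (1 : ℂ)

/-- `μ` is the spectral measure of the (self-adjoint) operator `A` at the vector `e`: its
Stieltjes transform is the resolvent matrix element,
`⟪e, (A - z)⁻¹ e⟫ = ∫ (x - z)⁻¹ dμ(x)` for all non-real `z`. -/
def IsSpectralMeasureAt (A : EllTwo →ₗ.[ℂ] EllTwo) (e : EllTwo) (μ : Measure ℝ) : Prop :=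
  ∀ z : ℂ, z.im ≠ 0 → ∃ v : A.domain,
    A v - z • (v : EllTwo) = e ∧ inner ℂ e (v : EllTwo) = ∫ x : ℝ, ((x : ℂ) - z)⁻¹ ∂μ

/-! ### Orthogonal polynomials -/

/-- `p` is the `n`-th orthonormal polynomial of `μ`: it has degree `n`, positive leading
coefficient, norm one in `L²(μ)`, and it is orthogonal in `L²(μ)` to all polynomials of lower
degree. -/
structure IsOrthonormalPolynomial (μ : Measure ℝ) (n : ℕ) (p : ℝ[X]) : Prop where
  degree_eq : p.degree = n
  leadingCoeff_pos : 0 < p.leadingCoeff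
  norm_eq_one : ∫ x, p.eval x ^ 2 ∂μ = 1
  orthogonal : ∀ q : ℝ[X], q.degree < n → ∫ x, p.eval x * q.eval x ∂μ = 0

/-- The vector of the real roots of `p`, with multiplicity and in increasing order (meant for a
polynomial with exactly `n` real roots; padded by zeros or truncated otherwise). -/
noncomputable def orderedRoots (n : ℕ) (p : ℝ[X]) : Fin n → ℝ :=
  fun i => (p.roots.sort (· ≤ ·)).getD i 0

/-! ### The random matrices and the ensemble -/

/-- The entries of the random semi-infinite Jacobi matrix `J_β`: all entries on and above the
diagonal are independent, the diagonal ones are `N(0, 2 / β)`, and the `k`-th off-diagonal one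
(`k = 1, 2, …`, which is `b (k - 1)`) is distributed as `χ_{kβ} / √β`. -/
structure IsBetaHermiteJacobi {Ω : Type*} [MeasurableSpace Ω] (β : ℝ) (P : Measure Ω)
    (a b : ℕ → Ω → ℝ) : Prop where
  law_diag : ∀ k, HasLaw (a k) (gaussianReal 0 (2 / β).toNNReal) P
  law_offDiag : ∀ k : ℕ,
    HasLaw (b k) ((chiMeasure (((k : ℝ) + 1) * β)).map (fun x => x / √β)) P
  indep : iIndepFun (Sum.elim a b) P

/-- `T` is the `n × n` `β`-Hermite tridiagonal model: a random symmetric tridiagonal matrix with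
independent entries on and above the diagonal, with diagonal entries `N(0, 2 / (nβ))` and with
`(i, i + 1)` entry (`1 ≤ i ≤ n - 1`) distributed as `χ_{(n - i)β} / √(nβ)`. (The indices `i : Fin n`
below start from `0`.) -/
structure IsBetaHermiteTridiagonal {Ω : Type*} [MeasurableSpace Ω] (β : ℝ) (n : ℕ)
    (P : Measure Ω) (T : Ω → Matrix (Fin n) (Fin n) ℝ) : Prop where
  symm : ∀ ω, (T ω).IsSymm
  tridiagonal : ∀ ω (i j : Fin n), (i : ℕ) + 1 < j → T ω i j = 0
  law_diag : ∀ i, HasLaw (fun ω => T ω i i) (gaussianReal 0 (2 / (n * β)).toNNReal) P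
  law_offDiag : ∀ i j : Fin n, (i : ℕ) + 1 = j →
    HasLaw (fun ω => T ω i j)
      ((chiMeasure (((n : ℝ) - ((i : ℝ) + 1)) * β)).map (fun x => x / √(n * β))) P
  indep : iIndepFun
    (fun (s : {s : Fin n × Fin n // (s.1 : ℕ) = s.2 ∨ (s.1 : ℕ) + 1 = s.2}) (ω : Ω) =>
      T ω s.1.1 s.1.2) P

/-- The unnormalized joint law of the increasingly ordered points of the `n`-point `β`-Hermite
ensemble: the density
`exp (-(β / 4) ∑ᵢ λᵢ²) ∏_{i < j} |λᵢ - λⱼ| ^ β` on `{λ₁ < … < λₙ}`. -/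
noncomputable def hermiteWeight (β : ℝ) (n : ℕ) : Measure (Fin n → ℝ) :=
  (volume.restrict {x : Fin n → ℝ | StrictMono x}).withDensity fun x =>
    ENNReal.ofReal (Real.exp (-(β / 4) * ∑ i, x i ^ 2) *
      ∏ i : Fin n, ∏ j ∈ Finset.Ioi i, |x i - x j| ^ β)

/-- The joint law of the increasingly ordered points of the `n`-point `β`-Hermite ensemble. -/
noncomputable def hermiteEnsemble (β : ℝ) (n : ℕ) : Measure (Fin n → ℝ) :=
  (hermiteWeight β n Set.univ)⁻¹ • hermiteWeight β n

end BetaHermite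

namespace BetaHermite

open Lagrange (nodal)

/-- The monic polynomial with roots `x`. -/
noncomputable def rootPoly {n : ℕ} (x : Fin n → ℝ) : ℝ[X] := nodal Finset.univ x

/-- The polynomial of degree less than `n` with `f / rootPoly x = ∑ i, g i / (X - x i)`. -/
noncomputable def residuePoly {n : ℕ} (x g : Fin n → ℝ) : ℝ[X] :=
  ∑ i, C (g i) * nodal (Finset.univ.erase i) x

/-- The pairs `(P, R)` for which `R / P` is the Stieltjes transform of a positive measure with
exactly `n` atoms, where `P` is monic. -/
def spectralPairs (n : ℕ) : Set (ℝ[X] × ℝ[X]) :=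
  {f | ∃ x g : Fin n → ℝ, StrictMono x ∧ (∀ i, 0 < g i) ∧ f = (rootPoly x, residuePoly x g)}

theorem eval_residuePoly {n : ℕ} (x g : Fin n → ℝ) (i : Fin n) :
    (residuePoly x g).eval (x i) = g i * ∏ j ∈ Finset.univ.erase i, (x i - x j) := by
  rw [residuePoly, eval_finsetSum, Finset.sum_eq_single i]
  · simp [Lagrange.eval_nodal]
  · intro j _ hj
    rw [eval_mul, Lagrange.eval_nodal_at_node (by simp [hj.symm]), mul_zero]
  · simp

theorem degree_residuePoly_lt {n : ℕ} (x g : Fin n → ℝ) : (residuePoly x g).degree < n := by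
  rw [← mem_degreeLT]
  refine Submodule.sum_mem _ fun i _ => ?_
  rw [C_mul']
  refine Submodule.smul_mem _ _ ?_
  rw [mem_degreeLT]
  have hn : 0 < n := i.pos
  rw [Lagrange.degree_nodal, Finset.card_erase_of_mem (Finset.mem_univ i)]
  simp [hn]

theorem rootPoly_monic {n : ℕ} (x : Fin n → ℝ) : (rootPoly x).Monic := Lagrange.nodal_monic

theorem natDegree_rootPoly {n : ℕ} (x : Fin n → ℝ) : (rootPoly x).natDegree = n := by
  simp [rootPoly]

theorem degree_rootPoly {n : ℕ} (x : Fin n → ℝ) : (rootPoly x).degree = n := by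
  simp [rootPoly]

theorem eval_rootPoly {n : ℕ} (x : Fin n → ℝ) (t : ℝ) : (rootPoly x).eval t = ∏ i, (t - x i) :=
  Lagrange.eval_nodal

theorem roots_rootPoly {n : ℕ} (x : Fin n → ℝ) :
    (rootPoly x).roots = Finset.univ.val.map x := by
  rw [rootPoly, Lagrange.nodal_eq]
  exact Polynomial.roots_multiset_prod_X_sub_C (Finset.univ.val.map x) ▸ by
    rw [Multiset.map_map]; rfl

theorem sign_prod_sub_pos {ι : Type*} (s : Finset ι) (x : ι → ℝ) (y : ℝ) (h : ∀ i ∈ s, y ≠ x i) :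
    0 < (-1) ^ (s.filter fun i => y < x i).card * ∏ i ∈ s, (y - x i) := by
  classical
  rw [← Finset.prod_const, Finset.prod_filter, ← Finset.prod_mul_distrib]
  refine Finset.prod_pos fun i hi => ?_
  rcases lt_or_gt_of_ne (h i hi) with h1 | h1
  · rw [if_pos h1]; linarith
  · rw [if_neg h1.not_gt]; linarith

theorem sign_prod_sub_of_lt {n : ℕ} (x : Fin n → ℝ) (y : ℝ) (k : ℕ) (hk : k ≤ n)
    (h1 : ∀ i : Fin n, (i : ℕ) < k → x i < y) (h2 : ∀ i : Fin n, k ≤ (i : ℕ) → y < x i) :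
    0 < (-1) ^ (n - k) * ∏ i, (y - x i) := by
  have h := sign_prod_sub_pos Finset.univ x y fun i _ => by
    rcases lt_or_ge (i : ℕ) k with hi | hi
    · exact (h1 i hi).ne'
    · exact (h2 i hi).ne
  convert h using 3
  have : (Finset.univ.filter fun i : Fin n => y < x i) =
      Finset.univ.filter fun i : Fin n => ¬ (i : ℕ) < k := by
    ext i
    simp only [Finset.mem_filter, Finset.mem_univ, true_and]
    refine ⟨fun h hi => absurd (h1 i hi) h.not_gt, fun h => h2 i (not_lt.1 h)⟩
  rw [this]
  have hc := Finset.card_filter_add_card_filter_not (s := (Finset.univ : Finset (Fin n)))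
    (fun i : Fin n => (i : ℕ) < k)
  have : (Finset.univ.filter fun i : Fin n => (i : ℕ) < k).card = k := by
    rw [Fin.card_filter_val_lt, min_eq_right hk]
  simp only [Finset.card_univ, Fintype.card_fin] at hc
  omega

theorem sign_prod_erase {n : ℕ} {x : Fin n → ℝ} (hx : StrictMono x) (i : Fin n) :
    0 < (-1) ^ (n - 1 - i) * ∏ j ∈ Finset.univ.erase i, (x i - x j) := by
  have h := sign_prod_sub_pos (Finset.univ.erase i) x (x i) fun j hj =>
    hx.injective.ne (Finset.ne_of_mem_erase hj).symm
  convert h using 3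
  have : ((Finset.univ.erase i).filter fun j : Fin n => x i < x j) = Finset.Ioi i := by
    ext j
    simp only [Finset.mem_filter, Finset.mem_erase, Finset.mem_univ, Finset.mem_Ioi, hx.lt_iff_lt]
    exact ⟨fun h => h.2, fun h => ⟨⟨h.ne', trivial⟩, h⟩⟩
  rw [this, Fin.card_Ioi]

/-- Spectral pairs are characterized by the signs of `R` at the roots of `P`. -/
theorem mem_spectralPairs_of_sign {n : ℕ} {x : Fin n → ℝ} (hx : StrictMono x) {R : ℝ[X]}
    (hR : R.degree < n) (h : ∀ i : Fin n, 0 < (-1) ^ (n - 1 - i) * R.eval (x i)) :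
    (rootPoly x, R) ∈ spectralPairs n := by
  have hne : ∀ i, ∏ j ∈ Finset.univ.erase i, (x i - x j) ≠ 0 := fun i h0 => by
    have := sign_prod_erase hx i
    simp [h0] at this
  refine ⟨x, fun i => R.eval (x i) / ∏ j ∈ Finset.univ.erase i, (x i - x j), hx, fun i => ?_, ?_⟩
  · have h1 := sign_prod_erase hx i
    have h2 := h i
    beta_reduce
    rw [← mul_div_mul_left _ _ (pow_ne_zero (n - 1 - i) (by norm_num : (-1 : ℝ) ≠ 0))]
    exact div_pos h2 h1
  · refine Prod.ext rfl ?_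
    refine Polynomial.eq_of_degree_sub_lt_of_eval_index_eq Finset.univ (v := x)
      hx.injective.injOn ?_ fun i _ => ?_
    · refine (degree_sub_le _ _).trans_lt ?_
      simpa using ⟨hR, degree_residuePoly_lt _ _⟩
    · rw [eval_residuePoly, div_mul_cancel₀ _ (hne i)]

theorem eval_sign_of_mem_spectralPairs {n : ℕ} {x g : Fin n → ℝ} (hx : StrictMono x)
    (hg : ∀ i, 0 < g i) (i : Fin n) :
    0 < (-1) ^ (n - 1 - i) * (residuePoly x g).eval (x i) := by
  rw [eval_residuePoly, mul_left_comm]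
  exact mul_pos (hg i) (sign_prod_erase hx i)

/-- A monic polynomial of degree `m` with alternating signs at `m + 1` points splits, and its roots
interlace these points. -/
theorem exists_interlacing_roots {m : ℕ} {f : ℝ[X]} (hf : f.Monic) (hd : f.natDegree = m)
    {y : Fin (m + 1) → ℝ} (hy : StrictMono y)
    (h : ∀ i : Fin (m + 1), 0 < (-1) ^ (m - i) * f.eval (y i)) :
    ∃ x : Fin m → ℝ, StrictMono x ∧ (∀ i : Fin m, y i.castSucc < x i ∧ x i < y i.succ) ∧
      f = rootPoly x := by
  have key : ∀ i : Fin m, ∃ t ∈ Set.Ioo (y i.castSucc) (y i.succ), f.eval t = 0 := by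
    intro i
    have hlt : y i.castSucc < y i.succ := hy (Fin.castSucc_lt_succ)
    have h0 := h i.castSucc
    have h1 := h i.succ
    simp only [Fin.val_castSucc, Fin.val_succ] at h0 h1
    obtain ⟨k, hk⟩ : ∃ k, m - (i : ℕ) = k + 1 := ⟨m - i - 1, by omega⟩
    have hk' : m - ((i : ℕ) + 1) = k := by omega
    rw [hk] at h0
    rw [hk'] at h1
    have hc : ContinuousOn (fun t => (-1) ^ k * f.eval t) (Set.Icc (y i.castSucc) (y i.succ)) :=
      (continuous_const.mul f.continuous).continuousOn
    have := intermediate_value_Ioo hlt.le hc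
    have h0' : (-1) ^ k * f.eval (y i.castSucc) < 0 := by rw [pow_succ] at h0; linarith
    obtain ⟨t, ht, h2⟩ := this ⟨h0', h1⟩
    refine ⟨t, ht, ?_⟩
    simpa using h2
  choose x hx hx0 using key
  have hmono : StrictMono x := by
    intro i j hij
    calc x i < y i.succ := (hx i).2
      _ ≤ y j.castSucc := hy.monotone (by rw [Fin.le_def]; simpa using hij)
      _ < x j := (hx j).1
  refine ⟨x, hmono, hx, ?_⟩
  refine Polynomial.eq_of_degree_sub_lt_of_eval_index_eq Finset.univ (v := x)
      hmono.injective.injOn ?_ fun i _ => ?_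
  · have := degree_sub_lt_left (p := f) (q := rootPoly x)
      (by rw [degree_rootPoly, degree_eq_natDegree hf.ne_zero, hd]) hf.ne_zero
      (by rw [hf, rootPoly_monic])
    rw [degree_eq_natDegree hf.ne_zero, hd] at this
    simpa using this
  · rw [hx0, eval_rootPoly, Finset.prod_eq_zero (Finset.mem_univ i) (sub_self _)]

theorem exists_gt_eval_pos {f : ℝ[X]} (hf : f.Monic) (K : ℝ) : ∃ t, K < t ∧ 0 < f.eval t := by
  rcases Nat.eq_zero_or_pos f.natDegree with h | h
  · rw [hf.natDegree_eq_zero.1 h]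
    exact ⟨K + 1, by linarith, by simp⟩
  · have := f.tendsto_atTop_of_leadingCoeff_nonneg (natDegree_pos_iff_degree_pos.1 h)
      (by rw [hf]; norm_num)
    exact ((Filter.eventually_gt_atTop K).and (this.eventually_gt_atTop 0)).exists

theorem exists_lt_eval_pos {f : ℝ[X]} (hf : f.Monic) (K : ℝ) :
    ∃ t, t < K ∧ 0 < (-1) ^ f.natDegree * f.eval t := by
  have hg : (C ((-1) ^ f.natDegree) * f.comp (-X)).Monic := by
    rw [Monic, leadingCoeff_mul, leadingCoeff_comp (by simp), hf]
    simp [← mul_pow]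
  obtain ⟨t, h1, h2⟩ := exists_gt_eval_pos hg (-K)
  exact ⟨-t, by linarith, by simpa using h2⟩

theorem degree_step {n : ℕ} {P R : ℝ[X]} (hP : P.Monic) (hd : P.natDegree = n)
    (hR : R.degree < n) (a : ℝ) :
    ((X - C a) * P - R).Monic ∧ ((X - C a) * P - R).natDegree = n + 1 := by
  have h1 : ((X - C a) * P).Monic := (monic_X_sub_C a).mul hP
  have h2 : ((X - C a) * P).natDegree = n + 1 := by
    rw [(monic_X_sub_C a).natDegree_mul hP, natDegree_X_sub_C, hd, add_comm]
  have h3 : R.degree < ((X - C a) * P).degree := by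
    rw [degree_eq_natDegree h1.ne_zero, h2]
    exact hR.trans (by exact_mod_cast Nat.lt_succ_self n)
  refine ⟨h1.sub_of_left h3, ?_⟩
  rw [natDegree_sub_eq_left_of_natDegree_lt, h2]
  by_cases h0 : R = 0
  · simp [h0, h2]
  · exact natDegree_lt_natDegree h0 h3

theorem spectralPairs_step {n : ℕ} {P R : ℝ[X]} (h : (P, R) ∈ spectralPairs n) (a : ℝ) {c : ℝ}
    (hc : 0 < c) : ((X - C a) * P - R, C c * P) ∈ spectralPairs (n + 1) := by
  obtain ⟨x, g, hx, hg, h⟩ := h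
  obtain ⟨rfl, rfl⟩ := Prod.mk.inj h
  obtain ⟨hm, hd⟩ := degree_step (rootPoly_monic x) (natDegree_rootPoly x)
    (degree_residuePoly_lt x g) a
  set f := (X - C a) * rootPoly x - residuePoly x g with hf
  have hroot : ∀ i, (rootPoly x).eval (x i) = 0 := fun i => by
    rw [eval_rootPoly, Finset.prod_eq_zero (Finset.mem_univ i) (sub_self _)]
  have hfx : ∀ i, f.eval (x i) = -(residuePoly x g).eval (x i) := fun i => by
    simp [hf, hroot]
  obtain ⟨B, hB⟩ : ∃ B : ℝ, 0 < B ∧ ∀ i, |x i| < B := by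
    refine ⟨∑ i, |x i| + 1, by positivity, fun i => ?_⟩
    have := Finset.single_le_sum (f := fun i => |x i|) (fun i _ => abs_nonneg _) (Finset.mem_univ i)
    linarith
  obtain ⟨t, ht, htp⟩ := exists_gt_eval_pos hm B
  obtain ⟨s, hs, hsp⟩ := exists_lt_eval_pos hm (-B)
  rw [hd] at hsp
  let y : Fin (n + 1 + 1) → ℝ := Fin.cons s (Fin.snoc (α := fun _ => ℝ) x t)
  have hy0 : y 0 = s := rfl
  have hy1 : ∀ i : Fin n, y i.castSucc.succ = x i := fun i => by simp [y]
  have hyl : y (Fin.last n).succ = t := by simp [y]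
  have hy : StrictMono y := by
    rw [Fin.strictMono_iff_lt_succ]
    intro i
    refine Fin.cases ?_ (fun i => ?_) i
    · change y 0 < _
      rw [hy0]
      refine Fin.lastCases ?_ (fun j => ?_) (0 : Fin (n + 1))
      · rw [hyl]; linarith
      · rw [hy1]; have := (abs_lt.1 (hB.2 j)).1; linarith
    · rw [← Fin.succ_castSucc, hy1]
      by_cases hi : i.succ = Fin.last n
      · rw [hi, hyl]; have := (abs_lt.1 (hB.2 i)).2; linarith
      · obtain ⟨j, hj⟩ := Fin.exists_castSucc_eq.2 hi
        rw [← hj, hy1]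
        refine hx ?_
        have := congrArg Fin.val hj
        simp at this
        rw [Fin.lt_def]; omega
  have hsign : ∀ i : Fin (n + 1 + 1), 0 < (-1) ^ (n + 1 - i) * f.eval (y i) := by
    intro i
    refine Fin.cases ?_ (fun i => ?_) i
    · rw [hy0]; simpa using hsp
    · refine Fin.lastCases ?_ (fun j => ?_) i
      · rw [hyl]; simpa using htp
      · rw [hy1, hfx]
        have := eval_sign_of_mem_spectralPairs hx hg j
        have h2 : n + 1 - ((j.castSucc.succ : Fin (n + 1 + 1)) : ℕ) = n - 1 - j + 1 := by
          simp; omega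
        rw [h2, pow_succ]
        linarith
  obtain ⟨z, hz, hzy, hfz⟩ := exists_interlacing_roots hm hd hy hsign
  rw [hfz]
  refine mem_spectralPairs_of_sign hz ?_ fun i => ?_
  · rw [degree_C_mul hc.ne', degree_rootPoly]
    exact_mod_cast Nat.lt_succ_self n
  · rw [eval_C_mul, mul_left_comm, eval_rootPoly]
    refine mul_pos hc ?_
    have := sign_prod_sub_of_lt x (z i) i (by omega) (fun j hj => ?_) (fun j hj => ?_)
    · simpa using this
    · refine lt_of_le_of_lt ?_ (hzy i).1
      rw [← hy1]
      exact hy.monotone (by rw [Fin.le_def]; simpa using hj)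
    · refine lt_of_lt_of_le (hzy i).2 ?_
      rw [← hy1]
      exact hy.monotone (by rw [Fin.le_def]; simpa using hj)

theorem spectralPairs_of_step {n : ℕ} {P R : ℝ[X]} {a c : ℝ} (hP : P.Monic)
    (hd : P.natDegree = n) (hR : R.degree < n) (hc : 0 < c)
    (h : ((X - C a) * P - R, C c * P) ∈ spectralPairs (n + 1)) : (P, R) ∈ spectralPairs n := by
  obtain ⟨x, g, hx, hg, h⟩ := h
  obtain ⟨h1, h2⟩ := Prod.mk.inj h
  have hsign : ∀ i : Fin (n + 1), 0 < (-1) ^ (n - i) * P.eval (x i) := fun i => by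
    have := eval_sign_of_mem_spectralPairs hx hg i
    rw [← h2, eval_C_mul, mul_left_comm] at this
    exact pos_of_mul_pos_right this hc.le
  obtain ⟨z, hz, hzx, rfl⟩ := exists_interlacing_roots hP hd hx hsign
  refine mem_spectralPairs_of_sign hz hR fun i => ?_
  have h3 := congrArg (eval (z i)) h1
  rw [eval_sub, eval_mul, eval_rootPoly z, Finset.prod_eq_zero (Finset.mem_univ i) (sub_self _),
    mul_zero, zero_sub, eval_rootPoly] at h3
  have := sign_prod_sub_of_lt x (z i) (i + 1) (by omega) (fun j hj => ?_) (fun j hj => ?_)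
  · rw [← h3] at this
    have h4 : n + 1 - ((i : ℕ) + 1) = n - 1 - i + 1 := by omega
    rw [h4, pow_succ] at this
    linarith
  · refine lt_of_le_of_lt (hx.monotone ?_) (hzx i).1
    rw [Fin.le_def]; simp; omega
  · refine lt_of_lt_of_le (hzx i).2 (hx.monotone ?_)
    rw [Fin.le_def]; simpa using hj

theorem coeff_residuePoly_last {n : ℕ} (x g : Fin (n + 1) → ℝ) :
    (residuePoly x g).coeff n = ∑ i, g i := by
  rw [residuePoly, finsetSum_coeff]
  refine Finset.sum_congr rfl fun i _ => ?_
  have h : (nodal (Finset.univ.erase i) x).natDegree = n := by simp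
  have h2 : (nodal (Finset.univ.erase i) x).coeff n = 1 := by
    rw [← Lagrange.nodal_monic (s := Finset.univ.erase i) (v := x), leadingCoeff, h]
  rw [coeff_C_mul, h2, mul_one]

/-! ### Coefficient vectors -/

/-- The monic polynomial of degree `n` with lower coefficients `p`. -/
noncomputable def monicOf {n : ℕ} (p : Fin n → ℝ) : ℝ[X] := X ^ n + ofFn n p

theorem toFn_apply {n : ℕ} (f : ℝ[X]) (i : Fin n) : toFn n f i = f.coeff i := rfl

theorem ofFn_toFn_of_degree_lt {n : ℕ} {f : ℝ[X]} (hf : f.degree < n) :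
    ofFn n (toFn n f) = f := by
  ext i
  by_cases h : i < n
  · simp [h, toFn]
  · rw [ofFn_coeff_eq_zero_of_ge _ (not_lt.1 h), coeff_eq_zero_of_degree_lt]
    exact hf.trans_le (by exact_mod_cast not_lt.1 h)

theorem monicOf_monic {n : ℕ} (p : Fin n → ℝ) : (monicOf p).Monic :=
  monic_X_pow_add (ofFn_degree_lt p)

theorem natDegree_monicOf {n : ℕ} (p : Fin n → ℝ) : (monicOf p).natDegree = n := by
  have h := ofFn_degree_lt p
  apply natDegree_eq_of_degree_eq_some
  rw [monicOf, degree_add_eq_left_of_degree_lt (by simpa using h), degree_X_pow]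

theorem toFn_X_pow (n : ℕ) : toFn n (X ^ n : ℝ[X]) = 0 := by
  ext i
  simp [toFn_apply, coeff_X_pow, i.2.ne]

theorem toFn_monicOf {n : ℕ} (p : Fin n → ℝ) : toFn n (monicOf p) = p := by
  rw [monicOf, map_add, toFn_comp_ofFn_eq_id, toFn_X_pow, zero_add]

theorem monicOf_toFn {n : ℕ} {f : ℝ[X]} (hf : f.Monic) (hd : f.natDegree = n) :
    monicOf (toFn n f) = f := by
  have h : (f - X ^ n).degree < (n : WithBot ℕ) := by
    have := degree_sub_lt_left (p := f) (q := X ^ n)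
      (by rw [degree_X_pow, degree_eq_natDegree hf.ne_zero, hd]) hf.ne_zero (by simp [hf.leadingCoeff])
    rwa [degree_eq_natDegree hf.ne_zero, hd] at this
  have h2 := ofFn_toFn_of_degree_lt h
  rw [map_sub, toFn_X_pow, sub_zero] at h2
  rw [monicOf, h2, add_sub_cancel]

/-! ### The Vandermonde factor -/

/-- The absolute value of the Vandermonde determinant. -/
noncomputable def absVandermonde {n : ℕ} (x : Fin n → ℝ) : ℝ :=
  ∏ i : Fin n, ∏ j ∈ Finset.Ioi i, |x i - x j|

theorem absVandermonde_pos {n : ℕ} {x : Fin n → ℝ} (hx : StrictMono x) : 0 < absVandermonde x :=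
  Finset.prod_pos fun _ _ => Finset.prod_pos fun _ hj =>
    abs_pos.2 (sub_ne_zero.2 (hx.injective.ne (Finset.mem_Ioi.1 hj).ne))

theorem prod_prod_erase_abs {n : ℕ} (x : Fin n → ℝ) :
    ∏ i, ∏ j ∈ Finset.univ.erase i, |x i - x j| = absVandermonde x ^ 2 := by
  have h : ∀ i : Fin n, ∏ j ∈ Finset.univ.erase i, |x i - x j| =
      (∏ j ∈ Finset.Iio i, |x i - x j|) * ∏ j ∈ Finset.Ioi i, |x i - x j| := fun i => by
    rw [← Finset.prod_union (Finset.disjoint_left.2 fun j h1 h2 =>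
      lt_asymm (Finset.mem_Iio.1 h1) (Finset.mem_Ioi.1 h2))]
    refine Finset.prod_congr ?_ fun _ _ => rfl
    ext j
    simp [lt_or_lt_iff_ne]
  rw [Finset.prod_congr rfl fun i _ => h i, Finset.prod_mul_distrib, sq, absVandermonde]
  congr 1
  rw [Finset.prod_comm' (t' := Finset.univ) (s' := fun i => Finset.Ioi i) (by simp)]
  exact Finset.prod_congr rfl fun i _ => Finset.prod_congr rfl fun j _ => abs_sub_comm _ _

/-- The matrix of the linear map from residues to coefficients. -/
noncomputable def residueMatrix {n : ℕ} (x : Fin n → ℝ) : Matrix (Fin n) (Fin n) ℝ :=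
  fun k j => (nodal (Finset.univ.erase j) x).coeff k

theorem toFn_residuePoly {n : ℕ} (x g : Fin n → ℝ) :
    toFn n (residuePoly x g) = Matrix.toLin' (residueMatrix x) g := by
  ext k
  rw [toFn_apply, residuePoly, finsetSum_coeff, Matrix.toLin'_apply, Matrix.mulVec, dotProduct]
  exact Finset.sum_congr rfl fun j _ => by rw [coeff_C_mul, residueMatrix, mul_comm]

theorem vandermonde_mul_residueMatrix {n : ℕ} (x : Fin n → ℝ) :
    Matrix.vandermonde x * residueMatrix x =
      Matrix.diagonal fun i => ∏ j ∈ Finset.univ.erase i, (x i - x j) := by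
  ext i j
  have hd : (nodal (Finset.univ.erase j) x).natDegree < n := by
    have := j.pos
    simpa using this
  have h : (Matrix.vandermonde x * residueMatrix x) i j =
      (nodal (Finset.univ.erase j) x).eval (x i) := by
    rw [eval_eq_sum_range' hd, Finset.sum_range, Matrix.mul_apply]
    exact Finset.sum_congr rfl fun k _ => by
      rw [Matrix.vandermonde_apply, residueMatrix, mul_comm]
  rw [h, Matrix.diagonal_apply]
  split_ifs with hij
  · rw [hij, Lagrange.eval_nodal]
  · exact Lagrange.eval_nodal_at_node (by simp [hij])

theorem abs_det_residueMatrix {n : ℕ} {x : Fin n → ℝ} (hx : StrictMono x) :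
    |(residueMatrix x).det| = absVandermonde x := by
  have h := congrArg (fun M => |Matrix.det M|) (vandermonde_mul_residueMatrix x)
  simp only [Matrix.det_mul, Matrix.det_diagonal, abs_mul, Finset.abs_prod,
    Matrix.det_vandermonde] at h
  rw [prod_prod_erase_abs] at h
  have h2 : ∏ i : Fin n, ∏ j ∈ Finset.Ioi i, |x j - x i| = absVandermonde x :=
    Finset.prod_congr rfl fun i _ => Finset.prod_congr rfl fun j _ => abs_sub_comm _ _
  rw [h2, sq] at h
  exact mul_left_cancel₀ (absVandermonde_pos hx).ne' h

/-! ### Differentiating the coefficients with respect to the roots -/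

theorem hasFDerivAt_coeff_nodal {ι : Type*} [Fintype ι] [DecidableEq ι] (s : Finset ι) (x : ι → ℝ)
    (k : ℕ) :
    HasFDerivAt (fun y : ι → ℝ => (nodal s y).coeff k)
      (-∑ j ∈ s, (nodal (s.erase j) x).coeff k • ContinuousLinearMap.proj (R := ℝ) (φ := fun _ : ι => ℝ) j) x := by
  induction s using Finset.induction_on generalizing k with
  | empty =>
    simpa using hasFDerivAt_const ((1 : ℝ[X]).coeff k) x
  | insert a s ha ih =>
    have hpr : HasFDerivAt (fun y : ι → ℝ => y a)
        (ContinuousLinearMap.proj (R := ℝ) (φ := fun _ : ι => ℝ) a) x :=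
      (ContinuousLinearMap.proj (R := ℝ) (φ := fun _ : ι => ℝ) a).hasFDerivAt
    have herase : ∀ j ∈ s, nodal ((insert a s).erase j) x = (X - C (x a)) * nodal (s.erase j) x := by
      intro j hj
      rw [Finset.erase_insert_of_ne (by rintro rfl; exact ha hj), Lagrange.nodal_insert_eq_nodal]
      exact fun h => ha (Finset.mem_of_mem_erase h)
    have hins : ∀ y : ι → ℝ, nodal (insert a s) y = X * nodal s y - C (y a) * nodal s y := fun y => by
      rw [Lagrange.nodal_insert_eq_nodal ha, sub_mul]
    simp only [hins]
    rw [Finset.sum_insert ha, Finset.erase_insert ha,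
      Finset.sum_congr rfl fun j hj => by rw [herase j hj, sub_mul]]
    cases k with
    | zero =>
      simp only [coeff_sub, mul_coeff_zero, coeff_X_zero, zero_mul, zero_sub, coeff_C_zero]
      refine (hpr.fun_mul (ih 0)).fun_neg.congr_fderiv ?_
      ext v
      simp [Finset.mul_sum, mul_assoc]
      exact add_comm _ _
    | succ k =>
      simp only [coeff_sub, coeff_C_mul, coeff_X_mul]
      refine ((ih k).fun_sub (hpr.fun_mul (ih (k + 1)))).congr_fderiv ?_
      ext v
      simp [Finset.mul_sum, sub_mul, mul_assoc, Finset.sum_sub_distrib]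
      ring

/-- The lower coefficients of the monic polynomial with roots `x`. -/
noncomputable def rootCoeffs {n : ℕ} (x : Fin n → ℝ) : Fin n → ℝ := toFn n (rootPoly x)

theorem hasFDerivAt_rootCoeffs {n : ℕ} (x : Fin n → ℝ) :
    HasFDerivAt rootCoeffs (-(Matrix.toLin' (residueMatrix x)).toContinuousLinearMap) x := by
  rw [hasFDerivAt_pi']
  intro k
  refine (hasFDerivAt_coeff_nodal Finset.univ x k).congr_fderiv ?_
  ext v
  simp [Matrix.mulVec, dotProduct, residueMatrix]

theorem continuous_rootCoeffs (n : ℕ) : Continuous (rootCoeffs (n := n)) :=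
  continuous_iff_continuousAt.2 fun x => (hasFDerivAt_rootCoeffs x).continuousAt

theorem monicOf_rootCoeffs {n : ℕ} (x : Fin n → ℝ) : monicOf (rootCoeffs x) = rootPoly x :=
  monicOf_toFn (rootPoly_monic x) (natDegree_rootPoly x)

theorem sort_roots_rootPoly {n : ℕ} {x : Fin n → ℝ} (hx : Monotone x) :
    (rootPoly x).roots.sort (· ≤ ·) = List.ofFn x := by
  rw [roots_rootPoly]
  have : (Finset.univ.val.map x : Multiset ℝ) = (List.ofFn x : Multiset ℝ) := by
    rw [List.ofFn_eq_map, ← Multiset.map_coe]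
    rfl
  rw [this, Multiset.coe_sort]
  exact List.mergeSort_of_pairwise (List.pairwise_ofFn.2 fun i j hij => by simpa using hx hij.le)

theorem orderedRoots_rootPoly {n : ℕ} {x : Fin n → ℝ} (hx : Monotone x) :
    orderedRoots n (rootPoly x) = x := by
  ext i
  rw [orderedRoots, sort_roots_rootPoly hx]
  simp

theorem rootCoeffs_injOn (n : ℕ) : Set.InjOn (rootCoeffs (n := n)) {x | Monotone x} := by
  intro x hx y hy h
  rw [← orderedRoots_rootPoly hx, ← orderedRoots_rootPoly hy, ← monicOf_rootCoeffs, h,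
    monicOf_rootCoeffs]

/-! ### Sums of squares of roots -/

/-- The sum of the squares of the roots, in terms of the coefficients. -/
noncomputable def energy (n : ℕ) (P : ℝ[X]) : ℝ :=
  (X * P).coeff n ^ 2 - 2 * (X * (X * P)).coeff n

theorem coeff_nodal_card {ι : Type*} (s : Finset ι) (x : ι → ℝ) : (nodal s x).coeff s.card = 1 := by
  have := Lagrange.nodal_monic (s := s) (v := x)
  rwa [Monic, leadingCoeff, Lagrange.natDegree_nodal] at this

theorem coeff_X_mul_nodal {ι : Type*} (s : Finset ι) (x : ι → ℝ) :
    (X * nodal s x).coeff s.card = -∑ i ∈ s, x i ∧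
    2 * (X * (X * nodal s x)).coeff s.card = (∑ i ∈ s, x i) ^ 2 - ∑ i ∈ s, x i ^ 2 := by
  classical
  induction s using Finset.induction_on with
  | empty => simp
  | insert a s ha ih =>
    obtain ⟨h1, h2⟩ := ih
    rw [Lagrange.nodal_insert_eq_nodal ha, Finset.card_insert_of_notMem ha, coeff_X_mul,
      coeff_X_mul, sub_mul, mul_sub, coeff_sub, coeff_sub, coeff_C_mul, coeff_nodal_card, h1,
      mul_sub, h2, mul_left_comm X (C _), coeff_C_mul, h1, Finset.sum_insert ha,
      Finset.sum_insert ha]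
    constructor <;> ring

theorem energy_rootPoly {n : ℕ} (x : Fin n → ℝ) : energy n (rootPoly x) = ∑ i, x i ^ 2 := by
  have h := coeff_X_mul_nodal Finset.univ x
  rw [Finset.card_univ, Fintype.card_fin] at h
  rw [energy, rootPoly, h.1, h.2]
  ring

theorem energy_step {n : ℕ} {P R : ℝ[X]} (hP : P.coeff n = 1) (hR : R.degree < n) (a : ℝ) :
    energy (n + 1) ((X - C a) * P - R) = energy n P + a ^ 2 + 2 * (X * R).coeff n := by
  have h1 : R.coeff n = 0 := coeff_eq_zero_of_degree_lt hR
  rw [energy, energy, coeff_X_mul, coeff_X_mul, coeff_sub, sub_mul, coeff_sub, coeff_C_mul, mul_sub,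
    mul_sub, coeff_sub, coeff_sub, mul_left_comm X (C _), coeff_C_mul, hP, h1]
  ring

/-! ### The resultant -/

/-- The absolute value of the resultant of a monic polynomial `P` of degree `n` and a polynomial
`R` of degree at most `n`. -/
noncomputable def absRes (n : ℕ) (P R : ℝ[X]) : ℝ := |P.resultant R n n|

theorem absRes_step {n : ℕ} {P R : ℝ[X]} (hP : P.Monic) (hd : P.natDegree = n)
    (hR : R.degree < n) (a : ℝ) {c : ℝ} (hc : 0 < c) :
    absRes (n + 1) ((X - C a) * P - R) (C c * P) = c ^ (n + 1) * absRes n P R := by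
  obtain ⟨h1, h2⟩ := degree_step hP hd hR a
  have hR' : R.natDegree ≤ n := natDegree_le_of_degree_le hR.le
  have hcP : (C c * P).natDegree ≤ n := by rw [natDegree_C_mul hc.ne', hd]
  have e1 : ((X - C a) * P - R).coeff (n + 1) = 1 := by rw [← h2]; exact h1
  have e2 : P.coeff n = 1 := by rw [← hd]; exact hP
  have e3 : (X - C a) * P - R = C (-1) * R + P * (X - C a) := by simp; ring
  rw [absRes, resultant_add_right_deg _ _ _ _ 1 hcP, e1, one_pow, one_mul, resultant_C_mul_right,
    e3, resultant_add_mul_left _ _ _ _ _ (by rw [natDegree_X_sub_C, add_comm]) hd.le,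
    resultant_C_mul_left, resultant_comm, resultant_add_right_deg _ _ _ _ 1 hR', e2, absRes]
  simp [abs_mul, abs_of_pos hc]

theorem absRes_residuePoly {n : ℕ} {x g : Fin n → ℝ} (hg : ∀ i, 0 < g i) :
    absRes n (rootPoly x) (residuePoly x g) = (∏ i, g i) * absVandermonde x ^ 2 := by
  have h2 : (residuePoly x g).natDegree ≤ n :=
    natDegree_le_of_degree_le (degree_residuePoly_lt x g).le
  rw [absRes, ← prod_prod_erase_abs, ← Finset.prod_mul_distrib]
  have key : (rootPoly x).resultant (residuePoly x g) n n = ∏ i, (residuePoly x g).eval (x i) := by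
    have h3 := resultant_eq_prod_eval (rootPoly x) (residuePoly x g) n h2
      (by rw [rootPoly, Lagrange.nodal_eq]; exact Splits.prod fun i _ => Splits.X_sub_C _)
    rw [natDegree_rootPoly, (rootPoly_monic x).leadingCoeff, one_pow, one_mul, roots_rootPoly,
      Multiset.map_map] at h3
    exact h3
  rw [key, Finset.abs_prod]
  refine Finset.prod_congr rfl fun i _ => ?_
  rw [eval_residuePoly, abs_mul, Finset.abs_prod, abs_of_pos (hg i)]

/-! ### Measurability in the coefficients -/

theorem continuous_coeff_mul_ofFn (n : ℕ) (q : ℝ[X]) (k : ℕ) :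
    Continuous fun r : Fin n → ℝ => (q * ofFn n r).coeff k :=
  LinearMap.continuous_of_finiteDimensional
    ((lcoeff ℝ k).comp ((LinearMap.mulLeft ℝ q).comp (ofFn n)))

theorem continuous_coeff_mul_monicOf (n : ℕ) (q : ℝ[X]) (k : ℕ) :
    Continuous fun p : Fin n → ℝ => (q * monicOf p).coeff k := by
  simp only [monicOf, mul_add, coeff_add]
  exact continuous_const.add (continuous_coeff_mul_ofFn n q k)

theorem continuous_coeff_monicOf (n k : ℕ) :
    Continuous fun p : Fin n → ℝ => (monicOf p).coeff k := by
  simpa using continuous_coeff_mul_monicOf n 1 k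

theorem continuous_coeff_ofFn (n k : ℕ) :
    Continuous fun p : Fin n → ℝ => (ofFn n p).coeff k := by
  simpa using continuous_coeff_mul_ofFn n 1 k

theorem continuous_energy (n : ℕ) : Continuous fun p : Fin n → ℝ => energy n (monicOf p) := by
  simp only [energy, ← mul_assoc]
  exact ((continuous_coeff_mul_monicOf n _ _).pow 2).sub
    (continuous_const.mul (continuous_coeff_mul_monicOf n _ _))

theorem continuous_absRes (n : ℕ) :
    Continuous fun f : (Fin n → ℝ) × (Fin n → ℝ) => absRes n (monicOf f.1) (ofFn n f.2) := by
  unfold absRes resultant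
  refine (Continuous.matrix_det (continuous_matrix fun i j => ?_)).abs
  simp only [sylvester, Matrix.of_apply]
  refine Fin.addCases (fun j => ?_) (fun j => ?_) j
  · simp only [Fin.addCases_left]
    split_ifs
    · exact (continuous_coeff_ofFn n _).comp continuous_snd
    · exact continuous_const
  · simp only [Fin.addCases_right]
    split_ifs
    · exact (continuous_coeff_monicOf n _).comp continuous_fst
    · exact continuous_const

theorem continuous_toFn_residuePoly (n : ℕ) :
    Continuous fun f : (Fin n → ℝ) × (Fin n → ℝ) => toFn n (residuePoly f.1 f.2) := by
  refine continuous_pi fun k => ?_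
  simp only [toFn_apply, residuePoly, finsetSum_coeff, coeff_C_mul]
  refine continuous_finsetSum _ fun j _ => ((continuous_apply j).comp continuous_snd).mul ?_
  exact (continuous_iff_continuousAt.2 fun x =>
    (hasFDerivAt_coeff_nodal (Finset.univ.erase j) x k).continuousAt).comp continuous_fst

theorem isOpen_strictMono (n : ℕ) : IsOpen {x : Fin n → ℝ | StrictMono x} := by
  have : {x : Fin n → ℝ | StrictMono x} = ⋂ i, ⋂ j, ⋂ _ : i < j, {x | x i < x j} := by
    ext x
    simp [StrictMono]
  rw [this]
  exact isOpen_iInter_of_finite fun i => isOpen_iInter_of_finite fun j =>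
    isOpen_iInter_of_finite fun _ => isOpen_lt (continuous_apply i) (continuous_apply j)

theorem residuePoly_injective {n : ℕ} {x : Fin n → ℝ} (hx : StrictMono x) :
    Function.Injective (residuePoly x) := by
  intro g g' h
  ext i
  have h1 := congrArg (eval (x i)) h
  rw [eval_residuePoly, eval_residuePoly] at h1
  refine mul_right_cancel₀ (Finset.prod_ne_zero_iff.2 fun j hj => ?_) h1
  exact sub_ne_zero.2 (hx.injective.ne (Finset.ne_of_mem_erase hj).symm)

theorem mk_mem_spectralPairs_iff {n : ℕ} {x g : Fin n → ℝ} (hx : StrictMono x) :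
    (rootPoly x, residuePoly x g) ∈ spectralPairs n ↔ ∀ i, 0 < g i := by
  refine ⟨?_, fun hg => ⟨x, g, hx, hg, rfl⟩⟩
  rintro ⟨y, g', hy, hg', h⟩
  obtain ⟨h1, h2⟩ := Prod.mk.inj h
  have hxy : x = y := by
    rw [← orderedRoots_rootPoly hx.monotone, h1, orderedRoots_rootPoly hy.monotone]
  subst hxy
  rwa [residuePoly_injective hx h2]

/-- The pairs of coefficient vectors of the elements of `spectralPairs`. -/
def spectralCoeffs (n : ℕ) : Set ((Fin n → ℝ) × (Fin n → ℝ)) :=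
  {f | (monicOf f.1, ofFn n f.2) ∈ spectralPairs n}

theorem measurableSet_spectralCoeffs (n : ℕ) : MeasurableSet (spectralCoeffs n) := by
  have h : spectralCoeffs n = (fun f : (Fin n → ℝ) × (Fin n → ℝ) =>
      (rootCoeffs f.1, toFn n (residuePoly f.1 f.2))) ''
        ({x | StrictMono x} ×ˢ {g | ∀ i, 0 < g i}) := by
    ext f
    constructor
    · rintro ⟨x, g, hx, hg, h⟩
      obtain ⟨h1, h2⟩ := Prod.mk.inj h
      refine ⟨(x, g), ⟨hx, hg⟩, Prod.ext ?_ ?_⟩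
      · simp only [rootCoeffs, ← h1, toFn_monicOf]
      · simp only [← h2, toFn_comp_ofFn_eq_id]
    · rintro ⟨⟨x, g⟩, ⟨hx, hg⟩, rfl⟩
      refine ⟨x, g, hx, hg, Prod.ext ?_ ?_⟩
      · exact monicOf_rootCoeffs x
      · exact ofFn_toFn_of_degree_lt (degree_residuePoly_lt x g)
  rw [h]
  refine MeasurableSet.image_of_continuousOn_injOn ?_ ?_ ?_
  · refine (isOpen_strictMono n).measurableSet.prod ?_
    rw [show {g : Fin n → ℝ | ∀ i, 0 < g i} = ⋂ i, {g | 0 < g i} by ext; simp]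
    exact MeasurableSet.iInter fun i => measurableSet_lt measurable_const (measurable_pi_apply i)
  · exact (((continuous_rootCoeffs n).comp continuous_fst).prodMk
      (continuous_toFn_residuePoly n)).continuousOn
  · rintro ⟨x, g⟩ ⟨hx, hg⟩ ⟨y, g'⟩ ⟨hy, hg'⟩ h
    obtain ⟨h1, h2⟩ := Prod.mk.inj h
    obtain rfl := rootCoeffs_injOn n (StrictMono.monotone hx) (StrictMono.monotone hy) h1
    refine Prod.ext rfl (residuePoly_injective hx ?_)
    have := congrArg (ofFn n) h2
    rwa [ofFn_toFn_of_degree_lt (degree_residuePoly_lt _ _),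
      ofFn_toFn_of_degree_lt (degree_residuePoly_lt _ _)] at this

/-- The unnormalized joint density of the coefficients of the characteristic polynomials of two
consecutive minors of the `β`-Hermite Jacobi matrix. -/
noncomputable def spectralDensity (β : ℝ) (n : ℕ) (f : (Fin n → ℝ) × (Fin n → ℝ)) : ℝ≥0∞ :=
  (spectralCoeffs n).indicator (fun f => ENNReal.ofReal
    (Real.exp (-(β / 4) * energy n (monicOf f.1) - β / 2 * (X * ofFn n f.2).coeff n) *
      absRes n (monicOf f.1) (ofFn n f.2) ^ (β / 2 - 1))) f

theorem measurable_spectralDensity (β : ℝ) (n : ℕ) : Measurable (spectralDensity β n) := by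
  refine Measurable.indicator ?_ (measurableSet_spectralCoeffs n)
  refine ENNReal.measurable_ofReal.comp (Measurable.mul ?_ ?_)
  · refine Real.measurable_exp.comp (Measurable.sub ?_ ?_)
    · exact ((continuous_energy n).comp continuous_fst).measurable.const_mul _
    · exact ((continuous_coeff_mul_ofFn n X n).comp continuous_snd).measurable.const_mul _
  · exact (continuous_absRes n).measurable.pow_const _

/-! ### One step of the three-term recursion -/

/-- The coefficients of the next characteristic polynomial. -/
noncomputable def stepP {n : ℕ} (p r : Fin n → ℝ) (a : ℝ) : Fin (n + 1) → ℝ :=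
  toFn (n + 1) ((X - C a) * monicOf p - ofFn n r)

/-- The coefficients of the current characteristic polynomial, scaled. -/
noncomputable def stepR {n : ℕ} (p : Fin n → ℝ) (c : ℝ) : Fin (n + 1) → ℝ :=
  toFn (n + 1) (C c * monicOf p)

theorem monicOf_stepP {n : ℕ} (p r : Fin n → ℝ) (a : ℝ) :
    monicOf (stepP p r a) = (X - C a) * monicOf p - ofFn n r := by
  have h := degree_step (monicOf_monic p) (natDegree_monicOf p) (ofFn_degree_lt r) a
  exact monicOf_toFn h.1 h.2

theorem ofFn_stepR {n : ℕ} (p : Fin n → ℝ) (c : ℝ) : ofFn (n + 1) (stepR p c) = C c * monicOf p := by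
  refine ofFn_toFn_of_degree_lt ?_
  rw [C_mul']
  refine (degree_smul_le _ _).trans_lt ?_
  rw [degree_eq_natDegree (monicOf_monic p).ne_zero, natDegree_monicOf]
  exact_mod_cast Nat.lt_succ_self n

theorem coeff_monicOf_self {n : ℕ} (p : Fin n → ℝ) : (monicOf p).coeff n = 1 := by
  have := monicOf_monic p
  rwa [Monic, leadingCoeff, natDegree_monicOf] at this

theorem coeff_monicOf_of_lt {n : ℕ} (p : Fin n → ℝ) (k : Fin n) : (monicOf p).coeff k = p k := by
  rw [← toFn_apply, toFn_monicOf]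

theorem stepP_eq_snoc {n : ℕ} (p r : Fin n → ℝ) (a : ℝ) :
    stepP p r a = Fin.snoc (α := fun _ => ℝ) (toFn n ((X - C a) * monicOf p) - r)
      ((X * monicOf p).coeff n - a) := by
  ext k
  refine Fin.lastCases ?_ (fun k => ?_) k
  · simp [stepP, toFn_apply, sub_mul, coeff_monicOf_self]
  · simp [stepP, toFn_apply]

theorem stepR_eq_snoc {n : ℕ} (p : Fin n → ℝ) (c : ℝ) :
    stepR p c = Fin.snoc (α := fun _ => ℝ) (c • p) c := by
  ext k
  refine Fin.lastCases ?_ (fun k => ?_) k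
  · simp [stepR, toFn_apply, coeff_monicOf_self]
  · simp [stepR, toFn_apply, coeff_monicOf_of_lt]

theorem spectralDensity_step {β : ℝ} {n : ℕ} (p r : Fin n → ℝ) (a : ℝ) {c : ℝ} (hc : 0 < c) :
    spectralDensity β n (p, r) * (ENNReal.ofReal (Real.exp (-(β / 4) * a ^ 2)) *
      ENNReal.ofReal (c ^ (((n : ℝ) + 1) * β / 2 - 1) * Real.exp (-(β / 2 * c)))) =
    spectralDensity β (n + 1) (stepP p r a, stepR p c) * ENNReal.ofReal (c ^ n) := by
  have hmem : (stepP p r a, stepR p c) ∈ spectralCoeffs (n + 1) ↔ (p, r) ∈ spectralCoeffs n := by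
    simp only [spectralCoeffs, Set.mem_ofPred_eq, monicOf_stepP, ofFn_stepR]
    exact ⟨spectralPairs_of_step (monicOf_monic p) (natDegree_monicOf p) (ofFn_degree_lt r) hc,
      fun h => spectralPairs_step h a hc⟩
  by_cases h : (p, r) ∈ spectralCoeffs n
  · rw [spectralDensity, spectralDensity, Set.indicator_of_mem h, Set.indicator_of_mem (hmem.2 h)]
    dsimp only
    rw [monicOf_stepP, ofFn_stepR, energy_step (coeff_monicOf_self p) (ofFn_degree_lt r),
      absRes_step (monicOf_monic p) (natDegree_monicOf p) (ofFn_degree_lt r) a hc, coeff_X_mul,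
      coeff_C_mul, coeff_monicOf_self]
    have h0 : 0 ≤ absRes n (monicOf p) (ofFn n r) := abs_nonneg _
    rw [← ENNReal.ofReal_mul (by positivity), ← ENNReal.ofReal_mul (by positivity),
      ← ENNReal.ofReal_mul (by positivity)]
    congr 1
    have e0 : (c ^ (n + 1)) ^ (β / 2 - 1) = c ^ (((n + 1 : ℕ) : ℝ) * (β / 2 - 1)) := by
      rw [← Real.rpow_natCast, ← Real.rpow_mul hc.le]
    rw [Real.mul_rpow (by positivity) h0, e0]
    have e1 : c ^ (((n : ℝ) + 1) * β / 2 - 1) =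
        c ^ (((n + 1 : ℕ) : ℝ) * (β / 2 - 1)) * c ^ n := by
      rw [← Real.rpow_natCast c n, ← Real.rpow_add hc]
      congr 1
      push_cast
      ring
    have e2 : Real.exp (-(β / 4) * (energy n (monicOf p) + a ^ 2 + 2 * (X * ofFn n r).coeff n) -
        β / 2 * (c * 1)) = Real.exp (-(β / 4) * energy n (monicOf p) -
          β / 2 * (X * ofFn n r).coeff n) * Real.exp (-(β / 4) * a ^ 2) *
          Real.exp (-(β / 2 * c)) := by
      rw [← Real.exp_add, ← Real.exp_add]
      congr 1
      ring
    rw [e1, e2]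
    ring
  · rw [spectralDensity, spectralDensity, Set.indicator_of_notMem h,
      Set.indicator_of_notMem (hmem.not.2 h), zero_mul, zero_mul]

theorem lintegral_snoc {n : ℕ} {K : (Fin (n + 1) → ℝ) → ℝ≥0∞} (hK : Measurable K) :
    ∫⁻ p, K p = ∫⁻ t : ℝ, ∫⁻ q : Fin n → ℝ, K (Fin.snoc (α := fun _ => ℝ) q t) := by
  have h := (volume_preserving_piFinSuccAbove (fun _ : Fin (n + 1) => ℝ) (Fin.last n)).symm
  rw [← h.lintegral_comp hK, Measure.volume_eq_prod, lintegral_prod _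
    (by exact (hK.comp (MeasurableEquiv.measurable _)).aemeasurable)]
  refine lintegral_congr fun t => lintegral_congr fun q => ?_
  congr 1
  rw [MeasurableEquiv.piFinSuccAbove_symm_apply]
  exact Fin.insertNth_last' (β := ℝ) t q

theorem measurable_snoc (n : ℕ) :
    Measurable fun f : ℝ × (Fin n → ℝ) => (Fin.snoc (α := fun _ => ℝ) f.2 f.1 : Fin (n + 1) → ℝ) := by
  refine measurable_pi_lambda _ fun k => ?_
  refine Fin.lastCases ?_ (fun k => ?_) k
  · simpa using measurable_fst
  · simp only [Fin.snoc_castSucc]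
    exact (measurable_pi_apply k).comp measurable_snd

theorem lintegral_const_smul_comp {n : ℕ} {L : (Fin n → ℝ) → ℝ≥0∞} (hL : Measurable L) {c : ℝ}
    (hc : 0 < c) : ENNReal.ofReal (c ^ n) * ∫⁻ p, L (c • p) = ∫⁻ q, L q := by
  have h := Measure.map_addHaar_smul (volume : Measure (Fin n → ℝ)) hc.ne'
  rw [← lintegral_map hL (by fun_prop : Measurable fun p : Fin n → ℝ => c • p), h,
    lintegral_smul_measure, smul_eq_mul, ← mul_assoc, ← ENNReal.ofReal_mul (by positivity)]
  simp [abs_of_pos (pow_pos hc n), mul_inv_cancel₀ (pow_pos hc n).ne']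

/-- The change of variables of one step of the three-term recursion. -/
theorem lintegral_step {n : ℕ} {K : (Fin (n + 1) → ℝ) × (Fin (n + 1) → ℝ) → ℝ≥0∞}
    (hK : Measurable K) (hK0 : ∀ p r, r (Fin.last n) ≤ 0 → K (p, r) = 0) :
    ∫⁻ c in Set.Ioi (0 : ℝ), ∫⁻ p : Fin n → ℝ, ∫⁻ a : ℝ, ∫⁻ r : Fin n → ℝ,
      K (stepP p r a, stepR p c) * ENNReal.ofReal (c ^ n) = ∫⁻ r, ∫⁻ p, K (p, r) := by
  have h1 : ∀ (c : ℝ) (p : Fin n → ℝ), ∫⁻ a : ℝ, ∫⁻ r : Fin n → ℝ,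
      K (stepP p r a, stepR p c) * ENNReal.ofReal (c ^ n) =
      ENNReal.ofReal (c ^ n) * ∫⁻ q, K (q, Fin.snoc (α := fun _ => ℝ) (c • p) c) := fun c p => by
    have hm : Measurable fun q => K (q, Fin.snoc (α := fun _ => ℝ) (c • p) c) := by fun_prop
    have h2 : ∀ a : ℝ, ∫⁻ r : Fin n → ℝ, K (stepP p r a, stepR p c) * ENNReal.ofReal (c ^ n) =
        ENNReal.ofReal (c ^ n) * ∫⁻ q : Fin n → ℝ, K (Fin.snoc (α := fun _ => ℝ) q
          ((X * monicOf p).coeff n - a), Fin.snoc (α := fun _ => ℝ) (c • p) c) := fun a => by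
      simp only [stepP_eq_snoc, stepR_eq_snoc]
      rw [lintegral_mul_const' _ _ ENNReal.ofReal_ne_top, mul_comm]
      congr 1
      exact lintegral_sub_left_eq_self (μ := volume) (fun q : Fin n → ℝ => K (Fin.snoc (α := fun _ => ℝ) q
          ((X * monicOf p).coeff n - a), Fin.snoc (α := fun _ => ℝ) (c • p) c)) _
    simp only [h2]
    rw [lintegral_const_mul' _ _ ENNReal.ofReal_ne_top, lintegral_snoc hm]
    congr 1
    exact lintegral_sub_left_eq_self (μ := volume) (fun t : ℝ => ∫⁻ q : Fin n → ℝ, K (Fin.snoc (α := fun _ => ℝ) q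
      t, Fin.snoc (α := fun _ => ℝ) (c • p) c)) _
  simp only [h1]
  have hm : Measurable fun r => ∫⁻ p, K (p, r) := hK.lintegral_prod_left'
  have h3 : ∀ c ∈ Set.Ioi (0 : ℝ), ∫⁻ p : Fin n → ℝ,
      ENNReal.ofReal (c ^ n) * ∫⁻ q, K (q, Fin.snoc (α := fun _ => ℝ) (c • p) c) =
      ∫⁻ s : Fin n → ℝ, ∫⁻ q, K (q, Fin.snoc (α := fun _ => ℝ) s c) := fun c hc => by
    rw [lintegral_const_mul' _ _ ENNReal.ofReal_ne_top]
    exact lintegral_const_smul_comp (L := fun s => ∫⁻ q, K (q, Fin.snoc (α := fun _ => ℝ) s c))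
      (hm.comp ((measurable_snoc n).comp measurable_prodMk_left)) hc
  rw [setLIntegral_congr_fun measurableSet_Ioi h3, lintegral_snoc hm,
    ← lintegral_indicator measurableSet_Ioi]
  refine lintegral_congr fun t => ?_
  by_cases ht : 0 < t
  · rw [Set.indicator_of_mem (by exact ht)]
  · rw [Set.indicator_of_notMem (by exact ht)]
    have : ∀ (q : Fin n → ℝ) p, K (p, Fin.snoc (α := fun _ => ℝ) q t) = 0 := fun q p =>
      hK0 _ _ (by simpa using ht)
    simp [this]

theorem spectralDensity_eq_zero {β : ℝ} {n : ℕ} (p r : Fin (n + 1) → ℝ) (h : r (Fin.last n) ≤ 0) :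
    spectralDensity β (n + 1) (p, r) = 0 := by
  rw [spectralDensity, Set.indicator_of_notMem]
  rintro ⟨x, g, hx, hg, h2⟩
  have h3 := (Prod.mk.inj h2).2
  have h4 : (ofFn (n + 1) r).coeff n = ∑ i, g i := by rw [h3, coeff_residuePoly_last]
  rw [ofFn_coeff_eq_val_of_lt r (Nat.lt_succ_self n)] at h4
  have : 0 < ∑ i, g i := Finset.sum_pos (fun i _ => hg i) Finset.univ_nonempty
  rw [← h4] at this
  exact absurd this h.not_gt

/-! ### The three-term recursion -/

/-- The monic orthogonal polynomials of the Jacobi matrix with diagonal `a` and squared off-diagonal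
`c`; the second component is the previous polynomial scaled by the last squared off-diagonal
entry. -/
noncomputable def opPair (a c : ℕ → ℝ) : ℕ → ℝ[X] × ℝ[X]
  | 0 => (1, 0)
  | n + 1 => ((X - C (a n)) * (opPair a c n).1 - (opPair a c n).2, C (c n) * (opPair a c n).1)

theorem opPair_congr {a c a' c' : ℕ → ℝ} (n : ℕ) (ha : ∀ k < n, a k = a' k)
    (hc : ∀ k < n, c k = c' k) : opPair a c n = opPair a' c' n := by
  induction n with
  | zero => rfl
  | succ n ih =>
    rw [opPair, opPair, ih (fun k hk => ha k (hk.trans n.lt_succ_self))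
      (fun k hk => hc k (hk.trans n.lt_succ_self)), ha n n.lt_succ_self, hc n n.lt_succ_self]

theorem opPair_degree (a c : ℕ → ℝ) (n : ℕ) :
    ((opPair a c n).1.Monic ∧ (opPair a c n).1.natDegree = n) ∧ (opPair a c n).2.degree < n := by
  induction n with
  | zero => simp [opPair]
  | succ n ih =>
    refine ⟨degree_step ih.1.1 ih.1.2 ih.2 _, ?_⟩
    rw [opPair, C_mul']
    refine (degree_smul_le _ _).trans_lt ?_
    rw [degree_eq_natDegree ih.1.1.ne_zero, ih.1.2]
    exact_mod_cast Nat.lt_succ_self n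

theorem opPair_mem_spectralPairs (a : ℕ → ℝ) {c : ℕ → ℝ} (hc : ∀ k, 0 < c k) (n : ℕ) :
    opPair a c n ∈ spectralPairs n := by
  induction n with
  | zero =>
    exact ⟨0, 0, Subsingleton.strictMono _, fun i => i.elim0, by simp [opPair, rootPoly, residuePoly]⟩
  | succ n ih => exact spectralPairs_step ih _ (hc n)

/-- The coefficient vectors of `opPair`. -/
noncomputable def opCoeffs (n : ℕ) (v : ℕ ⊕ ℕ → ℝ) : (Fin n → ℝ) × (Fin n → ℝ) :=
  (toFn n (opPair (v ∘ Sum.inl) (v ∘ Sum.inr) n).1, toFn n (opPair (v ∘ Sum.inl) (v ∘ Sum.inr) n).2)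

theorem opCoeffs_succ (n : ℕ) (v : ℕ ⊕ ℕ → ℝ) :
    opCoeffs (n + 1) v = (stepP (opCoeffs n v).1 (opCoeffs n v).2 (v (Sum.inl n)),
      stepR (opCoeffs n v).1 (v (Sum.inr n))) := by
  obtain ⟨⟨h1, h2⟩, h3⟩ := opPair_degree (v ∘ Sum.inl) (v ∘ Sum.inr) n
  simp only [opCoeffs, stepP, stepR, opPair, monicOf_toFn h1 h2, ofFn_toFn_of_degree_lt h3,
    Function.comp_apply]

theorem measurable_stepP (n : ℕ) : Measurable fun f : ((Fin n → ℝ) × (Fin n → ℝ)) × ℝ =>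
    stepP f.1.1 f.1.2 f.2 := by
  have hp : Measurable fun f : ((Fin n → ℝ) × (Fin n → ℝ)) × ℝ => f.1.1 := measurable_fst.fst
  have h1 : Measurable fun f : ((Fin n → ℝ) × (Fin n → ℝ)) × ℝ =>
      (X * monicOf f.1.1).coeff n - f.2 :=
    ((continuous_coeff_mul_monicOf n X n).measurable.comp hp).sub measurable_snd
  have h2 : Measurable fun f : ((Fin n → ℝ) × (Fin n → ℝ)) × ℝ =>
      toFn n ((X - C f.2) * monicOf f.1.1) - f.1.2 := by
    refine Measurable.sub (measurable_pi_lambda _ fun k => ?_) measurable_fst.snd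
    simp only [sub_mul, toFn_apply, coeff_sub, coeff_C_mul]
    exact ((continuous_coeff_mul_monicOf n X k).measurable.comp hp).sub
      (measurable_snd.mul ((continuous_coeff_monicOf n k).measurable.comp hp))
  simp only [stepP_eq_snoc]
  exact (measurable_snoc n).comp (h1.prodMk h2)

theorem measurable_stepR (n : ℕ) : Measurable fun f : (Fin n → ℝ) × ℝ => stepR f.1 f.2 := by
  simp only [stepR_eq_snoc]
  exact (measurable_snoc n).comp (measurable_snd.prodMk (measurable_snd.smul measurable_fst))

section Measurability

attribute [local irreducible] stepP stepR opCoeffs spectralDensity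

theorem measurable_opCoeffs (n : ℕ) : Measurable (opCoeffs n) := by
  induction n with
  | zero =>
    exact measurable_of_subsingleton_codomain _
  | succ n ih =>
    simp only [funext (opCoeffs_succ n)]
    refine Measurable.prodMk ?_ ?_
    · exact (measurable_stepP n).comp (f := fun v => (opCoeffs n v, v (Sum.inl n)))
        (ih.prodMk (measurable_pi_apply _))
    · exact (measurable_stepR n).comp (f := fun v => ((opCoeffs n v).1, v (Sum.inr n)))
        (ih.fst.prodMk (measurable_pi_apply _))

/-! ### Independence -/

section Law

variable {Ω : Type*} [MeasurableSpace Ω] {P : Measure Ω}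

/-- The indices below `n`. -/
def indexBelow (n : ℕ) : Finset (ℕ ⊕ ℕ) := (Finset.range n).disjSum (Finset.range n)

theorem indepFun_opCoeffs {f : ℕ ⊕ ℕ → Ω → ℝ} (hf : ∀ i, Measurable (f i)) (hi : iIndepFun f P)
    (n : ℕ) : IndepFun (fun ω => opCoeffs n fun i => f i ω)
      (fun ω => (f (Sum.inl n) ω, f (Sum.inr n) ω)) P := by
  classical
  have hd : Disjoint (indexBelow n) {Sum.inl n, Sum.inr n} := by
    rw [Finset.disjoint_left]
    rintro (k | k) hk hk2
    · simp [indexBelow] at hk hk2; omega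
    · simp [indexBelow] at hk hk2; omega
  have h := hi.indepFun_finset (indexBelow n) {Sum.inl n, Sum.inr n} hd hf
  let φ : (indexBelow n → ℝ) → (ℕ ⊕ ℕ → ℝ) := fun v i => if h : i ∈ indexBelow n then v ⟨i, h⟩ else 0
  have hφ : Measurable φ := measurable_pi_lambda _ fun i => by
    by_cases h : i ∈ indexBelow n
    · simp only [φ, dif_pos h]; exact measurable_pi_apply _
    · simp only [φ, dif_neg h]; exact measurable_const
  let ψ : (({Sum.inl n, Sum.inr n} : Finset (ℕ ⊕ ℕ)) → ℝ) → ℝ × ℝ := fun v =>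
    (v ⟨Sum.inl n, by simp⟩, v ⟨Sum.inr n, by simp⟩)
  have hψ : Measurable ψ := (measurable_pi_apply _).prodMk (measurable_pi_apply _)
  have h2 := h.comp ((measurable_opCoeffs n).comp hφ) hψ
  refine (h2.congr (Filter.EventuallyEq.of_eq ?_) (Filter.EventuallyEq.of_eq rfl))
  funext ω
  have : opPair ((fun i => f i ω) ∘ Sum.inl) ((fun i => f i ω) ∘ Sum.inr) n =
      opPair (φ (fun i => f i ω) ∘ Sum.inl) (φ (fun i => f i ω) ∘ Sum.inr) n :=
    opPair_congr n (fun k hk => by simp [φ, indexBelow, hk]) (fun k hk => by simp [φ, indexBelow, hk])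
  simp only [opCoeffs, Function.comp_apply]
  exact (congrArg (fun q : ℝ[X] × ℝ[X] => (toFn n q.1, toFn n q.2)) this).symm

/-- The density, up to a constant, of the diagonal entries. -/
noncomputable def diagDensity (β x : ℝ) : ℝ≥0∞ := ENNReal.ofReal (Real.exp (-(β / 4) * x ^ 2))

/-- The density, up to a constant, of the squared off-diagonal entries. -/
noncomputable def offDiagDensity (β : ℝ) (k : ℕ) (x : ℝ) : ℝ≥0∞ :=
  ENNReal.ofReal (x ^ (((k : ℝ) + 1) * β / 2 - 1) * Real.exp (-(β / 2 * x)))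

theorem measurable_diagDensity (β : ℝ) : Measurable (diagDensity β) := by
  unfold diagDensity; fun_prop

theorem measurable_offDiagDensity (β : ℝ) (k : ℕ) : Measurable (offDiagDensity β k) := by
  unfold offDiagDensity; fun_prop

theorem lintegral_of_eq_smul_withDensity {α : Type*} [MeasurableSpace α] {μ ν : Measure α}
    {w : α → ℝ≥0∞} {C : ℝ≥0∞} (hw : Measurable w) (h : μ = C • ν.withDensity w) {f : α → ℝ≥0∞}
    (hf : Measurable f) : ∫⁻ x, f x ∂μ = C * ∫⁻ x, f x * w x ∂ν := by
  rw [h, lintegral_smul_measure, lintegral_withDensity_eq_lintegral_mul _ hw hf, smul_eq_mul]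
  simp only [Pi.mul_apply, mul_comm]

theorem lintegral_prod_of_eq_smul_withDensity {α β γ : Type*} [MeasurableSpace α]
    [MeasurableSpace β] [MeasurableSpace γ] {μ₁ ν₁ : Measure α} {μ₂ ν₂ : Measure β}
    {μ₃ ν₃ : Measure γ} [SFinite μ₁] [SFinite μ₂] [SFinite μ₃] [SFinite ν₁] [SFinite ν₂]
    {C₁ C₂ C₃ : ℝ≥0∞} {w₁ : α → ℝ≥0∞} {w₂ : β → ℝ≥0∞} {w₃ : γ → ℝ≥0∞}
    (hw₁ : Measurable w₁) (hw₂ : Measurable w₂) (hw₃ : Measurable w₃)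
    (h₁ : μ₁ = C₁ • ν₁.withDensity w₁) (h₂ : μ₂ = C₂ • ν₂.withDensity w₂)
    (h₃ : μ₃ = C₃ • ν₃.withDensity w₃) {G : α × (β × γ) → ℝ≥0∞} (hG : Measurable G) :
    ∫⁻ z, G z ∂(μ₁.prod (μ₂.prod μ₃)) = C₃ * (C₂ * C₁) *
      ∫⁻ z, ∫⁻ y, ∫⁻ x, G (x, (y, z)) * (w₁ x * (w₂ y * w₃ z)) ∂ν₁ ∂ν₂ ∂ν₃ := by
  have m1 : Measurable fun y => ∫⁻ x, G (x, y) ∂μ₁ := hG.lintegral_prod_left'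
  have m2 : Measurable fun z => ∫⁻ y, ∫⁻ x, G (x, (y, z)) ∂μ₁ ∂μ₂ :=
    m1.lintegral_prod_left'
  rw [lintegral_prod_symm _ hG.aemeasurable, lintegral_prod_symm _ m1.aemeasurable,
    lintegral_of_eq_smul_withDensity hw₃ h₃ m2, mul_assoc, mul_assoc]
  congr 1
  have m3 : Measurable fun z => ∫⁻ y, ∫⁻ x, G (x, (y, z)) * (w₁ x * (w₂ y * w₃ z)) ∂ν₁ ∂ν₂ := by
    fun_prop
  have m4 : Measurable fun y => ∫⁻ x, G (x, y) * w₁ x ∂ν₁ := by fun_prop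
  rw [← lintegral_const_mul _ m3, ← lintegral_const_mul _ (by fun_prop)]
  refine lintegral_congr fun z => ?_
  have m5 : Measurable fun y => ∫⁻ x, G (x, (y, z)) ∂μ₁ := m1.comp measurable_prodMk_right
  have m6 : Measurable fun y => ∫⁻ x, G (x, (y, z)) * w₁ x ∂ν₁ := m4.comp measurable_prodMk_right
  rw [lintegral_of_eq_smul_withDensity hw₂ h₂ m5, mul_assoc]
  congr 1
  have m8 : ∀ y, ∫⁻ x, G (x, (y, z)) ∂μ₁ = C₁ * ∫⁻ x, G (x, (y, z)) * w₁ x ∂ν₁ := fun y =>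
    lintegral_of_eq_smul_withDensity hw₁ h₁ (hG.comp measurable_prodMk_right)
  simp only [m8]
  rw [← lintegral_mul_const _ (by exact (m6.const_mul C₁).mul hw₂), ← lintegral_const_mul _ (by fun_prop)]
  refine lintegral_congr fun y => ?_
  have m7 : Measurable fun x => G (x, (y, z)) := hG.comp measurable_prodMk_right
  rw [mul_assoc, mul_assoc]
  congr 1
  rw [← lintegral_mul_const _ (by exact m7.mul hw₁)]
  exact lintegral_congr fun x => by ring

theorem map_opCoeffs [IsProbabilityMeasure P] {β : ℝ} {f : ℕ ⊕ ℕ → Ω → ℝ} (hf : ∀ i, Measurable (f i)) (hi : iIndepFun f P)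
    (ha : ∀ k, ∃ C : ℝ≥0∞, P.map (f (Sum.inl k)) = C • volume.withDensity (diagDensity β))
    (hc : ∀ k, ∃ C : ℝ≥0∞, P.map (f (Sum.inr k)) =
      C • (volume.restrict (Set.Ioi 0)).withDensity (offDiagDensity β k)) (n : ℕ) :
    ∃ C : ℝ≥0∞, P.map (fun ω => opCoeffs n fun i => f i ω) =
      C • volume.withDensity (spectralDensity β n) := by
  have hm : ∀ n, Measurable fun ω => opCoeffs n fun i => f i ω := fun n =>
    (measurable_opCoeffs n).comp (measurable_pi_lambda _ hf)
  induction n with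
  | zero =>
    refine ⟨1, ?_⟩
    have h1 : (fun ω => opCoeffs 0 fun i => f i ω) = fun _ => 0 := funext fun _ => Subsingleton.elim _ _
    have h2 : spectralDensity β 0 = 1 := by
      funext g
      have hg : g ∈ spectralCoeffs 0 := by
        refine ⟨0, 0, Subsingleton.strictMono _, fun i => i.elim0, ?_⟩
        simp [monicOf, rootPoly, residuePoly]
      rw [spectralDensity, Set.indicator_of_mem hg]
      simp [energy, monicOf, absRes]
    rw [h1, h2, withDensity_one, one_smul, Measure.map_const, measure_univ, one_smul,
      Measure.volume_eq_prod, volume_pi, Measure.pi_of_empty (x := 0),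
      Measure.dirac_prod_dirac]
    rfl
  | succ n ih =>
    obtain ⟨C₁, h1⟩ := ih
    obtain ⟨C₂, h2⟩ := ha n
    obtain ⟨C₃, h3⟩ := hc n
    refine ⟨C₃ * (C₂ * C₁), Measure.ext_of_lintegral _ fun F hF => ?_⟩
    have hD := measurable_spectralDensity β n
    have hD' := measurable_spectralDensity β (n + 1)
    have hA := measurable_diagDensity β
    have hH := measurable_offDiagDensity β n
    have hind := (indepFun_iff_map_prod_eq_prod_map_map (hm n).aemeasurable
      ((hf _).prodMk (hf _)).aemeasurable).1 (indepFun_opCoeffs hf hi n)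
    have hind2 := (indepFun_iff_map_prod_eq_prod_map_map (hf (Sum.inl n)).aemeasurable
      (hf (Sum.inr n)).aemeasurable).1 (hi.indepFun (by simp))
    have hp1 : IsProbabilityMeasure (P.map fun ω => opCoeffs n fun i => f i ω) :=
      Measure.isProbabilityMeasure_map (hm n).aemeasurable
    have hp2 : IsProbabilityMeasure (P.map (f (Sum.inl n))) :=
      Measure.isProbabilityMeasure_map (hf _).aemeasurable
    have hp3 : IsProbabilityMeasure (P.map (f (Sum.inr n))) :=
      Measure.isProbabilityMeasure_map (hf _).aemeasurable
    let S : ((Fin n → ℝ) × (Fin n → ℝ)) × (ℝ × ℝ) → (Fin (n + 1) → ℝ) × (Fin (n + 1) → ℝ) :=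
      fun z => (stepP z.1.1 z.1.2 z.2.1, stepR z.1.1 z.2.2)
    have hS : Measurable S :=
      ((measurable_stepP n).comp (measurable_fst.prodMk measurable_snd.fst)).prodMk
        ((measurable_stepR n).comp (measurable_fst.fst.prodMk measurable_snd.snd))
    have hFS : Measurable fun z => F (S z) := hF.comp hS
    rw [lintegral_map hF (hm _), lintegral_smul_measure,
      lintegral_withDensity_eq_lintegral_mul _ hD' hF]
    have e1 : ∫⁻ ω, F (opCoeffs (n + 1) fun i => f i ω) ∂P =
        ∫⁻ z, F (S z) ∂(P.map fun ω => (opCoeffs n fun i => f i ω, (f (Sum.inl n) ω,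
          f (Sum.inr n) ω))) := by
      rw [lintegral_map hFS ((hm n).prodMk ((hf _).prodMk (hf _)))]
      simp only [opCoeffs_succ, S]
    rw [e1, hind, hind2, lintegral_prod_of_eq_smul_withDensity hD hA hH h1 h2 h3 hFS, smul_eq_mul]
    congr 1
    have mK : Measurable fun z => (spectralDensity β (n + 1) * F) z := hD'.mul hF
    rw [Measure.volume_eq_prod (Fin (n + 1) → ℝ) (Fin (n + 1) → ℝ), lintegral_prod_symm _ mK.aemeasurable, ← lintegral_step mK ?_]
    swap
    · intro p r hr
      simp [spectralDensity_eq_zero p r hr]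
    refine setLIntegral_congr_fun measurableSet_Ioi fun c hc => ?_
    have m1 : ∀ a, Measurable fun x => F (S (x, (a, c))) * (spectralDensity β n x *
        (diagDensity β a * offDiagDensity β n c)) := fun a =>
      (hFS.comp measurable_prodMk_right).mul (hD.mul measurable_const)
    have m2 : Measurable fun z : ℝ × ((Fin n → ℝ) × (Fin n → ℝ)) => F (S (z.2, (z.1, c))) *
        (spectralDensity β n z.2 * (diagDensity β z.1 * offDiagDensity β n c)) :=
      (hFS.comp (measurable_snd.prodMk (measurable_fst.prodMk measurable_const))).mul
        ((hD.comp measurable_snd).mul ((hA.comp measurable_fst).mul measurable_const))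
    have e4 : ∀ a, ∫⁻ x, F (S (x, (a, c))) * (spectralDensity β n x *
          (diagDensity β a * offDiagDensity β n c)) =
        ∫⁻ p, ∫⁻ r, F (S ((p, r), (a, c))) * (spectralDensity β n (p, r) *
          (diagDensity β a * offDiagDensity β n c)) := fun a => by
      rw [Measure.volume_eq_prod, lintegral_prod _ (m1 a).aemeasurable]
    have m3 : Measurable fun z : ℝ × (Fin n → ℝ) => ∫⁻ r, F (S ((z.2, r), (z.1, c))) *
        (spectralDensity β n (z.2, r) * (diagDensity β z.1 * offDiagDensity β n c)) := by
      have := m2.comp (f := fun z : (ℝ × (Fin n → ℝ)) × (Fin n → ℝ) => (z.1.1, (z.1.2, z.2)))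
        (by fun_prop)
      exact this.lintegral_prod_right'
    simp only [e4]
    rw [lintegral_lintegral_swap m3.aemeasurable]
    refine lintegral_congr fun p => lintegral_congr fun a => lintegral_congr fun r => ?_
    have := spectralDensity_step (β := β) p r a hc
    simp only [Pi.mul_apply, S, diagDensity, offDiagDensity]
    rw [this]
    ring

end Law

end Measurability

/-! ### The law of the ordered roots -/

/-- The normalization of the residues. -/
noncomputable def residueMass (β : ℝ) (n : ℕ) : ℝ≥0∞ :=
  ∫⁻ g in {g : Fin n → ℝ | ∀ i, 0 < g i},
    ENNReal.ofReal (Real.exp (-(β / 2) * ∑ i, g i) * (∏ i, g i) ^ (β / 2 - 1))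

theorem measurableSet_forall_pos (n : ℕ) : MeasurableSet {g : Fin n → ℝ | ∀ i, 0 < g i} := by
  rw [show {g : Fin n → ℝ | ∀ i, 0 < g i} = ⋂ i, {g | 0 < g i} by ext; simp]
  exact MeasurableSet.iInter fun i => measurableSet_lt measurable_const (measurable_pi_apply i)

theorem coeff_X_mul_residuePoly {n : ℕ} (x g : Fin n → ℝ) :
    (X * residuePoly x g).coeff n = ∑ i, g i := by
  cases n with
  | zero => simp
  | succ n => rw [coeff_X_mul, coeff_residuePoly_last]

theorem spectralDensity_residue {β : ℝ} {n : ℕ} {x : Fin n → ℝ} (hx : StrictMono x)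
    (g : Fin n → ℝ) :
    spectralDensity β n (rootCoeffs x, toFn n (residuePoly x g)) =
      ENNReal.ofReal (Real.exp (-(β / 4) * ∑ i, x i ^ 2) * absVandermonde x ^ (β - 2)) *
      {g : Fin n → ℝ | ∀ i, 0 < g i}.indicator (fun g => ENNReal.ofReal
        (Real.exp (-(β / 2) * ∑ i, g i) * (∏ i, g i) ^ (β / 2 - 1))) g := by
  have hΔ := absVandermonde_pos hx
  have hmem : (rootCoeffs x, toFn n (residuePoly x g)) ∈ spectralCoeffs n ↔
      g ∈ {g : Fin n → ℝ | ∀ i, 0 < g i} := by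
    simp only [spectralCoeffs, Set.mem_ofPred_eq, monicOf_rootCoeffs,
      ofFn_toFn_of_degree_lt (degree_residuePoly_lt x g)]
    exact mk_mem_spectralPairs_iff hx
  by_cases hg : g ∈ {g : Fin n → ℝ | ∀ i, 0 < g i}
  · rw [spectralDensity, Set.indicator_of_mem (hmem.2 hg), Set.indicator_of_mem hg]
    dsimp only
    have hp : 0 < ∏ i, g i := Finset.prod_pos fun i _ => hg i
    rw [monicOf_rootCoeffs, ofFn_toFn_of_degree_lt (degree_residuePoly_lt x g), energy_rootPoly,
      absRes_residuePoly hg, coeff_X_mul_residuePoly, ← ENNReal.ofReal_mul (by positivity)]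
    congr 1
    rw [Real.mul_rpow hp.le (by positivity), ← Real.rpow_natCast, ← Real.rpow_mul hΔ.le,
      sub_eq_add_neg, Real.exp_add, show ((2 : ℕ) : ℝ) * (β / 2 - 1) = β - 2 by push_cast; ring,
      neg_mul (β / 2)]
    ring
  · rw [spectralDensity, Set.indicator_of_notMem (hmem.not.2 hg), Set.indicator_of_notMem hg,
      mul_zero]

theorem lintegral_spectralDensity_residue {β : ℝ} {n : ℕ} {x : Fin n → ℝ} (hx : StrictMono x) :
    ∫⁻ r, spectralDensity β n (rootCoeffs x, r) = ENNReal.ofReal (absVandermonde x) *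
      (ENNReal.ofReal (Real.exp (-(β / 4) * ∑ i, x i ^ 2) * absVandermonde x ^ (β - 2)) *
        residueMass β n) := by
  have hΔ := absVandermonde_pos hx
  have hdet : (residueMatrix x).det ≠ 0 := by
    rw [← abs_pos, abs_det_residueMatrix hx]; exact hΔ
  have h := Real.map_matrix_volume_pi_eq_smul_volume_pi hdet
  have hm : Measurable fun r => spectralDensity β n (rootCoeffs x, r) :=
    (measurable_spectralDensity β n).comp measurable_prodMk_left
  have h1 : ∫⁻ g, spectralDensity β n (rootCoeffs x, toFn n (residuePoly x g)) =
      ENNReal.ofReal (absVandermonde x)⁻¹ * ∫⁻ r, spectralDensity β n (rootCoeffs x, r) := by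
    simp only [toFn_residuePoly]
    rw [← abs_det_residueMatrix hx, ← abs_inv, ← smul_eq_mul, ← lintegral_smul_measure, ← h,
      lintegral_map hm (by exact (LinearMap.continuous_of_finiteDimensional _).measurable)]
  simp only [spectralDensity_residue hx] at h1
  rw [lintegral_const_mul' _ _ ENNReal.ofReal_ne_top,
    lintegral_indicator (measurableSet_forall_pos n)] at h1
  rw [residueMass, h1, ← mul_assoc, ← ENNReal.ofReal_mul hΔ.le, mul_inv_cancel₀ hΔ.ne',
    ENNReal.ofReal_one, one_mul]

theorem lintegral_fst_mul_spectralDensity (β : ℝ) (n : ℕ) {F : (Fin n → ℝ) → ℝ≥0∞}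
    (hF : Measurable F) :
    ∫⁻ f, F f.1 * spectralDensity β n f =
      residueMass β n * ∫⁻ x, F (rootCoeffs x) ∂(hermiteWeight β n) := by
  have hD := measurable_spectralDensity β n
  have hV : MeasurableSet {x : Fin n → ℝ | StrictMono x} := (isOpen_strictMono n).measurableSet
  have hinj : Set.InjOn (rootCoeffs (n := n)) {x | StrictMono x} :=
    (rootCoeffs_injOn n).mono fun x (hx : StrictMono x) => hx.monotone
  have hder : ∀ x ∈ {x : Fin n → ℝ | StrictMono x}, HasFDerivWithinAt rootCoeffs
      (-(Matrix.toLin' (residueMatrix x)).toContinuousLinearMap) {x | StrictMono x} x :=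
    fun x _ => (hasFDerivAt_rootCoeffs x).hasFDerivWithinAt
  have himage : MeasurableSet (rootCoeffs '' {x : Fin n → ℝ | StrictMono x}) :=
    hV.image_of_continuousOn_injOn (continuous_rootCoeffs n).continuousOn hinj
  rw [Measure.volume_eq_prod, lintegral_prod _ (by
    exact ((hF.comp measurable_fst).mul hD).aemeasurable)]
  have h1 : ∀ p, ∫⁻ r, F p * spectralDensity β n (p, r) =
      (rootCoeffs '' {x : Fin n → ℝ | StrictMono x}).indicator
        (fun p => F p * ∫⁻ r, spectralDensity β n (p, r)) p := fun p => by
    rw [lintegral_const_mul _ (by exact hD.comp measurable_prodMk_left)]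
    by_cases hp : p ∈ rootCoeffs '' {x : Fin n → ℝ | StrictMono x}
    · rw [Set.indicator_of_mem hp]
    · rw [Set.indicator_of_notMem hp]
      have : ∀ r, spectralDensity β n (p, r) = 0 := fun r => by
        rw [spectralDensity, Set.indicator_of_notMem]
        rintro ⟨x, g, hx, hg, h⟩
        refine hp ⟨x, hx, ?_⟩
        rw [rootCoeffs, ← (Prod.mk.inj h).1, toFn_monicOf]
      simp [this]
  simp only [h1]
  rw [lintegral_indicator himage,
    lintegral_image_eq_lintegral_abs_det_fderiv_mul volume hV hder hinj, hermiteWeight]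
  have hw : Measurable fun x : Fin n → ℝ =>
      ENNReal.ofReal (Real.exp (-(β / 4) * ∑ i, x i ^ 2) *
        ∏ i : Fin n, ∏ j ∈ Finset.Ioi i, |x i - x j| ^ β) := by
    fun_prop
  have hFc : Measurable fun x : Fin n → ℝ => F (rootCoeffs x) :=
    hF.comp (continuous_rootCoeffs n).measurable
  rw [lintegral_withDensity_eq_lintegral_mul _ hw hFc, ← lintegral_const_mul _ (hw.mul hFc)]
  refine setLIntegral_congr_fun hV fun x hx => ?_
  have hΔ := absVandermonde_pos hx
  have hdet : |(-(Matrix.toLin' (residueMatrix x)).toContinuousLinearMap).det| =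
      absVandermonde x := by
    rw [← abs_det_residueMatrix hx, ContinuousLinearMap.det, ContinuousLinearMap.toLinearMap_neg,
      LinearMap.coe_toContinuousLinearMap, ← neg_one_smul ℝ, LinearMap.det_smul,
      LinearMap.det_toLin']
    simp [abs_mul]
  have hprod : ∏ i : Fin n, ∏ j ∈ Finset.Ioi i, |x i - x j| ^ β = absVandermonde x ^ β := by
    rw [absVandermonde, ← Real.finsetProd_rpow _ _ fun i _ =>
      Finset.prod_nonneg fun j _ => abs_nonneg _]
    exact Finset.prod_congr rfl fun i _ => Real.finsetProd_rpow _ _ (fun j _ => abs_nonneg _) _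
  have hpow : absVandermonde x ^ β =
      absVandermonde x * (absVandermonde x * absVandermonde x ^ (β - 2)) := by
    rw [← mul_assoc, ← sq, ← Real.rpow_natCast, ← Real.rpow_add hΔ]
    congr 1
    push_cast
    ring
  have hmul : ENNReal.ofReal (Real.exp (-(β / 4) * ∑ i, x i ^ 2) * absVandermonde x ^ β) =
      ENNReal.ofReal (absVandermonde x) * (ENNReal.ofReal (absVandermonde x) *
        ENNReal.ofReal (Real.exp (-(β / 4) * ∑ i, x i ^ 2) * absVandermonde x ^ (β - 2))) := by
    rw [← ENNReal.ofReal_mul hΔ.le, ← ENNReal.ofReal_mul hΔ.le, hpow]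
    congr 1
    ring
  simp only [Pi.mul_apply]
  rw [hdet, hprod, lintegral_spectralDensity_residue hx, hmul]
  ring

/-! ### Measurability of the ordered roots -/

/-- The ordered roots of the monic polynomial with given lower coefficients, if it splits. -/
noncomputable def rootsOfCoeffs (n : ℕ) (p : Fin n → ℝ) : Fin n → ℝ := by
  classical
  exact if p ∈ rootCoeffs '' {x : Fin n → ℝ | Monotone x} then orderedRoots n (monicOf p) else 0

theorem rootsOfCoeffs_rootCoeffs {n : ℕ} {x : Fin n → ℝ} (hx : Monotone x) :
    rootsOfCoeffs n (rootCoeffs x) = x := by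
  rw [rootsOfCoeffs, if_pos (by exact ⟨x, hx, rfl⟩), monicOf_rootCoeffs, orderedRoots_rootPoly hx]

theorem measurable_rootsOfCoeffs (n : ℕ) : Measurable (rootsOfCoeffs n) := by
  have hc : MeasurableSet {x : Fin n → ℝ | Monotone x} := by
    have : {x : Fin n → ℝ | Monotone x} = ⋂ i, ⋂ j, ⋂ _ : i ≤ j, {x | x i ≤ x j} := by
      ext x
      simp [Monotone]
    rw [this]
    exact MeasurableSet.iInter fun i => MeasurableSet.iInter fun j => MeasurableSet.iInter fun _ =>
      measurableSet_le (measurable_pi_apply i) (measurable_pi_apply j)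
  have himage : ∀ B, MeasurableSet B → MeasurableSet (rootCoeffs '' ({x : Fin n → ℝ | Monotone x} ∩ B)) :=
    fun B hB => (hc.inter hB).image_of_continuousOn_injOn (continuous_rootCoeffs n).continuousOn
      ((rootCoeffs_injOn n).mono Set.inter_subset_left)
  have himage' : MeasurableSet (rootCoeffs '' {x : Fin n → ℝ | Monotone x}) := by
    simpa using himage Set.univ MeasurableSet.univ
  intro B hB
  have : rootsOfCoeffs n ⁻¹' B = (rootCoeffs '' ({x : Fin n → ℝ | Monotone x} ∩ B)) ∪
      ((rootCoeffs '' {x : Fin n → ℝ | Monotone x})ᶜ ∩ {_p | (0 : Fin n → ℝ) ∈ B}) := by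
    ext p
    by_cases hp : p ∈ rootCoeffs '' {x : Fin n → ℝ | Monotone x}
    · obtain ⟨x, hx, rfl⟩ := hp
      simp only [Set.mem_preimage, rootsOfCoeffs_rootCoeffs hx]
      constructor
      · exact fun h => Or.inl ⟨x, ⟨hx, h⟩, rfl⟩
      · rintro (⟨y, ⟨hy, hyB⟩, h⟩ | h)
        · rwa [← rootCoeffs_injOn n hy hx h]
        · exact absurd ⟨x, hx, rfl⟩ h.1
    · simp only [Set.mem_preimage, rootsOfCoeffs, if_neg hp]
      constructor
      · exact fun h => Or.inr ⟨hp, h⟩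
      · rintro (⟨y, ⟨hy, -⟩, h⟩ | h)
        · exact absurd ⟨y, hy, h⟩ hp
        · exact h.2
  rw [this]
  exact (himage B hB).union (himage'.compl.inter (MeasurableSet.const _))

/-! ### The laws of the entries -/

theorem gaussianReal_eq_smul_withDensity {β : ℝ} (hβ : 0 < β) :
    ∃ C : ℝ≥0∞, gaussianReal 0 (2 / β).toNNReal = C • volume.withDensity (diagDensity β) := by
  have hv : (2 / β).toNNReal ≠ 0 := by
    rw [Ne, Real.toNNReal_eq_zero, not_le]; positivity
  refine ⟨ENNReal.ofReal (√(2 * Real.pi * (2 / β).toNNReal))⁻¹, ?_⟩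
  rw [gaussianReal_of_var_ne_zero _ hv, ← withDensity_smul _ (measurable_diagDensity β)]
  congr 1
  funext x
  rw [gaussianPDF, gaussianPDFReal, ENNReal.ofReal_mul (by positivity), Pi.smul_apply, smul_eq_mul,
    diagDensity, Real.coe_toNNReal _ (by positivity)]
  congr 3
  field_simp
  ring

theorem lintegral_div_left {F : ℝ → ℝ≥0∞} (hF : Measurable F) {β : ℝ} (hβ : 0 < β) :
    ∫⁻ x, F x = ENNReal.ofReal β * ∫⁻ y, F (β * y) := by
  have h := Real.smul_map_volume_mul_left hβ.ne'
  nth_rw 1 [← h]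
  rw [lintegral_smul_measure, lintegral_map hF (by fun_prop), abs_of_pos hβ, smul_eq_mul]

theorem map_sq_scaled_chi {β : ℝ} (hβ : 0 < β) (k : ℕ) :
    ∃ C : ℝ≥0∞, ((chiMeasure (((k : ℝ) + 1) * β)).map (fun x => x / √β)).map (fun x => x ^ 2) =
      C • (volume.restrict (Set.Ioi 0)).withDensity (offDiagDensity β k) := by
  set s := ((k : ℝ) + 1) * β / 2 with hs
  have hs0 : 0 < s := by positivity
  refine ⟨ENNReal.ofReal β *
    ENNReal.ofReal ((1 / 2 : ℝ) ^ s / Real.Gamma s * β ^ (s - 1)), ?_⟩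
  refine Measure.ext_of_lintegral _ fun F hF => ?_
  rw [chiMeasure, Measure.map_map (by fun_prop) (by fun_prop), Measure.map_map (by fun_prop)
    (by fun_prop), lintegral_map hF (by fun_prop), gammaMeasure,
    lintegral_withDensity_eq_lintegral_mul _ (by unfold gammaPDF; exact
      (measurable_gammaPDFReal _ _).ennreal_ofReal) (by fun_prop),
    lintegral_div_left (by
      exact (Measurable.mul (by unfold gammaPDF; exact (measurable_gammaPDFReal _ _).ennreal_ofReal)
        (by fun_prop))) hβ, lintegral_smul_measure,
    lintegral_withDensity_eq_lintegral_mul _ (measurable_offDiagDensity β k) hF, smul_eq_mul,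
    mul_assoc, ← lintegral_const_mul (ENNReal.ofReal ((1 / 2 : ℝ) ^ s / Real.Gamma s * β ^ (s - 1)))
      (by exact (measurable_offDiagDensity β k).mul hF),
    ← lintegral_indicator measurableSet_Ioi]
  congr 1
  refine lintegral_congr_ae ?_
  filter_upwards [(Measure.ae_ne volume (0 : ℝ))] with y hy
  rcases lt_or_gt_of_ne hy with h | h
  · rw [Set.indicator_of_notMem (by exact h.not_gt), Pi.mul_apply, ← hs,
      gammaPDF_of_neg (mul_neg_of_pos_of_neg hβ h), zero_mul]
  · rw [Set.indicator_of_mem (by exact h)]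
    simp only [Pi.mul_apply, Function.comp_apply]
    have e1 : (√(β * y) / √β) ^ 2 = y := by
      rw [div_pow, Real.sq_sqrt (by positivity), Real.sq_sqrt hβ.le]
      field_simp
    rw [e1, ← mul_assoc, ← hs, gammaPDF_of_nonneg (by positivity), offDiagDensity,
      ← ENNReal.ofReal_mul (by
        have := Real.Gamma_pos_of_pos hs0
        positivity), ← hs, Real.mul_rpow hβ.le h.le]
    congr 2
    rw [show 1 / 2 * (β * y) = β / 2 * y by ring]
    ring

/-! ### The Hermite ensemble -/

theorem eq_inv_smul_of_eq_smul {α : Type*} [MeasurableSpace α] {μ ν : Measure α}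
    [IsProbabilityMeasure μ] {C : ℝ≥0∞} (h : μ = C • ν) : μ = (ν Set.univ)⁻¹ • ν := by
  have h1 : C * ν Set.univ = 1 := by
    rw [← smul_eq_mul, ← Measure.smul_apply, ← h, measure_univ]
  rw [← ENNReal.eq_inv_of_mul_eq_one_left h1, h]

/-- The ordered roots of the `n`-th orthogonal polynomial follow the `β`-Hermite ensemble. -/
theorem hasLaw_rootsOfCoeffs {Ω : Type*} [MeasurableSpace Ω] {P : Measure Ω}
    [IsProbabilityMeasure P] {β : ℝ} (hβ : 0 < β) {a b : ℕ → Ω → ℝ} (ha : ∀ k, Measurable (a k))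
    (hb : ∀ k, Measurable (b k)) (h : IsBetaHermiteJacobi β P a b) (n : ℕ) :
    HasLaw (fun ω => rootsOfCoeffs n (opCoeffs n (Sum.elim (fun k => a k ω) fun k => b k ω ^ 2)).1)
      (hermiteEnsemble β n) P := by
  let f : ℕ ⊕ ℕ → Ω → ℝ := Sum.elim a fun k ω => b k ω ^ 2
  have hf : ∀ i, Measurable (f i) := by
    rintro (k | k)
    · exact ha k
    · exact (hb k).pow_const 2
  have hi : iIndepFun f P := by
    have := h.indep.comp (Sum.elim (fun _ x => x) fun _ x => x ^ 2) (by
      rintro (k | k)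
      · exact measurable_id
      · exact measurable_id.pow_const 2)
    convert this using 1
    funext i
    cases i <;> rfl
  have hfa : ∀ k, ∃ C : ℝ≥0∞, P.map (f (Sum.inl k)) = C • volume.withDensity (diagDensity β) :=
    fun k => by
      obtain ⟨C, hC⟩ := gaussianReal_eq_smul_withDensity hβ
      exact ⟨C, by rw [← hC]; exact (h.law_diag k).map_eq⟩
  have hfb : ∀ k, ∃ C : ℝ≥0∞, P.map (f (Sum.inr k)) =
      C • (volume.restrict (Set.Ioi 0)).withDensity (offDiagDensity β k) := fun k => by
    obtain ⟨C, hC⟩ := map_sq_scaled_chi hβ k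
    refine ⟨C, ?_⟩
    rw [← hC, ← (h.law_offDiag k).map_eq, Measure.map_map (by fun_prop) (hb k)]
    rfl
  obtain ⟨C, hC⟩ := map_opCoeffs hf hi hfa hfb n
  have hfω : ∀ ω, (fun i => f i ω) = Sum.elim (fun k => a k ω) fun k => b k ω ^ 2 := fun ω => by
    funext i
    cases i <;> rfl
  have hm1 : Measurable fun ω => opCoeffs n fun i => f i ω :=
    (measurable_opCoeffs n).comp (measurable_pi_lambda _ hf)
  have hm : Measurable fun ω => rootsOfCoeffs n (opCoeffs n fun i => f i ω).1 :=
    (measurable_rootsOfCoeffs n).comp hm1.fst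
  simp only [← hfω]
  refine ⟨hm.aemeasurable, ?_⟩
  have hp := Measure.isProbabilityMeasure_map (μ := P) hm.aemeasurable
  refine eq_inv_smul_of_eq_smul (C := C * residueMass β n) (Measure.ext_of_lintegral _ fun F hF => ?_)
  have hR : Measurable fun p => F (rootsOfCoeffs n p) := hF.comp (measurable_rootsOfCoeffs n)
  have hV : MeasurableSet {x : Fin n → ℝ | StrictMono x} := (isOpen_strictMono n).measurableSet
  have hR1 : Measurable fun z : (Fin n → ℝ) × (Fin n → ℝ) => F (rootsOfCoeffs n z.1) :=
    hR.comp measurable_fst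
  have e1 : ∫⁻ ω, F (rootsOfCoeffs n (opCoeffs n fun i => f i ω).1) ∂P =
      ∫⁻ z, F (rootsOfCoeffs n z.1) ∂(P.map fun ω => opCoeffs n fun i => f i ω) := by
    rw [lintegral_map hR1 hm1]
  rw [lintegral_map hF hm, e1, lintegral_of_eq_smul_withDensity (measurable_spectralDensity β n) hC
    hR1, lintegral_fst_mul_spectralDensity β n hR, lintegral_smul_measure,
    smul_eq_mul, mul_assoc]
  congr 2
  refine lintegral_congr_ae ?_
  rw [hermiteWeight]
  refine (withDensity_absolutelyContinuous _ _).ae_le ?_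
  filter_upwards [ae_restrict_mem hV] with x hx
  rw [rootsOfCoeffs_rootCoeffs (StrictMono.monotone hx)]

open Filter Topology

/-! ### Weak limits and moments -/

section Moments

variable {μs : ℕ → ProbabilityMeasure ℝ} {L : ℝ[X] → ℝ}

theorem isTightMeasureSet_of_moments
    (hint : ∀ (q : ℝ[X]) N, Integrable (fun x => q.eval x) (μs N : Measure ℝ))
    (hL : ∀ q : ℝ[X], ∀ᶠ N in atTop, ∫ x, q.eval x ∂(μs N : Measure ℝ) = L q) :
    IsTightMeasureSet {m : Measure ℝ | ∃ μ ∈ Set.range μs, (μ : Measure ℝ) = m} := by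
  have hb : ∃ B : ℝ, ∀ N, ∫ x, x ^ 2 ∂(μs N : Measure ℝ) ≤ B := by
    have h : Tendsto (fun N => ∫ x, x ^ 2 ∂(μs N : Measure ℝ)) atTop (𝓝 (L (X ^ 2))) :=
      tendsto_const_nhds.congr' ((hL (X ^ 2)).mono fun N hN => by simpa using hN.symm)
    obtain ⟨B, hB⟩ := h.bddAbove_range
    exact ⟨B, fun N => hB ⟨N, rfl⟩⟩
  obtain ⟨B, hB⟩ := hb
  rw [isTightMeasureSet_iff_exists_isCompact_measure_compl_le]
  intro ε hε
  obtain ⟨r, hr0, hr⟩ : ∃ r : ℝ, 0 < r ∧ ENNReal.ofReal (B / r ^ 2) ≤ ε := by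
    have h : Tendsto (fun r : ℝ => ENNReal.ofReal (B / r ^ 2)) atTop (𝓝 (ENNReal.ofReal 0)) :=
      (ENNReal.continuous_ofReal.tendsto 0).comp
        (tendsto_const_nhds.div_atTop (tendsto_pow_atTop (by norm_num)))
    rw [ENNReal.ofReal_zero] at h
    exact ((eventually_gt_atTop 0).and (h.eventually_le_const hε)).exists
  refine ⟨Set.Icc (-r) r, isCompact_Icc, ?_⟩
  rintro m ⟨μ, ⟨N, rfl⟩, rfl⟩
  refine le_trans ?_ hr
  have hsub : (Set.Icc (-r) r)ᶜ ⊆ {x : ℝ | r ^ 2 ≤ x ^ 2} := fun x hx => by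
    rw [Set.mem_ofPred_eq]
    by_contra hlt
    exact hx (abs_le.1 (abs_le_of_sq_le_sq (not_le.1 hlt).le hr0.le))
  have hi : Integrable (fun x : ℝ => x ^ 2) (μs N : Measure ℝ) := 
    (hint (X ^ 2) N).congr (ae_of_all _ fun x => by simp)
  have hm := mul_meas_ge_le_integral_of_nonneg (μ := (μs N : Measure ℝ)) (f := fun x : ℝ => x ^ 2)
    (Eventually.of_forall fun x => sq_nonneg x) hi (r ^ 2)
  calc (μs N : Measure ℝ) (Set.Icc (-r) r)ᶜ ≤ (μs N : Measure ℝ) {x : ℝ | r ^ 2 ≤ x ^ 2} :=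
        measure_mono hsub
    _ = ENNReal.ofReal ((μs N : Measure ℝ).real {x : ℝ | r ^ 2 ≤ x ^ 2}) :=
        (ENNReal.ofReal_toReal (measure_ne_top _ _)).symm
    _ ≤ ENNReal.ofReal (B / r ^ 2) := by
        refine ENNReal.ofReal_le_ofReal ?_
        rw [le_div_iff₀ (by positivity), mul_comm]
        exact hm.trans (hB N)

theorem exists_tendsto_ultrafilter_of_moments
    (hint : ∀ (q : ℝ[X]) N, Integrable (fun x => q.eval x) (μs N : Measure ℝ))
    (hL : ∀ q : ℝ[X], ∀ᶠ N in atTop, ∫ x, q.eval x ∂(μs N : Measure ℝ) = L q)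
    (F : Ultrafilter ℕ) : ∃ μ, Tendsto μs F (𝓝 μ) := by
  have hc := isCompact_closure_of_isTightMeasureSet (isTightMeasureSet_of_moments hint hL)
  obtain ⟨μ, -, h⟩ := hc.ultrafilter_le_nhds (F.map μs) (by
    rw [le_principal_iff, Ultrafilter.mem_coe, Ultrafilter.mem_map]
    exact Filter.mem_of_superset Filter.univ_mem fun N _ => subset_closure ⟨N, rfl⟩)
  exact ⟨μ, h⟩

variable {μ : ProbabilityMeasure ℝ} {F : Filter ℕ} [F.NeBot]

theorem integrable_of_tendsto_of_moments
    (hint : ∀ (q : ℝ[X]) N, Integrable (fun x => q.eval x) (μs N : Measure ℝ))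
    (hL : ∀ q : ℝ[X], ∀ᶠ N in atTop, ∫ x, q.eval x ∂(μs N : Measure ℝ) = L q)
    (hF : F ≤ atTop) (hμ : Tendsto μs F (𝓝 μ)) (R : ℝ[X]) (hR : ∀ x, 0 ≤ R.eval x) :
    Integrable (fun x => R.eval x) (μ : Measure ℝ) ∧ ∫ x, R.eval x ∂(μ : Measure ℝ) ≤ L R := by
  have hL0 : 0 ≤ L R := by
    obtain ⟨N, hN⟩ := (hL R).exists
    rw [← hN]
    exact integral_nonneg hR
  have hmin : ∀ M : ℕ, ∫⁻ x, ENNReal.ofReal (min (R.eval x) M) ∂(μ : Measure ℝ) ≤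
      ENNReal.ofReal (L R) := by
    intro M
    have hc : Continuous fun x => min (R.eval x) (M : ℝ) := R.continuous.min continuous_const
    have hbd : ∀ x, ‖min (R.eval x) (M : ℝ)‖ ≤ M := fun x => by
      rw [Real.norm_of_nonneg (le_min (hR x) (Nat.cast_nonneg M))]
      exact min_le_right _ _
    have hb := (ProbabilityMeasure.tendsto_iff_forall_integral_tendsto.1 hμ)
      (BoundedContinuousFunction.ofNormedAddCommGroup _ hc M hbd)
    simp only [BoundedContinuousFunction.coe_ofNormedAddCommGroup] at hb
    have hib : ∀ ν : ProbabilityMeasure ℝ,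
        Integrable (fun x => min (R.eval x) (M : ℝ)) (ν : Measure ℝ) := fun ν =>
      Integrable.of_bound hc.aestronglyMeasurable M (Eventually.of_forall hbd)
    rw [← ofReal_integral_eq_lintegral_ofReal (hib μ)
      (Eventually.of_forall fun x => le_min (hR x) (Nat.cast_nonneg M))]
    refine ENNReal.ofReal_le_ofReal (le_of_tendsto hb ?_)
    filter_upwards [hF (hL R)] with N hN
    rw [← hN]
    exact integral_mono (hib _) (hint R N) fun x => min_le_left _ _
  have hlint : ∫⁻ x, ENNReal.ofReal (R.eval x) ∂(μ : Measure ℝ) ≤ ENNReal.ofReal (L R) := by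
    have hsup : ∀ x, ENNReal.ofReal (R.eval x) = ⨆ M : ℕ, ENNReal.ofReal (min (R.eval x) M) := by
      intro x
      refine le_antisymm ?_ (iSup_le fun M => ENNReal.ofReal_le_ofReal (min_le_left _ _))
      obtain ⟨M, hM⟩ := exists_nat_ge (R.eval x)
      refine le_trans ?_ (le_iSup _ M)
      rw [min_eq_left hM]
    simp only [hsup]
    rw [lintegral_iSup]
    · exact iSup_le hmin
    · intro M
      exact ENNReal.measurable_ofReal.comp (R.continuous.min continuous_const).measurable
    · intro M M' h x
      exact ENNReal.ofReal_le_ofReal (min_le_min le_rfl (by exact_mod_cast h))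
  have hi : Integrable (fun x => R.eval x) (μ : Measure ℝ) := by
    refine ⟨R.continuous.aestronglyMeasurable, ?_⟩
    rw [hasFiniteIntegral_iff_ofReal (Eventually.of_forall hR)]
    exact hlint.trans_lt ENNReal.ofReal_lt_top
  refine ⟨hi, ?_⟩
  rw [← ofReal_integral_eq_lintegral_ofReal hi (Eventually.of_forall hR)] at hlint
  exact (ENNReal.ofReal_le_ofReal_iff hL0).1 hlint

theorem abs_sub_div_le {q ε : ℝ} (hε : 0 < ε) :
    |q - q / (1 + ε * q ^ 2)| ≤ ε * (1 + q ^ 4) := by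
  have h1 : 0 < 1 + ε * q ^ 2 := by positivity
  have h2 : q - q / (1 + ε * q ^ 2) = ε * q ^ 3 / (1 + ε * q ^ 2) := by
    field_simp
    ring
  rw [h2, abs_div, abs_of_pos h1, abs_mul, abs_of_pos hε, div_le_iff₀ h1, mul_assoc]
  refine mul_le_mul_of_nonneg_left ?_ hε.le
  have h3 : |q ^ 3| ≤ 1 + q ^ 4 := by
    rw [abs_le]
    constructor <;> nlinarith [sq_nonneg (q ^ 2 - 1), sq_nonneg (q ^ 2 + q), sq_nonneg (q ^ 2 - q), sq_nonneg (q+1), sq_nonneg (q - 1)]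
  have h4 : 0 ≤ (1 + q ^ 4) * (ε * q ^ 2) := by positivity
  linarith

theorem abs_div_le {q ε : ℝ} (hε : 0 < ε) : ‖q / (1 + ε * q ^ 2)‖ ≤ 1 + ε⁻¹ := by
  have h1 : 0 < 1 + ε * q ^ 2 := by positivity
  rw [Real.norm_eq_abs, abs_div, abs_of_pos h1, div_le_iff₀ h1]
  have h2 : |q| ≤ 1 + q ^ 2 := by
    rw [abs_le]
    constructor <;> nlinarith [sq_nonneg (q + 1), sq_nonneg (q - 1)]
  have h3 : (1 + ε⁻¹) * (1 + ε * q ^ 2) = 1 + q ^ 2 + ε⁻¹ + ε * q ^ 2 := by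
    field_simp
    ring
  rw [h3]
  have : 0 ≤ ε⁻¹ + ε * q ^ 2 := by positivity
  linarith

theorem integral_of_tendsto_of_moments
    (hint : ∀ (q : ℝ[X]) N, Integrable (fun x => q.eval x) (μs N : Measure ℝ))
    (hL : ∀ q : ℝ[X], ∀ᶠ N in atTop, ∫ x, q.eval x ∂(μs N : Measure ℝ) = L q)
    (hF : F ≤ atTop) (hμ : Tendsto μs F (𝓝 μ)) (q : ℝ[X]) :
    Integrable (fun x => q.eval x) (μ : Measure ℝ) ∧ ∫ x, q.eval x ∂(μ : Measure ℝ) = L q := by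
  set R : ℝ[X] := 1 + q ^ 4 with hRdef
  have hRe : ∀ x, R.eval x = 1 + q.eval x ^ 4 := fun x => by simp [hRdef]
  have hR0 : ∀ x, 0 ≤ R.eval x := fun x => by rw [hRe]; positivity
  obtain ⟨hRi, hRL⟩ := integrable_of_tendsto_of_moments hint hL hF hμ R hR0
  have hqR : ∀ x, |q.eval x| ≤ R.eval x := fun x => by
    rw [hRe, abs_le]
    constructor <;> nlinarith [sq_nonneg (q.eval x ^ 2 - 1), sq_nonneg (q.eval x - 1),
      sq_nonneg (q.eval x + 1)]
  have hqi : Integrable (fun x => q.eval x) (μ : Measure ℝ) :=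
    hRi.mono' q.continuous.aestronglyMeasurable (Eventually.of_forall hqR)
  refine ⟨hqi, ?_⟩
  have hL0 : 0 ≤ L R := le_trans (integral_nonneg hR0) hRL
  have key : ∀ ε : ℝ, 0 < ε → |∫ x, q.eval x ∂(μ : Measure ℝ) - L q| ≤ 2 * (ε * L R) := by
    intro ε hε
    have hc : Continuous fun x => q.eval x / (1 + ε * q.eval x ^ 2) :=
      q.continuous.div (by fun_prop) fun x => by positivity
    have hib : ∀ ν : ProbabilityMeasure ℝ,
        Integrable (fun x => q.eval x / (1 + ε * q.eval x ^ 2)) (ν : Measure ℝ) := fun ν =>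
      Integrable.of_bound hc.aestronglyMeasurable _ (Eventually.of_forall fun x => abs_div_le hε)
    have hb := (ProbabilityMeasure.tendsto_iff_forall_integral_tendsto.1 hμ)
      (BoundedContinuousFunction.ofNormedAddCommGroup _ hc _ fun x => abs_div_le hε)
    simp only [BoundedContinuousFunction.coe_ofNormedAddCommGroup] at hb
    have hdist : ∀ ν : ProbabilityMeasure ℝ, Integrable (fun x => q.eval x) (ν : Measure ℝ) →
        Integrable (fun x => R.eval x) (ν : Measure ℝ) → ∫ x, R.eval x ∂(ν : Measure ℝ) ≤ L R →
        |∫ x, q.eval x ∂(ν : Measure ℝ) -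
          ∫ x, q.eval x / (1 + ε * q.eval x ^ 2) ∂(ν : Measure ℝ)| ≤ ε * L R := by
      intro ν h1 h2 h3
      rw [← integral_sub h1 (hib ν), ← Real.norm_eq_abs]
      refine (norm_integral_le_of_norm_le (h2.const_mul ε) (Eventually.of_forall fun x => ?_)).trans ?_
      · rw [hRe]; exact abs_sub_div_le hε
      · rw [integral_const_mul]; exact mul_le_mul_of_nonneg_left h3 hε.le
    have h1 := hdist μ hqi hRi hRL
    have h2 : |L q - ∫ x, q.eval x / (1 + ε * q.eval x ^ 2) ∂(μ : Measure ℝ)| ≤ ε * L R := by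
      refine le_of_tendsto ((tendsto_const_nhds.sub hb).abs) ?_
      filter_upwards [hF (hL q), hF (hL R)] with N hN hN2
      rw [← hN]
      exact hdist _ (hint q N) (hint R N) hN2.le
    rw [abs_le] at h1 h2 ⊢
    constructor <;> linarith
  by_contra hne
  have hpos : 0 < |∫ x, q.eval x ∂(μ : Measure ℝ) - L q| := abs_pos.2 (sub_ne_zero.2 hne)
  have h := key (|∫ x, q.eval x ∂(μ : Measure ℝ) - L q| / (4 * (L R + 1))) (by positivity)
  have h2 : 2 * (|∫ x, q.eval x ∂(μ : Measure ℝ) - L q| / (4 * (L R + 1)) * L R) <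
      |∫ x, q.eval x ∂(μ : Measure ℝ) - L q| := by
    rw [div_mul_eq_mul_div, mul_div_assoc', div_lt_iff₀ (by positivity)]
    nlinarith
  linarith

end Moments

/-! ### Orthonormal polynomials -/

/-- The orthonormal polynomials of a Jacobi matrix. -/
noncomputable def onPoly (a b : ℕ → ℝ) (n : ℕ) : ℝ[X] :=
  C (∏ k ∈ Finset.range n, b k)⁻¹ * (opPair a (fun k => b k ^ 2) n).1

section Recursion

variable {a b : ℕ → ℝ}

theorem onPoly_zero : onPoly a b 0 = 1 := by simp [onPoly, opPair]

theorem eval_onPoly_zero (x : ℝ) : (onPoly a b 0).eval x = 1 := by simp [onPoly_zero]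

theorem eval_onPoly_one (hb : ∀ k, 0 < b k) (x : ℝ) :
    b 0 * (onPoly a b 1).eval x = (x - a 0) * (onPoly a b 0).eval x := by
  have := (hb 0).ne'
  simp [onPoly, opPair]
  field_simp

theorem eval_onPoly_add_two (hb : ∀ k, 0 < b k) (n : ℕ) (x : ℝ) :
    b (n + 1) * (onPoly a b (n + 2)).eval x =
      (x - a (n + 1)) * (onPoly a b (n + 1)).eval x - b n * (onPoly a b n).eval x := by
  have h1 := (hb n).ne'
  have h2 := (hb (n + 1)).ne'
  have h3 : ∏ k ∈ Finset.range n, b k ≠ 0 := Finset.prod_ne_zero_iff.2 fun k _ => (hb k).ne'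
  simp only [onPoly, Finset.prod_range_succ, opPair, eval_mul, eval_sub, eval_C, eval_X]
  field_simp

theorem degree_onPoly (hb : ∀ k, 0 < b k) (n : ℕ) : (onPoly a b n).degree = n := by
  have h3 : (∏ k ∈ Finset.range n, b k)⁻¹ ≠ 0 :=
    inv_ne_zero (Finset.prod_ne_zero_iff.2 fun k _ => (hb k).ne')
  obtain ⟨⟨h1, h2⟩, -⟩ := opPair_degree a (fun k => b k ^ 2) n
  rw [onPoly, degree_C_mul h3, degree_eq_natDegree h1.ne_zero, h2]

theorem leadingCoeff_onPoly (n : ℕ) :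
    (onPoly a b n).leadingCoeff = (∏ k ∈ Finset.range n, b k)⁻¹ := by
  obtain ⟨⟨h1, h2⟩, -⟩ := opPair_degree a (fun k => b k ^ 2) n
  rw [onPoly, leadingCoeff_mul, leadingCoeff_C, h1.leadingCoeff, mul_one]

theorem leadingCoeff_onPoly_pos (hb : ∀ k, 0 < b k) (n : ℕ) : 0 < (onPoly a b n).leadingCoeff := by
  rw [leadingCoeff_onPoly]
  exact inv_pos.2 (Finset.prod_pos fun k _ => hb k)

theorem roots_onPoly (hb : ∀ k, 0 < b k) (n : ℕ) :
    (onPoly a b n).roots = (opPair a (fun k => b k ^ 2) n).1.roots :=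
  roots_C_mul _ (inv_ne_zero (Finset.prod_ne_zero_iff.2 fun k _ => (hb k).ne'))

/-- The orthonormal polynomials span the space of all polynomials. -/
theorem span_onPoly (hb : ∀ k, 0 < b k) : Submodule.span ℝ (Set.range (onPoly a b)) = ⊤ :=
  Polynomial.Sequence.span (⟨onPoly a b, degree_onPoly hb⟩ : Polynomial.Sequence ℝ) fun i =>
    (leadingCoeff_onPoly_pos hb i).ne'.isUnit

/-- The Christoffel-Darboux formula. -/
theorem christoffel_darboux (hb : ∀ k, 0 < b k) (x y : ℝ) (n : ℕ) :
    (x - y) * ∑ k ∈ Finset.range (n + 1), (onPoly a b k).eval x * (onPoly a b k).eval y =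
      b n * ((onPoly a b (n + 1)).eval x * (onPoly a b n).eval y -
        (onPoly a b n).eval x * (onPoly a b (n + 1)).eval y) := by
  induction n with
  | zero =>
    have h1 := eval_onPoly_one (a := a) hb x
    have h2 := eval_onPoly_one (a := a) hb y
    simp only [eval_onPoly_zero] at *
    simp [onPoly_zero]
    linarith
  | succ n ih =>
    rw [Finset.sum_range_succ, mul_add, ih]
    have h1 := eval_onPoly_add_two (a := a) hb n x
    have h2 := eval_onPoly_add_two (a := a) hb n y
    linear_combination (-(onPoly a b (n + 1)).eval y) * h1 + (onPoly a b (n + 1)).eval x * h2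

/-! ### Gauss quadrature -/

/-- The nodes of the Gauss quadrature. -/
noncomputable def gaussNodes (a b : ℕ → ℝ) (n : ℕ) : Fin n → ℝ :=
  rootsOfCoeffs n (opCoeffs n (Sum.elim a fun k => b k ^ 2)).1

/-- The weights of the Gauss quadrature. -/
noncomputable def gaussWeight (a b : ℕ → ℝ) (n : ℕ) (i : Fin n) : ℝ :=
  (∑ k ∈ Finset.range n, (onPoly a b k).eval (gaussNodes a b n i) ^ 2)⁻¹

/-- The Gauss quadrature measure of the truncated Jacobi matrix. -/
noncomputable def gaussMeasure (a b : ℕ → ℝ) (n : ℕ) : Measure ℝ :=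
  ∑ i, ENNReal.ofReal (gaussWeight a b n i) • Measure.dirac (gaussNodes a b n i)

theorem gaussNodes_spec (hb : ∀ k, 0 < b k) (n : ℕ) :
    StrictMono (gaussNodes a b n) ∧
      (opPair a (fun k => b k ^ 2) n).1 = rootPoly (gaussNodes a b n) := by
  obtain ⟨x, g, hx, -, h⟩ := opPair_mem_spectralPairs a (c := fun k => b k ^ 2)
    (fun k => pow_pos (hb k) 2) n
  have h1 : (opPair a (fun k => b k ^ 2) n).1 = rootPoly x := by rw [h]
  have h2 : gaussNodes a b n = x := by
    rw [gaussNodes, ← rootsOfCoeffs_rootCoeffs hx.monotone]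
    congr 1
    rw [rootCoeffs, ← h1]
    rfl
  rw [h2]
  exact ⟨hx, h1⟩

theorem eval_onPoly_gaussNodes (hb : ∀ k, 0 < b k) (n : ℕ) (i : Fin n) :
    (onPoly a b n).eval (gaussNodes a b n i) = 0 := by
  rw [onPoly, (gaussNodes_spec hb n).2, eval_mul, eval_rootPoly,
    Finset.prod_eq_zero (Finset.mem_univ i) (sub_self _), mul_zero]

theorem gaussWeight_pos (n : ℕ) (i : Fin n) : 0 < gaussWeight a b n i := by
  refine inv_pos.2 (Finset.sum_pos' (fun k _ => sq_nonneg _) ⟨0, ?_, ?_⟩)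
  · exact Finset.mem_range.2 i.pos
  · simp [onPoly_zero]

theorem sum_gaussWeight (hb : ∀ k, 0 < b k) (n : ℕ) {k l : ℕ} (hk : k < n) (hl : l < n) :
    ∑ i, gaussWeight a b n i * ((onPoly a b k).eval (gaussNodes a b n i) *
      (onPoly a b l).eval (gaussNodes a b n i)) = if k = l then 1 else 0 := by
  obtain ⟨m, rfl⟩ : ∃ m, n = m + 1 := ⟨n - 1, by omega⟩
  set x := gaussNodes a b (m + 1) with hx
  let B : Matrix (Fin (m + 1)) (Fin (m + 1)) ℝ := fun i k => (onPoly a b k).eval (x i)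
  let W : Matrix (Fin (m + 1)) (Fin (m + 1)) ℝ := Matrix.diagonal (gaussWeight a b (m + 1))
  have hBB : B * B.transpose = Matrix.diagonal fun i => (gaussWeight a b (m + 1) i)⁻¹ := by
    ext i j
    have hsum : (B * B.transpose) i j = ∑ k ∈ Finset.range (m + 1),
        (onPoly a b k).eval (x i) * (onPoly a b k).eval (x j) := by
      rw [Matrix.mul_apply, Finset.sum_range]
      rfl
    rw [hsum, Matrix.diagonal_apply]
    split_ifs with hij
    · rw [hij, gaussWeight, inv_inv]
      exact Finset.sum_congr rfl fun k _ => (sq _).symm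
    · have h := christoffel_darboux (a := a) hb (x i) (x j) m
      rw [eval_onPoly_gaussNodes hb, eval_onPoly_gaussNodes hb, zero_mul, mul_zero, sub_zero,
        mul_zero] at h
      exact (mul_eq_zero.1 h).resolve_left
        (sub_ne_zero.2 ((gaussNodes_spec hb (m + 1)).1.injective.ne hij))
  have h1 : (W * B) * B.transpose = 1 := by
    rw [Matrix.mul_assoc, hBB, Matrix.diagonal_mul_diagonal, ← Matrix.diagonal_one]
    congr 1
    funext i
    exact mul_inv_cancel₀ (gaussWeight_pos _ i).ne'
  have h3 : B.transpose * (W * B) = 1 := mul_eq_one_comm.1 h1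
  have h2 := congrFun (congrFun h3 ⟨k, hk⟩) ⟨l, hl⟩
  rw [Matrix.one_apply, Matrix.mul_apply] at h2
  simp only [Fin.mk.injEq] at h2
  rw [← h2]
  refine Finset.sum_congr rfl fun i _ => ?_
  have h4 : (W * B) i ⟨l, hl⟩ = gaussWeight a b (m + 1) i * B i ⟨l, hl⟩ :=
    Matrix.diagonal_mul _ _ _ _
  rw [Matrix.transpose_apply, h4]
  exact mul_left_comm _ _ _

theorem integrable_gaussMeasure (n : ℕ) (f : ℝ → ℝ) : Integrable f (gaussMeasure a b n) := by
  rw [gaussMeasure, integrable_finsetSum_measure]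
  exact fun i _ => (integrable_dirac (by simp)).smul_measure ENNReal.ofReal_ne_top

theorem integral_gaussMeasure (n : ℕ) (f : ℝ → ℝ) :
    ∫ x, f x ∂(gaussMeasure a b n) = ∑ i, gaussWeight a b n i * f (gaussNodes a b n i) := by
  rw [gaussMeasure, integral_finsetSum_measure fun i _ =>
    (integrable_dirac (by simp)).smul_measure ENNReal.ofReal_ne_top]
  refine Finset.sum_congr rfl fun i _ => ?_
  rw [integral_smul_measure, integral_dirac, ENNReal.toReal_ofReal (gaussWeight_pos n i).le,
    smul_eq_mul]

theorem isProbabilityMeasure_gaussMeasure (hb : ∀ k, 0 < b k) (n : ℕ) :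
    IsProbabilityMeasure (gaussMeasure a b (n + 1)) := by
  constructor
  have h := sum_gaussWeight (a := a) hb (n + 1) (Nat.succ_pos n) (Nat.succ_pos n)
  simp only [onPoly_zero, eval_one, mul_one, if_true] at h
  simp only [gaussMeasure, Measure.coe_finsetSum, Finset.sum_apply, Measure.smul_apply,
    measure_univ, smul_eq_mul, mul_one]
  rw [← ENNReal.ofReal_sum_of_nonneg fun i _ => (gaussWeight_pos _ i).le, h, ENNReal.ofReal_one]

theorem exists_eventually_integral_gaussMeasure (hb : ∀ k, 0 < b k) (q : ℝ[X]) :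
    ∃ c : ℝ, ∀ᶠ N in atTop, ∫ x, q.eval x ∂(gaussMeasure a b (N + 1)) = c := by
  have hq : q ∈ Submodule.span ℝ (Set.range (onPoly a b)) := by rw [span_onPoly hb]; trivial
  induction hq using Submodule.span_induction with
  | mem q hq =>
    obtain ⟨k, rfl⟩ := hq
    refine ⟨if k = 0 then 1 else 0, ?_⟩
    filter_upwards [eventually_ge_atTop k] with N hN
    rw [integral_gaussMeasure, ← sum_gaussWeight (a := a) hb (N + 1) (Nat.lt_succ_of_le hN)
      (Nat.succ_pos N)]
    simp [onPoly_zero]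
  | zero => exact ⟨0, by simp⟩
  | add p q _ _ hp hq =>
    obtain ⟨c, hc⟩ := hp
    obtain ⟨d, hd⟩ := hq
    refine ⟨c + d, ?_⟩
    filter_upwards [hc, hd] with N h1 h2
    simp only [eval_add]
    rw [integral_add (integrable_gaussMeasure _ _) (integrable_gaussMeasure _ _), h1, h2]
  | smul r q _ hq =>
    obtain ⟨c, hc⟩ := hq
    refine ⟨r * c, ?_⟩
    filter_upwards [hc] with N h1
    simp only [eval_smul, smul_eq_mul]
    rw [integral_const_mul, h1]

/-- A probability measure with all moments for which the polynomials `onPoly a b` are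
orthonormal. -/
structure IsOrthonormalizing (a b : ℕ → ℝ) (μ : Measure ℝ) : Prop where
  prob : IsProbabilityMeasure μ
  integrable : ∀ q : ℝ[X], Integrable (fun x => q.eval x) μ
  integral_mul : ∀ k l, ∫ x, (onPoly a b k).eval x * (onPoly a b l).eval x ∂μ =
    if k = l then 1 else 0

theorem isOrthonormalizing_of_tendsto (hb : ∀ k, 0 < b k) {μs : ℕ → ProbabilityMeasure ℝ}
    (hμs : ∀ N, (μs N : Measure ℝ) = gaussMeasure a b (N + 1)) {μ : ProbabilityMeasure ℝ}
    {F : Filter ℕ} [F.NeBot] (hF : F ≤ atTop) (hμ : Tendsto μs F (𝓝 μ)) :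
    IsOrthonormalizing a b μ := by
  choose L hL using exists_eventually_integral_gaussMeasure (a := a) hb
  have hint : ∀ (q : ℝ[X]) N, Integrable (fun x => q.eval x) (μs N : Measure ℝ) := fun q N => by
    rw [hμs]; exact integrable_gaussMeasure _ _
  have hL' : ∀ q : ℝ[X], ∀ᶠ N in atTop, ∫ x, q.eval x ∂(μs N : Measure ℝ) = L q := by
    simpa only [hμs] using hL
  have h := integral_of_tendsto_of_moments hint hL' hF hμ
  refine ⟨inferInstance, fun q => (h q).1, fun k l => ?_⟩
  have h1 := (h (onPoly a b k * onPoly a b l)).2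
  simp only [eval_mul] at h1
  rw [h1]
  obtain ⟨N, hN, hkl⟩ := ((hL (onPoly a b k * onPoly a b l)).and
    (eventually_ge_atTop (max k l))).exists
  rw [← hN, integral_gaussMeasure, ← sum_gaussWeight (a := a) hb (N + 1)
    (Nat.lt_succ_of_le ((le_max_left k l).trans hkl))
    (Nat.lt_succ_of_le ((le_max_right k l).trans hkl))]
  simp only [eval_mul]

theorem exists_tendsto_gaussMeasure (hb : ∀ k, 0 < b k) {μs : ℕ → ProbabilityMeasure ℝ}
    (hμs : ∀ N, (μs N : Measure ℝ) = gaussMeasure a b (N + 1))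
    (huniq : ∀ μ ν : Measure ℝ, IsOrthonormalizing a b μ → IsOrthonormalizing a b ν → μ = ν) :
    ∃ μ : ProbabilityMeasure ℝ, IsOrthonormalizing a b μ ∧ Tendsto μs atTop (𝓝 μ) := by
  choose L hL using exists_eventually_integral_gaussMeasure (a := a) hb
  have hint : ∀ (q : ℝ[X]) N, Integrable (fun x => q.eval x) (μs N : Measure ℝ) := fun q N => by
    rw [hμs]; exact integrable_gaussMeasure _ _
  have hL' : ∀ q : ℝ[X], ∀ᶠ N in atTop, ∫ x, q.eval x ∂(μs N : Measure ℝ) = L q := by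
    simpa only [hμs] using hL
  have hex := exists_tendsto_ultrafilter_of_moments hint hL'
  obtain ⟨μ, hμ⟩ := hex (Ultrafilter.of atTop)
  have hμo := isOrthonormalizing_of_tendsto hb hμs (Ultrafilter.of_le atTop) hμ
  refine ⟨μ, hμo, ?_⟩
  rw [tendsto_iff_ultrafilter]
  intro G hG
  obtain ⟨ν, hν⟩ := hex G
  have hνo := isOrthonormalizing_of_tendsto hb hμs hG hν
  have : ν = μ := Subtype.ext (huniq _ _ hνo hμo)
  rwa [this] at hν

end Recursion

open ComplexConjugate

section SpectralTheory

attribute [local instance] InnerProductSpace.toInner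

/-! ### Self-adjointness of Jacobi operators -/

section Operator

variable {a b : ℕ → ℝ}

theorem jacobiAction_zero (a b : ℕ → ℝ) (v : ℕ → ℂ) :
    jacobiAction a b v 0 = (a 0 : ℂ) * v 0 + (b 0 : ℂ) * v 1 := rfl

theorem jacobiAction_succ (a b : ℕ → ℝ) (v : ℕ → ℂ) (m : ℕ) :
    jacobiAction a b v (m + 1) =
      (b m : ℂ) * v m + (a (m + 1) : ℂ) * v (m + 1) + (b (m + 1) : ℂ) * v (m + 2) := rfl

/-- Green's formula for the Jacobi operator. -/
theorem green_formula (a b : ℕ → ℝ) (u v : ℕ → ℂ) (n : ℕ) :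
    ∑ k ∈ Finset.range (n + 1),
      (inner ℂ (jacobiAction a b u k) (v k) - inner ℂ (u k) (jacobiAction a b v k)) =
    (b n : ℂ) * (v n * conj (u (n + 1)) - v (n + 1) * conj (u n)) := by
  induction n with
  | zero =>
    simp only [zero_add, Finset.sum_range_one, RCLike.inner_apply, jacobiAction_zero, map_add,
      map_mul, Complex.conj_ofReal]
    ring
  | succ n ih =>
    rw [Finset.sum_range_succ, ih]
    simp only [RCLike.inner_apply, jacobiAction_succ, map_add, map_mul, Complex.conj_ofReal]
    ring

theorem summable_norm_sq (u : EllTwo) : Summable fun k => ‖u k‖ ^ 2 := by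
  have := (memℓp_gen_iff (p := 2) (by norm_num)).1 (lp.memℓp u)
  simpa using this

theorem norm_mul_conj_sub_le (p q r s : ℂ) :
    ‖q * conj r - s * conj p‖ ≤ (‖p‖ ^ 2 + ‖q‖ ^ 2) + (‖r‖ ^ 2 + ‖s‖ ^ 2) := by
  refine (norm_sub_le _ _).trans ?_
  rw [norm_mul, norm_mul, RCLike.norm_conj, RCLike.norm_conj]
  nlinarith [sq_nonneg (‖q‖ - ‖r‖), sq_nonneg (‖s‖ - ‖p‖), sq_nonneg ‖p‖, sq_nonneg ‖q‖,
    sq_nonneg ‖r‖, sq_nonneg ‖s‖]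

/-- Under Carleman's condition, the boundary term in Green's formula vanishes at infinity. -/
theorem eq_of_hasSum_green (hb : ∀ k, 0 < b k) (hC : ¬ Summable fun k => (b k)⁻¹)
    {u v : ℕ → ℂ} (hu : Summable fun k => ‖u k‖ ^ 2) (hv : Summable fun k => ‖v k‖ ^ 2) {s t : ℂ}
    (hs : HasSum (fun k => inner ℂ (jacobiAction a b u k) (v k)) s)
    (ht : HasSum (fun k => inner ℂ (u k) (jacobiAction a b v k)) t) : s = t := by
  by_contra hne
  set D := s - t with hD
  have hD0 : 0 < ‖D‖ := norm_pos_iff.2 (sub_ne_zero.2 hne)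
  have hlim := ((hs.sub ht).tendsto_sum_nat.comp (tendsto_add_atTop_nat 1)).norm
  simp only [Function.comp_def, green_formula] at hlim
  have hev := hlim.eventually (lt_mem_nhds (half_lt_self hD0))
  refine hC ?_
  have hsum : Summable fun n => (2 / ‖D‖) * ((‖u n‖ ^ 2 + ‖v n‖ ^ 2) +
      (‖u (n + 1)‖ ^ 2 + ‖v (n + 1)‖ ^ 2)) :=
    ((hu.add hv).add (((summable_nat_add_iff 1).2 hu).add
      ((summable_nat_add_iff 1).2 hv))).mul_left _
  refine hsum.of_norm_bounded_eventually_nat ?_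
  filter_upwards [hev] with n hn
  rw [norm_mul, Complex.norm_real, Real.norm_of_nonneg (hb n).le] at hn
  have h1 := hn.trans_le (mul_le_mul_of_nonneg_left
    (norm_mul_conj_sub_le (u n) (v n) (u (n + 1)) (v (n + 1))) (hb n).le)
  rw [Real.norm_of_nonneg (inv_pos.2 (hb n)).le, inv_le_iff_one_le_mul₀ (hb n)]
  rw [div_mul_eq_mul_div, div_mul_eq_mul_div, le_div_iff₀ hD0]
  linarith

theorem coe_jacobiOperator (u : (jacobiOperator a b).domain) :
    ((jacobiOperator a b u : EllTwo) : ℕ → ℂ) = jacobiAction a b ((u : EllTwo) : ℕ → ℂ) := rfl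

/-- Under Carleman's condition, the Jacobi operator is symmetric on its maximal domain. -/
theorem jacobiOperator_symmetric (hb : ∀ k, 0 < b k) (hC : ¬ Summable fun k => (b k)⁻¹)
    (u v : (jacobiOperator a b).domain) :
    inner ℂ (jacobiOperator a b u) (v : EllTwo) = inner ℂ (u : EllTwo) (jacobiOperator a b v) := by
  have hs := lp.hasSum_inner (𝕜 := ℂ) (jacobiOperator a b u) (v : EllTwo)
  have ht := lp.hasSum_inner (𝕜 := ℂ) (u : EllTwo) (jacobiOperator a b v)
  rw [coe_jacobiOperator] at hs ht
  exact eq_of_hasSum_green hb hC (summable_norm_sq _) (summable_norm_sq _) hs ht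

theorem jacobiAction_single (a b : ℕ → ℝ) (k : ℕ) (c : ℂ) (j : ℕ) (hj : k + 1 < j) :
    jacobiAction a b (Pi.single k c : ℕ → ℂ) j = 0 := by
  obtain ⟨m, rfl⟩ : ∃ m, j = m + 1 := ⟨j - 1, by omega⟩
  rw [jacobiAction_succ, Pi.single_eq_of_ne (by omega), Pi.single_eq_of_ne (by omega),
    Pi.single_eq_of_ne (by omega)]
  simp

theorem single_mem_domain (a b : ℕ → ℝ) (k : ℕ) (c : ℂ) :
    lp.single 2 k c ∈ (jacobiOperator a b).domain := by
  change Memℓp (jacobiAction a b (Pi.single k c : ℕ → ℂ)) 2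
  refine memℓp_gen ?_
  refine summable_of_ne_finset_zero (s := Finset.range (k + 2)) fun j hj => ?_
  rw [jacobiAction_single a b k c j (by have := Finset.mem_range.not.1 hj; omega)]
  simp

theorem dense_domain (a b : ℕ → ℝ) : Dense ((jacobiOperator a b).domain : Set EllTwo) := by
  intro f
  have h := lp.hasSum_single (p := 2) (by norm_num) f
  refine mem_closure_of_tendsto h (Eventually.of_forall fun s => ?_)
  exact Submodule.sum_mem _ fun k _ => single_mem_domain a b k _

/-- Under Carleman's condition, the Jacobi operator is self-adjoint. -/
theorem isSelfAdjoint_jacobiOperator (hb : ∀ k, 0 < b k) (hC : ¬ Summable fun k => (b k)⁻¹) :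
    IsSelfAdjoint (jacobiOperator a b) := by
  rw [LinearPMap.isSelfAdjoint_def]
  have hd := dense_domain a b
  refine le_antisymm ?_ (LinearPMap.IsFormalAdjoint.le_adjoint hd fun u v =>
    jacobiOperator_symmetric hb hC u v)
  have hadj := LinearPMap.adjoint_isFormalAdjoint hd
  have key : ∀ y : (jacobiOperator a b).adjoint.domain,
      ((jacobiOperator a b).adjoint y : ℕ → ℂ) = jacobiAction a b ((y : EllTwo) : ℕ → ℂ) := by
    intro y
    funext k
    have h1 := hadj y ⟨lp.single 2 k 1, single_mem_domain a b k 1⟩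
    rw [lp.inner_single_right] at h1
    have h2 := (lp.hasSum_inner (y : EllTwo)
      (jacobiOperator a b ⟨lp.single 2 k 1, single_mem_domain a b k 1⟩)).unique
      (hasSum_sum_of_ne_finset_zero (s := Finset.range (k + 1 + 1)) fun j hj => by
        have : (jacobiOperator a b ⟨lp.single 2 k 1, single_mem_domain a b k 1⟩ : ℕ → ℂ) j = 0 :=
          jacobiAction_single a b k 1 j (by have := Finset.mem_range.not.1 hj; omega)
        rw [this]; exact inner_zero_right (𝕜 := ℂ) ((y : EllTwo) j))
    have h3 := green_formula a b (y : EllTwo) (Pi.single k 1) (k + 1)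
    rw [Finset.sum_sub_distrib, Pi.single_eq_of_ne (by omega : k + 1 ≠ k),
      Pi.single_eq_of_ne (by omega : k + 1 + 1 ≠ k), zero_mul, zero_mul, sub_zero, mul_zero,
      sub_eq_zero, Finset.sum_eq_single k] at h3
    · rw [Pi.single_eq_same] at h3
      have h4 : inner ℂ ((jacobiOperator a b).adjoint y k) (1 : ℂ) =
          inner ℂ (jacobiAction a b (y : EllTwo) k) (1 : ℂ) :=
        h1.trans (h2.trans h3.symm)
      simp only [RCLike.inner_apply, one_mul] at h4
      exact (starRingEnd ℂ).injective h4
    · intro j _ hj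
      rw [Pi.single_eq_of_ne hj, inner_zero_right]
    · intro hk
      simp at hk
  refine ⟨fun y hy => ?_, fun x y hxy => ?_⟩
  · change Memℓp (jacobiAction a b (y : ℕ → ℂ)) 2
    rw [← key ⟨y, hy⟩]
    exact lp.memℓp _
  · apply lp.ext
    rw [key x, hxy]
    rfl

theorem jacobiOperator_injective (hb : ∀ k, 0 < b k) (hC : ¬ Summable fun k => (b k)⁻¹) {z : ℂ}
    (hz : z.im ≠ 0) (u : (jacobiOperator a b).domain)
    (hu : jacobiOperator a b u = z • (u : EllTwo)) : (u : EllTwo) = 0 := by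
  have h := jacobiOperator_symmetric hb hC u u
  rw [hu, inner_smul_left, inner_smul_right] at h
  by_contra h0
  have h1 := mul_right_cancel₀ (inner_self_ne_zero.2 h0) h
  exact hz (Complex.conj_eq_iff_im.1 h1)

end Operator

/-! ### The spectral measure -/

theorem inv_sub_bound {z : ℂ} (hz : z.im ≠ 0) (x : ℝ) : ‖((x : ℂ) - z)⁻¹‖ ≤ |z.im|⁻¹ := by
  rw [norm_inv]
  refine inv_anti₀ (abs_pos.2 hz) ?_
  simpa using Complex.abs_im_le_norm ((x : ℂ) - z)

theorem sub_ne_zero_of_im {z : ℂ} (hz : z.im ≠ 0) (x : ℝ) : (x : ℂ) - z ≠ 0 := fun h => by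
  have := congrArg Complex.im h
  simp at this
  exact hz this

theorem continuous_inv_sub {z : ℂ} (hz : z.im ≠ 0) : Continuous fun x : ℝ => ((x : ℂ) - z)⁻¹ :=
  (Complex.continuous_ofReal.sub continuous_const).inv₀ (sub_ne_zero_of_im hz)

section Spectral

variable {a b : ℕ → ℝ} {μ : Measure ℝ}

theorem IsOrthonormalizing.integrable_div (h : IsOrthonormalizing a b μ) {z : ℂ} (hz : z.im ≠ 0)
    (q : ℝ[X]) : Integrable (fun x : ℝ => ((q.eval x : ℝ) : ℂ) * ((x : ℂ) - z)⁻¹) μ :=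
  ((h.integrable q).ofReal (𝕜 := ℂ)).mul_bdd (c := |z.im|⁻¹)
    (continuous_inv_sub hz).aestronglyMeasurable (Eventually.of_forall fun x => inv_sub_bound hz x)

theorem IsOrthonormalizing.integral_onPoly (h : IsOrthonormalizing a b μ) (k : ℕ) :
    ∫ x, (onPoly a b k).eval x ∂μ = if k = 0 then 1 else 0 := by
  rw [← h.integral_mul k 0]
  simp [onPoly_zero]

theorem IsOrthonormalizing.summable (h : IsOrthonormalizing a b μ) {z : ℂ} (hz : z.im ≠ 0) :
    Summable fun k =>
      ‖∫ x : ℝ, (((onPoly a b k).eval x : ℝ) : ℂ) * ((x : ℂ) - z)⁻¹ ∂μ‖ ^ 2 := by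
  have := h.prob
  have hm : ∀ k, MemLp (fun x : ℝ => (((onPoly a b k).eval x : ℝ) : ℂ)) 2 μ := fun k => by
    refine (memLp_two_iff_integrable_sq_norm (Complex.continuous_ofReal.comp
      (onPoly a b k).continuous).aestronglyMeasurable).2 ?_
    refine (h.integrable (onPoly a b k ^ 2)).congr (Eventually.of_forall fun x => ?_)
    simp
  have hg : MemLp (fun x : ℝ => ((x : ℂ) - z)⁻¹) 2 μ :=
    MemLp.of_bound (continuous_inv_sub hz).aestronglyMeasurable _
      (Eventually.of_forall fun x => inv_sub_bound hz x)
  have ho : Orthonormal ℂ fun k => (hm k).toLp := by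
    rw [orthonormal_iff_ite]
    intro k l
    rw [L2.inner_def]
    have : ∫ x, inner ℂ ((hm k).toLp _ x) ((hm l).toLp _ x) ∂μ =
        ∫ x, (((onPoly a b k).eval x * (onPoly a b l).eval x : ℝ) : ℂ) ∂μ := by
      refine integral_congr_ae ?_
      filter_upwards [(hm k).coeFn_toLp, (hm l).coeFn_toLp] with x h1 h2
      rw [h1, h2, RCLike.inner_apply, Complex.conj_ofReal, mul_comm, Complex.ofReal_mul]
    rw [this, integral_complex_ofReal, h.integral_mul]
    split_ifs <;> simp
  have hs := ho.inner_products_summable (hg.toLp _)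
  refine hs.congr fun k => ?_
  congr 2
  rw [L2.inner_def]
  refine integral_congr_ae ?_
  filter_upwards [(hm k).coeFn_toLp, hg.coeFn_toLp] with x h1 h2
  rw [h1, h2, RCLike.inner_apply, Complex.conj_ofReal, mul_comm]

theorem IsOrthonormalizing.integral_mul_onPoly (h : IsOrthonormalizing a b μ) {z : ℂ}
    (hz : z.im ≠ 0) (k : ℕ) :
    ∫ x : ℝ, (x : ℂ) * ((((onPoly a b k).eval x : ℝ) : ℂ) * ((x : ℂ) - z)⁻¹) ∂μ =
      (if k = 0 then 1 else 0) +
        z * ∫ x : ℝ, (((onPoly a b k).eval x : ℝ) : ℂ) * ((x : ℂ) - z)⁻¹ ∂μ := by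
  have h1 : ∫ x : ℝ, (((onPoly a b k).eval x : ℝ) : ℂ) ∂μ = if k = 0 then 1 else 0 := by
    rw [integral_complex_ofReal, h.integral_onPoly]
    split_ifs <;> simp
  rw [← h1, ← integral_const_mul,
    ← integral_add (by exact (h.integrable _).ofReal) ((h.integrable_div hz _).const_mul z)]
  refine integral_congr_ae (Eventually.of_forall fun x => ?_)
  have := sub_ne_zero_of_im hz x
  simp only
  field_simp
  ring

theorem IsOrthonormalizing.integrable_mul_div (h : IsOrthonormalizing a b μ) {z : ℂ}
    (hz : z.im ≠ 0) (k : ℕ) :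
    Integrable (fun x : ℝ => (x : ℂ) * ((((onPoly a b k).eval x : ℝ) : ℂ) * ((x : ℂ) - z)⁻¹)) μ := by
  refine (h.integrable_div hz (X * onPoly a b k)).congr (Eventually.of_forall fun x => ?_)
  simp [mul_assoc]

/-- The vector of integrals of the orthonormal polynomials against the resolvent kernel solves the
resolvent equation. -/
theorem IsOrthonormalizing.jacobiAction_eq (hb : ∀ k, 0 < b k) (h : IsOrthonormalizing a b μ)
    {z : ℂ} (hz : z.im ≠ 0) {v : ℕ → ℂ}
    (hv : ∀ k, v k = ∫ x : ℝ, (((onPoly a b k).eval x : ℝ) : ℂ) * ((x : ℂ) - z)⁻¹ ∂μ) :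
    jacobiAction a b v = z • v + Pi.single 0 1 := by
  have hint := fun k => h.integrable_div hz (onPoly a b k)
  have hx := h.integral_mul_onPoly hz
  simp only [← hv] at hx
  funext k
  rw [Pi.add_apply, Pi.smul_apply, smul_eq_mul]
  cases k with
  | zero =>
    have h1 := hx 0
    rw [if_pos rfl] at h1
    have h2 : (b 0 : ℂ) * v 1 = 1 + z * v 0 - (a 0 : ℂ) * v 0 := by
      rw [← h1, hv, hv, ← integral_const_mul, ← integral_const_mul,
        ← integral_sub (h.integrable_mul_div hz 0) ((hint 0).const_mul _)]
      refine integral_congr_ae (Eventually.of_forall fun x => ?_)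
      have h3 : ((b 0 : ℝ) : ℂ) * (((onPoly a b 1).eval x : ℝ) : ℂ) =
          ((x : ℂ) - (a 0 : ℝ)) * (((onPoly a b 0).eval x : ℝ) : ℂ) := by
        exact_mod_cast eval_onPoly_one (a := a) hb x
      simp only
      linear_combination ((x : ℂ) - z)⁻¹ * h3
    rw [jacobiAction_zero, h2, Pi.single_eq_same]
    ring
  | succ m =>
    have h1 := hx (m + 1)
    rw [if_neg (Nat.succ_ne_zero m), zero_add] at h1
    have h2 : (b (m + 1) : ℂ) * v (m + 2) =
        z * v (m + 1) - (a (m + 1) : ℂ) * v (m + 1) - (b m : ℂ) * v m := by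
      rw [← h1, hv, hv, hv, ← integral_const_mul, ← integral_const_mul, ← integral_const_mul,
        ← integral_sub (h.integrable_mul_div hz (m + 1)) ((hint (m + 1)).const_mul _),
        ← integral_sub (by exact (h.integrable_mul_div hz (m + 1)).sub ((hint (m + 1)).const_mul _))
          ((hint m).const_mul _)]
      refine integral_congr_ae (Eventually.of_forall fun x => ?_)
      have h3 : ((b (m + 1) : ℝ) : ℂ) * (((onPoly a b (m + 2)).eval x : ℝ) : ℂ) =
          ((x : ℂ) - (a (m + 1) : ℝ)) * (((onPoly a b (m + 1)).eval x : ℝ) : ℂ) -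
            ((b m : ℝ) : ℂ) * (((onPoly a b m).eval x : ℝ) : ℂ) := by
        exact_mod_cast eval_onPoly_add_two (a := a) hb m x
      simp only
      linear_combination ((x : ℂ) - z)⁻¹ * h3
    rw [jacobiAction_succ, h2, Pi.single_eq_of_ne (Nat.succ_ne_zero m)]
    ring

theorem memℓp_single (c : ℂ) : Memℓp (Pi.single 0 c : ℕ → ℂ) 2 :=
  (lp.single (E := fun _ : ℕ => ℂ) 2 0 c).2

theorem exists_resolvent_vector {v : ℕ → ℂ} {z : ℂ} (hv : Memℓp v 2)
    (hJ : jacobiAction a b v = z • v + Pi.single 0 1) :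
    ∃ u : (jacobiOperator a b).domain, jacobiOperator a b u - z • (u : EllTwo) = firstVector ∧
      inner ℂ firstVector (u : EllTwo) = v 0 := by
  have hdom : Memℓp (jacobiAction a b v) 2 := by
    rw [hJ]
    exact (hv.const_smul z).add (memℓp_single 1)
  refine ⟨⟨⟨v, hv⟩, hdom⟩, ?_, ?_⟩
  · apply lp.ext
    change jacobiAction a b v - z • v = Pi.single 0 1
    rw [hJ, add_sub_cancel_left]
  · rw [firstVector, lp.inner_single_left, RCLike.inner_apply, map_one, mul_one]

theorem IsOrthonormalizing.isSpectralMeasureAt (hb : ∀ k, 0 < b k)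
    (h : IsOrthonormalizing a b μ) :
    IsSpectralMeasureAt (jacobiOperator a b) firstVector μ := by
  intro z hz
  obtain ⟨u, hu, hu0⟩ := exists_resolvent_vector
    (memℓp_gen (by simpa using h.summable hz)) (h.jacobiAction_eq hb hz fun _ => rfl)
  refine ⟨u, hu, hu0.trans ?_⟩
  simp [onPoly_zero]

/-- Under Carleman's condition, the Stieltjes transform is determined by the Jacobi matrix. -/
theorem stieltjes_eq_of_isSpectralMeasureAt (hb : ∀ k, 0 < b k)
    (hC : ¬ Summable fun k => (b k)⁻¹) {ν : Measure ℝ}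
    (hμ : IsSpectralMeasureAt (jacobiOperator a b) firstVector μ)
    (hν : IsSpectralMeasureAt (jacobiOperator a b) firstVector ν) {z : ℂ} (hz : z.im ≠ 0) :
    ∫ x : ℝ, ((x : ℂ) - z)⁻¹ ∂μ = ∫ x : ℝ, ((x : ℂ) - z)⁻¹ ∂ν := by
  obtain ⟨u, hu, hu2⟩ := hμ z hz
  obtain ⟨v, hv, hv2⟩ := hν z hz
  have h := jacobiOperator_injective hb hC hz (u - v) (by
    rw [LinearPMap.map_sub, Submodule.coe_sub, smul_sub]
    rw [sub_eq_iff_eq_add] at hu hv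
    rw [hu, hv]
    abel)
  rw [Submodule.coe_sub, sub_eq_zero] at h
  rw [← hu2, ← hv2, h]

end Spectral

end SpectralTheory

open scoped BoundedContinuousFunction

/-! ### Stieltjes inversion -/

/-- The Poisson kernel of the upper half plane, not normalized. -/
noncomputable def poissonKernel (y u : ℝ) : ℝ := y / (u ^ 2 + y ^ 2)

theorem poissonKernel_eq {y : ℝ} (hy : 0 < y) (u : ℝ) :
    poissonKernel y u = y⁻¹ * (1 + (u / y) ^ 2)⁻¹ := by
  have : u ^ 2 + y ^ 2 ≠ 0 := by positivity
  have h2 : 1 + (u / y) ^ 2 ≠ 0 := by positivity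
  rw [poissonKernel]
  field_simp
  ring

theorem continuous_poissonKernel {y : ℝ} (hy : 0 < y) : Continuous (poissonKernel y) :=
  continuous_const.div ((continuous_pow 2).add continuous_const) fun u => by positivity

theorem integrable_poissonKernel {y : ℝ} (hy : 0 < y) : Integrable (poissonKernel y) := by
  have h := (integrable_inv_one_add_sq.comp_div hy.ne').const_mul y⁻¹
  exact h.congr (Eventually.of_forall fun u => (poissonKernel_eq hy u).symm)

theorem integral_poissonKernel_mul {y : ℝ} (hy : 0 < y) (f : ℝ → ℝ) (t : ℝ) :
    ∫ x, f x * poissonKernel y (x - t) = ∫ s, f (t + y * s) * (1 + s ^ 2)⁻¹ := by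
  have h := Measure.integral_comp_mul_left (fun u => f (t + u) * (1 + (u / y) ^ 2)⁻¹) y
  rw [abs_of_pos (inv_pos.2 hy), smul_eq_mul, ← integral_const_mul] at h
  have h1 : ∀ s : ℝ, y * s / y = s := fun s => by field_simp
  simp only [h1] at h
  rw [h, ← integral_add_left_eq_self _ t]
  refine integral_congr_ae (Eventually.of_forall fun u => ?_)
  simp only [add_sub_cancel_left, poissonKernel_eq hy]
  ring

theorem integral_poissonKernel_measure {μ : Measure ℝ} [IsFiniteMeasure μ] {y : ℝ} (hy : 0 < y)
    (x : ℝ) :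
    ∫ t, poissonKernel y (x - t) ∂μ =
      (∫ t : ℝ, ((t : ℂ) - ((x : ℂ) + y * Complex.I))⁻¹ ∂μ).im := by
  have hz : ((x : ℂ) + y * Complex.I).im ≠ 0 := by simpa using hy.ne'
  have hi : Integrable (fun t : ℝ => ((t : ℂ) - ((x : ℂ) + y * Complex.I))⁻¹) μ :=
    Integrable.of_bound (continuous_inv_sub hz).aestronglyMeasurable _
      (Eventually.of_forall (inv_sub_bound hz))
  have h := integral_im hi
  simp only [RCLike.im_to_complex] at h
  rw [← h]
  refine integral_congr_ae (Eventually.of_forall fun t => ?_)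
  simp only [Complex.inv_im, Complex.normSq_apply, poissonKernel]
  simp
  ring

theorem integrable_prod_poissonKernel {μ : Measure ℝ} [IsFiniteMeasure μ] {y : ℝ} (hy : 0 < y)
    (f : ℝ →ᵇ ℝ) :
    Integrable (fun q : ℝ × ℝ => f q.2 * poissonKernel y (q.2 - q.1)) (μ.prod volume) := by
  have hc : Continuous fun q : ℝ × ℝ => poissonKernel y (q.2 - q.1) :=
    (continuous_poissonKernel hy).comp (continuous_snd.sub continuous_fst)
  have h : Integrable (fun q : ℝ × ℝ => poissonKernel y (q.2 - q.1)) (μ.prod volume) := by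
    rw [integrable_prod_iff hc.aestronglyMeasurable]
    refine ⟨Eventually.of_forall fun t => (integrable_poissonKernel hy).comp_sub_right t, ?_⟩
    have : ∀ t : ℝ, ∫ x, ‖poissonKernel y (x - t)‖ = ∫ x, ‖poissonKernel y x‖ := fun t =>
      integral_sub_right_eq_self (fun x => ‖poissonKernel y x‖) t
    simp only [this]
    exact integrable_const _
  exact h.bdd_mul (c := ‖f‖) (f.continuous.comp continuous_snd).aestronglyMeasurable
    (Eventually.of_forall fun q => f.norm_coe_le_norm q.2)

theorem integral_poisson_swap {μ : Measure ℝ} [IsFiniteMeasure μ] {y : ℝ} (hy : 0 < y)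
    (f : ℝ →ᵇ ℝ) :
    ∫ t, (∫ s, f (t + y * s) * (1 + s ^ 2)⁻¹) ∂μ =
      ∫ x, f x * (∫ t : ℝ, ((t : ℂ) - ((x : ℂ) + y * Complex.I))⁻¹ ∂μ).im := by
  simp only [← integral_poissonKernel_measure hy, ← integral_const_mul]
  rw [← integral_integral_swap (f := fun t x => f x * poissonKernel y (x - t))
    (by exact integrable_prod_poissonKernel hy f)]
  simp only [integral_poissonKernel_mul hy]

theorem tendsto_integral_poisson {μ : Measure ℝ} [IsFiniteMeasure μ] (f : ℝ →ᵇ ℝ) {y : ℕ → ℝ}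
    (hy : ∀ n, 0 < y n) (hy0 : Tendsto y atTop (𝓝 0)) :
    Tendsto (fun n => ∫ t, (∫ s, f (t + y n * s) * (1 + s ^ 2)⁻¹) ∂μ) atTop
      (𝓝 (∫ t, f t * Real.pi ∂μ)) := by
  have hb : ∀ n t s, ‖f (t + y n * s) * (1 + s ^ 2)⁻¹‖ ≤ ‖f‖ * (1 + s ^ 2)⁻¹ := fun n t s => by
    rw [norm_mul, Real.norm_of_nonneg (by positivity : 0 ≤ (1 + s ^ 2)⁻¹)]
    exact mul_le_mul_of_nonneg_right (f.norm_coe_le_norm _) (by positivity)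
  refine tendsto_integral_of_dominated_convergence (fun _ => ‖f‖ * Real.pi) (fun n => ?_)
    (integrable_const _) (fun n => Eventually.of_forall fun t => ?_)
    (Eventually.of_forall fun t => ?_)
  · simp only [← integral_poissonKernel_mul (hy n)]
    exact (integrable_prod_poissonKernel (μ := μ) (hy n) f).integral_prod_left.aestronglyMeasurable
  · refine (norm_integral_le_of_norm_le (integrable_inv_one_add_sq.const_mul ‖f‖)
      (Eventually.of_forall (hb n t))).trans ?_
    rw [integral_const_mul, integral_univ_inv_one_add_sq]
  · rw [← integral_univ_inv_one_add_sq, ← integral_const_mul]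
    refine tendsto_integral_of_dominated_convergence (fun s => ‖f‖ * (1 + s ^ 2)⁻¹) (fun n => ?_)
      (integrable_inv_one_add_sq.const_mul _) (fun n => Eventually.of_forall (hb n t))
      (Eventually.of_forall fun s => ?_)
    · exact ((f.continuous.comp (continuous_const.add (continuous_const.mul continuous_id))).mul
        (Continuous.inv₀ (by fun_prop) fun s => by positivity)).aestronglyMeasurable
    · have h1 : Tendsto (fun n => t + y n * s) atTop (𝓝 t) := by
        simpa using (hy0.mul_const s).const_add t
      exact ((f.continuous.tendsto t).comp h1).mul_const _

/-- A finite measure on the line is determined by its Stieltjes transform. -/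
theorem measure_eq_of_stieltjes_eq {μ ν : Measure ℝ} [IsFiniteMeasure μ] [IsFiniteMeasure ν]
    (h : ∀ z : ℂ, z.im ≠ 0 → ∫ x : ℝ, ((x : ℂ) - z)⁻¹ ∂μ = ∫ x : ℝ, ((x : ℂ) - z)⁻¹ ∂ν) :
    μ = ν := by
  refine ext_of_forall_integral_eq_of_IsFiniteMeasure fun f => ?_
  have hy : ∀ n : ℕ, (0 : ℝ) < 1 / ((n : ℝ) + 1) := fun n => by positivity
  have h1 := tendsto_integral_poisson (μ := μ) f hy tendsto_one_div_add_atTop_nhds_zero_nat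
  have h2 := tendsto_integral_poisson (μ := ν) f hy tendsto_one_div_add_atTop_nhds_zero_nat
  have h3 : ∀ n : ℕ, ∫ t, (∫ s, f (t + 1 / ((n : ℝ) + 1) * s) * (1 + s ^ 2)⁻¹) ∂μ =
      ∫ t, (∫ s, f (t + 1 / ((n : ℝ) + 1) * s) * (1 + s ^ 2)⁻¹) ∂ν := fun n => by
    rw [integral_poisson_swap (hy n), integral_poisson_swap (hy n)]
    refine integral_congr_ae (Eventually.of_forall fun x => ?_)
    simp only
    rw [h _ (by
      rw [Complex.add_im, Complex.ofReal_im, Complex.im_ofReal_mul, Complex.I_im, zero_add, mul_one]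
      exact (hy n).ne')]
  simp only [h3] at h1
  have h4 := tendsto_nhds_unique h1 h2
  rw [integral_mul_const, integral_mul_const] at h4
  exact mul_right_cancel₀ Real.pi_ne_zero h4

/-- Under Carleman's condition, the orthogonality measure is unique. -/
theorem IsOrthonormalizing.unique {a b : ℕ → ℝ} (hb : ∀ k, 0 < b k)
    (hC : ¬ Summable fun k => (b k)⁻¹) {μ ν : Measure ℝ} (hμ : IsOrthonormalizing a b μ)
    (hν : IsOrthonormalizing a b ν) : μ = ν := by
  have := hμ.prob
  have := hν.prob
  exact measure_eq_of_stieltjes_eq fun z hz => stieltjes_eq_of_isSpectralMeasureAt hb hC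
    (hμ.isSpectralMeasureAt hb) (hν.isSpectralMeasureAt hb) hz

/-! ### Carleman's condition -/

theorem lintegral_ofReal_gammaMeasure {s r : ℝ} (hs : 0 < s) (hr : 0 < r) :
    ∫⁻ x, ENNReal.ofReal x ∂(gammaMeasure s r) = ENNReal.ofReal (s / r) := by
  have h : ∀ x, gammaPDF s r x * ENNReal.ofReal x =
      ENNReal.ofReal (s / r) * gammaPDF (s + 1) r x := fun x => by
    rcases lt_or_ge x 0 with hx | hx
    · rw [gammaPDF, gammaPDF, gammaPDFReal, gammaPDFReal, if_neg hx.not_ge, if_neg hx.not_ge]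
      simp
    · rw [gammaPDF, gammaPDF, gammaPDFReal, gammaPDFReal, if_pos hx, if_pos hx,
        ← ENNReal.ofReal_mul' hx, ← ENNReal.ofReal_mul (by positivity), Real.Gamma_add_one hs.ne',
        Real.rpow_add_one hr.ne', add_sub_cancel_right]
      congr 1
      have h1 : x ^ s = x ^ (s - 1) * x := by
        rcases hx.eq_or_lt with rfl | hx
        · simp [Real.zero_rpow hs.ne']
        · rw [Real.rpow_sub_one hx.ne']
          field_simp
      have h2 := (Real.Gamma_pos_of_pos hs).ne'
      rw [h1]
      field_simp
  rw [gammaMeasure, lintegral_withDensity_eq_lintegral_mul _ (by exact (measurable_gammaPDFReal s r).ennreal_ofReal) (by fun_prop)]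
  simp only [Pi.mul_apply, h]
  rw [lintegral_const_mul' _ _ ENNReal.ofReal_ne_top, lintegral_gammaPDF_eq_one (by positivity) hr,
    mul_one]

theorem ae_pos_gammaMeasure (s r : ℝ) : ∀ᵐ x ∂(gammaMeasure s r), 0 < x := by
  rw [gammaMeasure, ae_withDensity_iff (by exact (measurable_gammaPDFReal s r).ennreal_ofReal)]
  filter_upwards [Measure.ae_ne volume (0 : ℝ)] with x hx h
  by_contra h0
  have : x < 0 := lt_of_le_of_ne (not_lt.1 h0) hx
  rw [gammaPDF, gammaPDFReal, if_neg this.not_ge] at h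
  simp at h

theorem three_le_sq_add {u : ℝ} (hu : 0 < u) : 3 ≤ u ^ 2 + 2 * u⁻¹ := by
  have h : u ^ 2 + 2 * u⁻¹ - 3 = (u - 1) ^ 2 * (u + 2) / u := by
    field_simp
    ring
  have : 0 ≤ (u - 1) ^ 2 * (u + 2) / u := by positivity
  linarith

/-- The power mean inequality between the exponents `2` and `-1`. -/
theorem cube_le_of_sum_inv_le {b : ℕ → ℝ} (hb : ∀ k, 0 < b k) {M : ℝ} (hM : 0 < M) {N : ℕ}
    (hN : 0 < N) (h : ∑ k ∈ Finset.range N, (b k)⁻¹ ≤ M) :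
    (N : ℝ) ^ 3 ≤ M ^ 2 * ∑ k ∈ Finset.range N, b k ^ 2 := by
  have hN' : (0 : ℝ) < N := Nat.cast_pos.2 hN
  have h1 : ∑ _k ∈ Finset.range N, (3 : ℝ) ≤
      ∑ k ∈ Finset.range N, ((b k * M / N) ^ 2 + 2 * (b k * M / N)⁻¹) :=
    Finset.sum_le_sum fun k _ => three_le_sq_add (by have := hb k; positivity)
  have h2 : ∀ k, (b k * M / N) ^ 2 + 2 * (b k * M / N)⁻¹ =
      (M ^ 2 / N ^ 2) * b k ^ 2 + (2 * N / M) * (b k)⁻¹ := fun k => by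
    have := (hb k).ne'
    field_simp
  simp only [h2, Finset.sum_add_distrib, ← Finset.mul_sum, Finset.sum_const, Finset.card_range,
    nsmul_eq_mul] at h1
  have h3 : 2 * N / M * ∑ k ∈ Finset.range N, (b k)⁻¹ ≤ 2 * N := by
    refine (mul_le_mul_of_nonneg_left h (by positivity)).trans (le_of_eq ?_)
    field_simp
  have h4 : (N : ℝ) ≤ M ^ 2 / N ^ 2 * ∑ k ∈ Finset.range N, b k ^ 2 := by linarith
  rw [div_mul_eq_mul_div, le_div_iff₀ (by positivity)] at h4
  linarith [h4, (by ring : (N : ℝ) * N ^ 2 = N ^ 3)]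

section

variable {Ω : Type*} [MeasurableSpace Ω] {P : Measure Ω} {β : ℝ} {a b : ℕ → Ω → ℝ}

theorem IsBetaHermiteJacobi.ae_pos (hβ : 0 < β) (h : IsBetaHermiteJacobi β P a b) :
    ∀ᵐ ω ∂P, ∀ k, 0 < b k ω := by
  rw [ae_all_iff]
  intro k
  have hl := h.law_offDiag k
  have h1 : ∀ᵐ x ∂(P.map (b k)), 0 < x := by
    rw [hl.map_eq, chiMeasure, Measure.map_map (by fun_prop) (by fun_prop),
      ae_map_iff (by fun_prop) measurableSet_Ioi]
    filter_upwards [ae_pos_gammaMeasure _ _] with x hx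
    exact div_pos (Real.sqrt_pos.2 hx) (Real.sqrt_pos.2 hβ)
  exact ae_of_ae_map hl.aemeasurable h1

theorem IsBetaHermiteJacobi.lintegral_sq (hβ : 0 < β) (h : IsBetaHermiteJacobi β P a b) (k : ℕ) :
    ∫⁻ ω, ENNReal.ofReal (b k ω ^ 2) ∂P = ENNReal.ofReal (k + 1) := by
  have hl := h.law_offDiag k
  rw [← lintegral_map' (f := fun x => ENNReal.ofReal (x ^ 2)) (by fun_prop) hl.aemeasurable,
    hl.map_eq, chiMeasure, Measure.map_map (by fun_prop) (by fun_prop),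
    lintegral_map (by fun_prop) (by fun_prop)]
  have h1 : ∀ x : ℝ, ENNReal.ofReal (((fun x => x / √β) ∘ Real.sqrt) x ^ 2) =
      ENNReal.ofReal β⁻¹ * ENNReal.ofReal x := fun x => by
    rw [← ENNReal.ofReal_mul (by positivity), Function.comp_apply, div_pow, Real.sq_sqrt hβ.le]
    rcases le_total 0 x with hx | hx
    · rw [Real.sq_sqrt hx, div_eq_inv_mul]
    · rw [Real.sqrt_eq_zero_of_nonpos hx, ENNReal.ofReal_of_nonpos
        (mul_nonpos_of_nonneg_of_nonpos (by positivity) hx)]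
      simp
  simp only [h1]
  rw [lintegral_const_mul _ (by fun_prop), lintegral_ofReal_gammaMeasure (by positivity)
    (by norm_num), ← ENNReal.ofReal_mul (by positivity)]
  congr 1
  field_simp

/-- The off-diagonal entries almost surely satisfy Carleman's condition. -/
theorem IsBetaHermiteJacobi.ae_not_summable (hβ : 0 < β) (h : IsBetaHermiteJacobi β P a b) :
    ∀ᵐ ω ∂P, ¬ Summable fun k => (b k ω)⁻¹ := by
  have hbm : ∀ k, AEMeasurable (b k) P := fun k => (h.law_offDiag k).aemeasurable
  let F : ℕ → Ω → ℝ≥0∞ := fun N ω =>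
    ENNReal.ofReal ((N + 1 : ℝ) ^ 3)⁻¹ * ∑ k ∈ Finset.range (N + 1), ENNReal.ofReal (b k ω ^ 2)
  have hF : ∀ N, AEMeasurable (F N) P := fun N =>
    (Finset.aemeasurable_fun_sum _ fun k _ => ((hbm k).pow_const 2).ennreal_ofReal).const_mul _
  have hI : ∀ N, ∫⁻ ω, F N ω ∂P ≤ ENNReal.ofReal (1 / ((N : ℝ) + 1)) := fun N => by
    rw [lintegral_const_mul' _ _ ENNReal.ofReal_ne_top,
      lintegral_finsetSum' _ fun k _ => ((hbm k).pow_const 2).ennreal_ofReal]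
    simp only [h.lintegral_sq hβ]
    rw [← ENNReal.ofReal_sum_of_nonneg fun k _ => by positivity, ← ENNReal.ofReal_mul (by positivity)]
    refine ENNReal.ofReal_le_ofReal ?_
    have h1 : ∑ k ∈ Finset.range (N + 1), ((k : ℝ) + 1) ≤ ∑ _k ∈ Finset.range (N + 1), ((N : ℝ) + 1) :=
      Finset.sum_le_sum fun k hk => by
        have : (k : ℝ) ≤ N := Nat.cast_le.2 (Nat.lt_succ_iff.1 (Finset.mem_range.1 hk))
        linarith
    rw [Finset.sum_const, Finset.card_range, nsmul_eq_mul] at h1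
    push_cast at h1
    rw [inv_mul_le_iff₀ (by positivity)]
    refine h1.trans (le_of_eq ?_)
    field_simp
  have hlim : ∫⁻ ω, liminf (fun N => F N ω) atTop ∂P = 0 := by
    refine le_antisymm ((lintegral_liminf_le' hF).trans ?_) zero_le
    have h0 : Tendsto (fun N : ℕ => ENNReal.ofReal (1 / ((N : ℝ) + 1))) atTop (𝓝 0) := by
      simpa using ENNReal.tendsto_ofReal tendsto_one_div_add_atTop_nhds_zero_nat
    rw [← h0.liminf_eq]
    exact liminf_le_liminf (Eventually.of_forall hI)
  have hLm : AEMeasurable (fun ω => liminf (fun N => F N ω) atTop) P := by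
    simp only [liminf_eq_iSup_iInf_of_nat']
    exact AEMeasurable.iSup fun n => AEMeasurable.iInf fun i => hF (i + n)
  rw [lintegral_eq_zero_iff' hLm] at hlim
  filter_upwards [hlim, h.ae_pos hβ] with ω h1 hpos hs
  set M := ∑' k, (b k ω)⁻¹ with hM
  have hM0 : 0 < M := hs.tsum_pos (fun k => (inv_pos.2 (hpos k)).le) 0 (inv_pos.2 (hpos 0))
  have h2 : ∀ N, ENNReal.ofReal (M ^ 2)⁻¹ ≤ F N ω := fun N => by
    have h3 := cube_le_of_sum_inv_le hpos hM0 (Nat.succ_pos N)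
      (hs.sum_le_tsum _ fun k _ => (inv_pos.2 (hpos k)).le)
    simp only [F]
    rw [← ENNReal.ofReal_sum_of_nonneg fun k _ => sq_nonneg _, ← ENNReal.ofReal_mul (by positivity)]
    refine ENNReal.ofReal_le_ofReal ?_
    push_cast at h3
    rw [inv_le_iff_one_le_mul₀ (by positivity), mul_comm, ← mul_assoc, mul_comm (M ^ 2), mul_assoc,
      ← div_eq_inv_mul, one_le_div (by positivity)]
    exact h3
  have h4 : ENNReal.ofReal (M ^ 2)⁻¹ ≤ liminf (fun N => F N ω) atTop :=
    le_liminf_of_le (by isBoundedDefault) (Eventually.of_forall h2)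
  rw [h1, Pi.zero_apply, nonpos_iff_eq_zero, ENNReal.ofReal_eq_zero] at h4
  have : 0 < (M ^ 2)⁻¹ := by positivity
  linarith

end

/-! ### Properties of the orthogonality measure -/

section Orthonormal

variable {a b : ℕ → ℝ} {μ : Measure ℝ}

theorem IsOrthonormalizing.integrable_eval_mul (h : IsOrthonormalizing a b μ) (p q : ℝ[X]) :
    Integrable (fun x => p.eval x * q.eval x) μ := by
  simpa using h.integrable (p * q)

theorem IsOrthonormalizing.eq_zero_of_forall (hb : ∀ k, 0 < b k) (h : IsOrthonormalizing a b μ)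
    {q : ℝ[X]} (hq : ∀ l, ∫ x, q.eval x * (onPoly a b l).eval x ∂μ = 0) : q = 0 := by
  have hmem : q ∈ Submodule.span ℝ (Set.range (onPoly a b)) := by rw [span_onPoly hb]; trivial
  obtain ⟨c, hc⟩ := Finsupp.mem_span_range_iff_exists_finsupp.1 hmem
  have hc0 : c = 0 := by
    ext l
    rw [Finsupp.zero_apply, ← hq l, ← hc, Finsupp.sum]
    simp only [eval_finsetSum, eval_smul, smul_eq_mul, Finset.sum_mul, mul_assoc]
    rw [integral_finsetSum _ fun k _ => (h.integrable_eval_mul _ _).const_mul _]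
    simp only [integral_const_mul, h.integral_mul, mul_ite, mul_one, mul_zero,
      Finset.sum_ite_eq', Finsupp.mem_support_iff]
    split_ifs with h0
    · rfl
    · exact not_not.1 h0
  rw [← hc, hc0, Finsupp.sum_zero_index]

theorem IsOrthonormalizing.infinite_support (hb : ∀ k, 0 < b k) (h : IsOrthonormalizing a b μ) :
    μ.support.Infinite := by
  intro hfin
  have hq : ∏ y ∈ hfin.toFinset, (X - C y) = 0 := h.eq_zero_of_forall hb fun l => by
    refine integral_eq_zero_of_ae ?_
    filter_upwards [μ.support_mem_ae] with x hx
    rw [eval_prod, Finset.prod_eq_zero (hfin.mem_toFinset.2 hx) (by simp), zero_mul]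
    rfl
  exact (monic_prod_of_monic _ _ fun y _ => monic_X_sub_C y).ne_zero hq

theorem IsOrthonormalizing.integral_eq_zero_of_degree_lt (hb : ∀ k, 0 < b k)
    (h : IsOrthonormalizing a b μ) (n : ℕ) {m : ℕ} (hmn : m ≤ n) :
    ∀ q : ℝ[X], q.degree < m → ∫ x, (onPoly a b n).eval x * q.eval x ∂μ = 0 := by
  induction m with
  | zero =>
    intro q hq
    have : q = 0 := by rwa [Nat.cast_zero, Nat.WithBot.lt_zero_iff, degree_eq_bot] at hq
    simp [this]
  | succ m ih =>
    intro q hq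
    set c := q.coeff m / (onPoly a b m).leadingCoeff with hc
    have hl := (leadingCoeff_onPoly_pos (a := a) hb m).ne'
    have hd := degree_onPoly (a := a) hb m
    have hcoeff : (onPoly a b m).coeff m = (onPoly a b m).leadingCoeff := by
      rw [leadingCoeff, natDegree_eq_of_degree_eq_some hd]
    have hr : (q - C c * onPoly a b m).degree < m := by
      rw [degree_lt_iff_coeff_zero]
      intro k hk
      rw [coeff_sub, coeff_C_mul]
      rcases hk.eq_or_lt with rfl | hk
      · rw [hcoeff, hc, div_mul_cancel₀ _ hl, sub_self]
      · rw [coeff_eq_zero_of_degree_lt (hq.trans_le (by exact_mod_cast hk)),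
          coeff_eq_zero_of_degree_lt (hd.trans_lt (by exact_mod_cast hk)), mul_zero, sub_zero]
    have h1 := ih (Nat.le_of_succ_le hmn) _ hr
    have h2 : ∀ x, (onPoly a b n).eval x * (q - C c * onPoly a b m).eval x =
        (onPoly a b n).eval x * q.eval x -
          c * ((onPoly a b n).eval x * (onPoly a b m).eval x) := fun x => by
      simp only [eval_sub, eval_mul, eval_C]
      ring
    simp only [h2] at h1
    rw [integral_sub (h.integrable_eval_mul _ _) ((h.integrable_eval_mul _ _).const_mul c),
      integral_const_mul, h.integral_mul, if_neg (by omega), mul_zero, sub_zero] at h1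
    exact h1

/-- The orthonormal polynomials given by the recursion are the only ones. -/
theorem IsOrthonormalizing.isOrthonormalPolynomial_iff (hb : ∀ k, 0 < b k)
    (h : IsOrthonormalizing a b μ) (n : ℕ) (q : ℝ[X]) :
    IsOrthonormalPolynomial μ n q ↔ q = onPoly a b n := by
  have hl := leadingCoeff_onPoly_pos (a := a) hb
  have hd := degree_onPoly (a := a) hb
  constructor
  · intro hq
    set c := q.leadingCoeff / (onPoly a b n).leadingCoeff with hc
    have hc0 : 0 < c := div_pos hq.leadingCoeff_pos (hl n)
    have hdeg : (q - C c * onPoly a b n).degree < n := by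
      rw [← hq.degree_eq]
      refine degree_sub_lt_left ?_ (leadingCoeff_ne_zero.1 hq.leadingCoeff_pos.ne') ?_
      · rw [degree_C_mul hc0.ne', hd, hq.degree_eq]
      · rw [leadingCoeff_mul, leadingCoeff_C, hc, div_mul_cancel₀ _ (hl n).ne']
    have hzero : q - C c * onPoly a b n = 0 := h.eq_zero_of_forall hb fun l => by
      rcases lt_or_ge l n with hln | hln
      · have h1 := hq.orthogonal (onPoly a b l) (by rw [hd]; exact_mod_cast hln)
        have h2 : ∀ x, (q - C c * onPoly a b n).eval x * (onPoly a b l).eval x =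
            q.eval x * (onPoly a b l).eval x -
              c * ((onPoly a b n).eval x * (onPoly a b l).eval x) := fun x => by
          simp only [eval_sub, eval_mul, eval_C]
          ring
        simp only [h2]
        rw [integral_sub (h.integrable_eval_mul _ _) ((h.integrable_eval_mul _ _).const_mul c),
          integral_const_mul, h.integral_mul, if_neg hln.ne', h1, mul_zero, sub_zero]
      · simp only [mul_comm (eval _ (q - _))]
        exact h.integral_eq_zero_of_degree_lt hb l hln _ hdeg
    rw [sub_eq_zero] at hzero
    have h3 := hq.norm_eq_one
    simp only [hzero, eval_mul, eval_C, mul_pow] at h3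
    have h4 := h.integral_mul n n
    simp only [← sq, if_true] at h4
    rw [integral_const_mul, h4, mul_one] at h3
    have h5 : c = 1 := (pow_eq_one_iff_of_nonneg hc0.le two_ne_zero).1 h3
    rw [hzero, h5, C_1, one_mul]
  · rintro rfl
    refine ⟨hd n, hl n, ?_, h.integral_eq_zero_of_degree_lt hb n le_rfl⟩
    have h4 := h.integral_mul n n
    simpa only [← sq, if_true] using h4

theorem roots_onPoly_eq (hb : ∀ k, 0 < b k) (n : ℕ) :
    (onPoly a b n).roots = (rootPoly (gaussNodes a b n)).roots := by
  rw [roots_onPoly hb, (gaussNodes_spec hb n).2]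

theorem orderedRoots_onPoly (hb : ∀ k, 0 < b k) (n : ℕ) :
    orderedRoots n (onPoly a b n) = gaussNodes a b n := by
  rw [← orderedRoots_rootPoly (gaussNodes_spec hb n).1.monotone]
  unfold orderedRoots
  rw [roots_onPoly_eq hb]

theorem card_roots_onPoly (hb : ∀ k, 0 < b k) (n : ℕ) : (onPoly a b n).roots.card = n := by
  rw [roots_onPoly_eq hb, roots_rootPoly]
  simp

theorem nodup_roots_onPoly (hb : ∀ k, 0 < b k) (n : ℕ) : (onPoly a b n).roots.Nodup := by
  rw [roots_onPoly_eq hb, roots_rootPoly]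
  exact Finset.univ.nodup.map (gaussNodes_spec hb n).1.injective

end Orthonormal

/-! ### Measurability of the random measure -/

/-- A pointwise weak limit of random probability measures is a random measure. -/
theorem measurable_of_tendsto_probabilityMeasure {Ω : Type*} [MeasurableSpace Ω]
    {m : ℕ → Ω → ProbabilityMeasure ℝ} {μ : Ω → ProbabilityMeasure ℝ}
    (hm : ∀ N, Measurable fun ω => (m N ω : Measure ℝ))
    (h : ∀ ω, Tendsto (fun N => m N ω) atTop (𝓝 (μ ω))) :
    Measurable fun ω => (μ ω : Measure ℝ) := by
  refine Measurable.measure_of_isPiSystem_of_isProbabilityMeasure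
    (by rw [BorelSpace.measurable_eq (α := ℝ), borel_eq_generateFrom_isClosed]) isPiSystem_isClosed
    fun F hF => ?_
  have hδ : ∀ n : ℕ, (0 : ℝ) < 1 / ((n : ℝ) + 1) := fun n => by positivity
  refine measurable_of_tendsto_metrizable
    (f := fun n ω => ∫⁻ x, (thickenedIndicator (hδ n) F x : ℝ≥0∞) ∂(μ ω : Measure ℝ))
    (fun n => ?_) (tendsto_pi_nhds.2 fun ω => tendsto_lintegral_thickenedIndicator_of_isClosed _ hF
      hδ tendsto_one_div_add_atTop_nhds_zero_nat)
  refine measurable_of_tendsto_metrizable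
    (f := fun N ω => ∫⁻ x, (thickenedIndicator (hδ n) F x : ℝ≥0∞) ∂(m N ω : Measure ℝ))
    (fun N => ?_) (tendsto_pi_nhds.2 fun ω =>
      ProbabilityMeasure.tendsto_iff_forall_lintegral_tendsto.1 (h ω) _)
  exact (Measure.measurable_lintegral
    ((thickenedIndicator (hδ n) F).continuous.measurable.coe_nnreal_ennreal)).comp (hm N)

section

variable {Ω : Type*} [MeasurableSpace Ω] {a b : ℕ → Ω → ℝ}

theorem measurable_gaussNodes (ha : ∀ k, Measurable (a k)) (hb : ∀ k, Measurable (b k)) (n : ℕ) :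
    Measurable fun ω => gaussNodes (fun k => a k ω) (fun k => b k ω) n := by
  have h : Measurable fun ω => Sum.elim (fun k => a k ω) (fun k => b k ω ^ 2) :=
    measurable_pi_lambda _ fun i => by
      cases i
      · exact ha _
      · exact (hb _).pow_const 2
  exact (measurable_rootsOfCoeffs n).comp ((measurable_opCoeffs n).comp h).fst

theorem measurable_eval_onPoly (ha : ∀ k, Measurable (a k)) (hb : ∀ k, Measurable (b k)) (n : ℕ)
    {x : Ω → ℝ} (hx : Measurable x) :
    Measurable fun ω => (onPoly (fun k => a k ω) (fun k => b k ω) n).eval (x ω) := by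
  have h : Measurable (fun ω =>
        (opPair (fun k => a k ω) (fun k => b k ω ^ 2) n).1.eval (x ω)) ∧
      Measurable (fun ω => (opPair (fun k => a k ω) (fun k => b k ω ^ 2) n).2.eval (x ω)) := by
    induction n with
    | zero => simp [opPair]
    | succ n ih =>
      simp only [opPair, eval_sub, eval_mul, eval_X, eval_C]
      exact ⟨((hx.sub (ha n)).mul ih.1).sub ih.2, ((hb n).pow_const 2).mul ih.1⟩
  simp only [onPoly, eval_mul, eval_C]
  exact (Finset.measurable_fun_prod _ fun k _ => hb k).inv.mul h.1

theorem measurable_gaussMeasure (ha : ∀ k, Measurable (a k)) (hb : ∀ k, Measurable (b k))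
    (n : ℕ) : Measurable fun ω => gaussMeasure (fun k => a k ω) (fun k => b k ω) n := by
  have hx : ∀ i, Measurable fun ω => gaussNodes (fun k => a k ω) (fun k => b k ω) n i := fun i =>
    (measurable_pi_apply i).comp (measurable_gaussNodes ha hb n)
  refine Measure.measurable_of_measurable_coe _ fun s hs => ?_
  simp only [gaussMeasure, Measure.coe_finsetSum, Finset.sum_apply, Measure.smul_apply,
    smul_eq_mul]
  refine Finset.measurable_fun_sum _ fun i _ => Measurable.mul ?_ ?_
  · exact (Finset.measurable_fun_sum _ fun k _ =>
      (measurable_eval_onPoly ha hb k (hx i)).pow_const 2).inv.ennreal_ofReal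
  · exact (Measure.measurable_coe hs).comp (Measure.measurable_dirac.comp (hx i))

/-- A random Jacobi matrix that almost surely satisfies Carleman's condition has a random
orthogonality measure. -/
theorem exists_measurable_isOrthonormalizing {P : Measure Ω} (ha : ∀ k, Measurable (a k))
    (hb : ∀ k, Measurable (b k)) (hpos : ∀ᵐ ω ∂P, ∀ k, 0 < b k ω)
    (hC : ∀ᵐ ω ∂P, ¬ Summable fun k => (b k ω)⁻¹) :
    ∃ μ : Ω → Measure ℝ, Measurable μ ∧ (∀ ω, IsProbabilityMeasure (μ ω)) ∧
      ∀ᵐ ω ∂P, IsOrthonormalizing (fun k => a k ω) (fun k => b k ω) (μ ω) := by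
  classical
  obtain ⟨t, hsub, ht, ht0⟩ := exists_measurable_superset_of_null (ae_iff.1 (hpos.and hC))
  have hgood : ∀ ω, ω ∉ t → (∀ k, 0 < b k ω) ∧ ¬ Summable fun k => (b k ω)⁻¹ := fun ω hω => by
    by_contra h
    exact hω (hsub h)
  let m : ℕ → Ω → ProbabilityMeasure ℝ := fun N ω =>
    if hω : ω ∈ t then ⟨Measure.dirac 0, inferInstance⟩
    else ⟨gaussMeasure (fun k => a k ω) (fun k => b k ω) (N + 1),
      isProbabilityMeasure_gaussMeasure (hgood ω hω).1 N⟩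
  have hmcoe : ∀ N ω, (m N ω : Measure ℝ) = if ω ∈ t then Measure.dirac 0 else
      gaussMeasure (fun k => a k ω) (fun k => b k ω) (N + 1) := fun N ω => by
    by_cases hω : ω ∈ t <;> simp [m, hω]
  have hex : ∀ ω, ∃ μ : ProbabilityMeasure ℝ, Tendsto (fun N => m N ω) atTop (𝓝 μ) ∧
      (ω ∉ t → IsOrthonormalizing (fun k => a k ω) (fun k => b k ω) μ) := fun ω => by
    by_cases hω : ω ∈ t
    · refine ⟨⟨Measure.dirac 0, inferInstance⟩, ?_, fun h => absurd hω h⟩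
      have : (fun N => m N ω) = fun _ => ⟨Measure.dirac 0, inferInstance⟩ := by
        funext N
        exact dif_pos hω
      rw [this]
      exact tendsto_const_nhds
    · obtain ⟨h1, h2⟩ := hgood ω hω
      obtain ⟨μ, hμ, hlim⟩ := exists_tendsto_gaussMeasure (a := fun k => a k ω) h1
        (μs := fun N => m N ω) (fun N => by rw [hmcoe, if_neg hω])
        fun μ ν hμ hν => hμ.unique h1 h2 hν
      exact ⟨μ, hlim, fun _ => hμ⟩
  choose μ hlim hμ using hex
  refine ⟨fun ω => μ ω, measurable_of_tendsto_probabilityMeasure (fun N => ?_) hlim,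
    fun ω => inferInstance, ?_⟩
  · simp only [hmcoe]
    exact Measurable.ite ht measurable_const (measurable_gaussMeasure ha hb _)
  · filter_upwards [measure_eq_zero_iff_ae_notMem.1 ht0] with ω hω
    exact hμ ω hω

end

/-! ### The characteristic polynomial of a Jacobi matrix -/

section Charpoly

variable {a b : ℕ → ℝ}

theorem jacobiMinor_apply (a b : ℕ → ℝ) {n : ℕ} (i j : Fin n) :
    jacobiMinor a b n i j = (if (j : ℕ) = i then a i else 0) +
      (if (j : ℕ) = i + 1 then b i else 0) + (if (j : ℕ) + 1 = i then b j else 0) := by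
  unfold jacobiMinor
  split_ifs <;> first | omega | simp

theorem jacobiMinor_mulVec_onPoly (hb : ∀ k, 0 < b k) {n : ℕ} {x : ℝ}
    (hx : (onPoly a b n).eval x = 0) :
    (jacobiMinor a b n).mulVec (fun k => (onPoly a b k).eval x) =
      fun k : Fin n => x * (onPoly a b k).eval x := by
  ext i
  have hup : ∑ j ∈ Finset.range n, (if j = (i : ℕ) + 1 then b i else 0) * (onPoly a b j).eval x =
      b i * (onPoly a b (i + 1)).eval x := by
    simp only [ite_mul, zero_mul, Finset.sum_ite_eq', Finset.mem_range]
    split_ifs with h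
    · rfl
    · rw [show (i : ℕ) + 1 = n by omega, hx, mul_zero]
  have hdiag : ∑ j ∈ Finset.range n, (if j = (i : ℕ) then a i else 0) * (onPoly a b j).eval x =
      a i * (onPoly a b i).eval x := by
    simp only [ite_mul, zero_mul, Finset.sum_ite_eq', Finset.mem_range, i.2, if_true]
  rw [Matrix.mulVec, dotProduct]
  simp only [jacobiMinor_apply]
  rw [Fin.sum_univ_eq_sum_range (fun j => ((if j = (i : ℕ) then a i else 0) +
    (if j = (i : ℕ) + 1 then b i else 0) + (if j + 1 = (i : ℕ) then b j else 0)) *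
      (onPoly a b j).eval x)]
  simp only [add_mul, Finset.sum_add_distrib]
  rw [hup, hdiag]
  obtain ⟨m, hm⟩ := i
  cases m with
  | zero =>
    have h := eval_onPoly_one (a := a) hb x
    simp only [Nat.add_eq_zero_iff, one_ne_zero, and_false, if_false, zero_mul,
      Finset.sum_const_zero]
    linarith
  | succ m =>
    have h := eval_onPoly_add_two (a := a) hb m x
    simp only [Nat.add_right_cancel_iff, ite_mul, zero_mul, Finset.sum_ite_eq', Finset.mem_range,
      Nat.lt_of_succ_lt hm, if_true]
    linarith

/-- The zeros of the orthogonal polynomial are the eigenvalues of the truncated Jacobi matrix. -/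
theorem charpoly_jacobiMinor (hb : ∀ k, 0 < b k) (n : ℕ) :
    (jacobiMinor a b n).charpoly = rootPoly (gaussNodes a b n) := by
  set x := gaussNodes a b n with hxdef
  have hd : (jacobiMinor a b n).charpoly.degree = n := by
    rw [Matrix.charpoly_degree_eq_dim, Fintype.card_fin]
  refine Polynomial.eq_of_degree_sub_lt_of_eval_index_eq (v := x) Finset.univ
    (gaussNodes_spec hb n).1.injective.injOn ?_ fun i _ => ?_
  · rw [Finset.card_univ, Fintype.card_fin, ← hd]
    exact degree_sub_lt_left (by rw [hd, degree_rootPoly]) (Matrix.charpoly_monic _).ne_zero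
      (by rw [(Matrix.charpoly_monic _).leadingCoeff, (rootPoly_monic x).leadingCoeff])
  · rw [eval_rootPoly, Finset.prod_eq_zero (Finset.mem_univ i) (sub_self _), Matrix.eval_charpoly,
      ← Matrix.exists_mulVec_eq_zero_iff]
    refine ⟨fun k => (onPoly a b k).eval (x i), fun h => ?_, ?_⟩
    · have := congrFun h ⟨0, i.pos⟩
      simp [onPoly_zero] at this
    · rw [Matrix.sub_mulVec, jacobiMinor_mulVec_onPoly hb (eval_onPoly_gaussNodes hb n i)]
      ext k
      simp [Matrix.scalar_apply, hxdef]

end Charpoly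

/-! ### Eigenvalues of symmetric matrices -/

theorem orderedRoots_charpoly {n : ℕ} {A : Matrix (Fin n) (Fin n) ℝ} (hA : A.IsSymm) :
    orderedRoots n A.charpoly = rootsOfCoeffs n (toFn n A.charpoly) := by
  have hH : A.IsHermitian := by
    rw [Matrix.IsHermitian, Matrix.conjTranspose_eq_transpose_of_trivial]
    exact hA
  set x := hH.eigenvalues ∘ Tuple.sort hH.eigenvalues with hx
  have hmono : Monotone x := Tuple.monotone_sort _
  have h : A.charpoly = rootPoly x := by
    rw [hH.charpoly_eq, rootPoly, Lagrange.nodal,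
      ← Equiv.prod_comp (Tuple.sort hH.eigenvalues)]
    rfl
  rw [h, orderedRoots_rootPoly hmono]
  exact (rootsOfCoeffs_rootCoeffs hmono).symm

theorem measurable_coeff_charpoly {n : ℕ} {α : Type*} [MeasurableSpace α]
    {A : α → Matrix (Fin n) (Fin n) ℝ} (hA : ∀ i j, Measurable fun x => A x i j) (k : ℕ) :
    Measurable fun x => (A x).charpoly.coeff k := by
  have h : ∀ x, (A x).charpoly.coeff k = MvPolynomial.eval (fun q : Fin n × Fin n => A x q.1 q.2)
      ((Matrix.charpoly.univ ℝ (Fin n)).coeff k) := fun x =>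
    (Matrix.charpoly.univ_coeff_eval₂Hom (Fin n) (RingHom.id ℝ) (fun q => A x q.1 q.2) k).symm
  simp only [h]
  exact (MvPolynomial.continuous_eval _).measurable.comp
    (measurable_pi_lambda _ fun q => hA q.1 q.2)

/-! ### The tridiagonal model -/

/-- The positions on and directly above the diagonal. -/
abbrev UpperIndex (n : ℕ) : Type :=
  {s : Fin n × Fin n // (s.1 : ℕ) = s.2 ∨ (s.1 : ℕ) + 1 = s.2}

/-- The symmetric tridiagonal matrix with the given entries on and above the diagonal. -/
def tridiagonalOf (n : ℕ) (x : UpperIndex n → ℝ) : Matrix (Fin n) (Fin n) ℝ := fun i j =>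
  if h : (i : ℕ) = j ∨ (i : ℕ) + 1 = j then x ⟨(i, j), h⟩
  else if h : (j : ℕ) + 1 = i then x ⟨(j, i), Or.inr h⟩
  else 0

theorem isSymm_tridiagonalOf {n : ℕ} (x : UpperIndex n → ℝ) : (tridiagonalOf n x).IsSymm := by
  ext i j
  rw [Matrix.transpose_apply]
  rcases lt_trichotomy i j with h | rfl | h
  · have h1 : ¬ ((j : ℕ) = i ∨ (j : ℕ) + 1 = i) := by have := Fin.lt_def.1 h; omega
    have h2 : ¬ ((j : ℕ) + 1 = i) := fun h => h1 (Or.inr h)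
    by_cases h3 : (i : ℕ) + 1 = j
    · have h4 : (i : ℕ) = j ∨ (i : ℕ) + 1 = j := Or.inr h3
      rw [tridiagonalOf, tridiagonalOf, dif_neg h1, dif_pos h3, dif_pos h4]
    · have h4 : ¬ ((i : ℕ) = j ∨ (i : ℕ) + 1 = j) := by have := Fin.lt_def.1 h; omega
      rw [tridiagonalOf, tridiagonalOf, dif_neg h1, dif_neg h3, dif_neg h4, dif_neg h2]
  · rfl
  · have h1 : ¬ ((i : ℕ) = j ∨ (i : ℕ) + 1 = j) := by have := Fin.lt_def.1 h; omega
    have h2 : ¬ ((i : ℕ) + 1 = j) := fun h => h1 (Or.inr h)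
    by_cases h3 : (j : ℕ) + 1 = i
    · have h4 : (j : ℕ) = i ∨ (j : ℕ) + 1 = i := Or.inr h3
      rw [tridiagonalOf, tridiagonalOf, dif_neg h1, dif_pos h3, dif_pos h4]
    · have h4 : ¬ ((j : ℕ) = i ∨ (j : ℕ) + 1 = i) := by have := Fin.lt_def.1 h; omega
      rw [tridiagonalOf, tridiagonalOf, dif_neg h1, dif_neg h3, dif_neg h4, dif_neg h2]

theorem measurable_tridiagonalOf {n : ℕ} (i j : Fin n) :
    Measurable fun x => tridiagonalOf n x i j := by
  unfold tridiagonalOf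
  split_ifs
  · exact measurable_pi_apply _
  · exact measurable_pi_apply _
  · exact measurable_const

/-- The law of an entry of the tridiagonal model. -/
noncomputable def entryLaw (β : ℝ) (n : ℕ) (s : UpperIndex n) : Measure ℝ :=
  if (s.1.1 : ℕ) = s.1.2 then gaussianReal 0 (2 / (n * β)).toNNReal
  else (chiMeasure (((n : ℝ) - ((s.1.1 : ℝ) + 1)) * β)).map (fun x => x / √(n * β))

section Tridiagonal

variable {Ω : Type*} [MeasurableSpace Ω] {P : Measure Ω} {β : ℝ} {n : ℕ}
  {T : Ω → Matrix (Fin n) (Fin n) ℝ}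

theorem IsBetaHermiteTridiagonal.eq_tridiagonalOf (h : IsBetaHermiteTridiagonal β n P T) (ω : Ω) :
    T ω = tridiagonalOf n fun s => T ω s.1.1 s.1.2 := by
  ext i j
  unfold tridiagonalOf
  split_ifs with h1 h2
  · rfl
  · exact (h.symm ω).apply j i
  · rcases lt_or_ge (i : ℕ) j with h3 | h3
    · exact h.tridiagonal ω i j (by omega)
    · rw [(h.symm ω).apply j i]
      exact h.tridiagonal ω j i (by omega)

theorem IsBetaHermiteTridiagonal.hasLaw_entries [IsProbabilityMeasure P]
    (h : IsBetaHermiteTridiagonal β n P T) :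
    HasLaw (fun ω (s : UpperIndex n) => T ω s.1.1 s.1.2) (Measure.pi (entryLaw β n)) P := by
  refine iIndepFun.hasLaw_pi (fun s => ?_) h.indep
  obtain ⟨⟨i, j⟩, hs⟩ := s
  by_cases hij : (i : ℕ) = j
  · obtain rfl := Fin.ext hij
    rw [entryLaw, if_pos hij]
    exact h.law_diag i
  · rw [entryLaw, if_neg hij]
    exact h.law_offDiag i j (hs.resolve_left hij)

/-- The joint law of the ordered eigenvalues of the tridiagonal model depends only on the
parameters. -/
theorem IsBetaHermiteTridiagonal.hasLaw_eigenvalues [IsProbabilityMeasure P]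
    (h : IsBetaHermiteTridiagonal β n P T) (r : ℝ) :
    HasLaw (fun ω => orderedRoots n (r • T ω).charpoly)
      ((Measure.pi (entryLaw β n)).map fun x => orderedRoots n (r • tridiagonalOf n x).charpoly)
      P := by
  have hm : Measurable fun x => orderedRoots n (r • tridiagonalOf n x).charpoly := by
    have h1 : ∀ x, orderedRoots n (r • tridiagonalOf n x).charpoly =
        rootsOfCoeffs n (toFn n (r • tridiagonalOf n x).charpoly) := fun x =>
      orderedRoots_charpoly ((isSymm_tridiagonalOf x).smul r)
    simp only [h1]
    refine (measurable_rootsOfCoeffs n).comp (measurable_pi_lambda _ fun i => ?_)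
    simp only [toFn_apply]
    exact measurable_coeff_charpoly
      (fun i j => (measurable_tridiagonalOf i j).const_mul r) _
  have h2 : (fun ω => orderedRoots n (r • T ω).charpoly) =
      (fun x => orderedRoots n (r • tridiagonalOf n x).charpoly) ∘
        fun ω (s : UpperIndex n) => T ω s.1.1 s.1.2 := by
    funext ω
    rw [Function.comp_apply, ← h.eq_tridiagonalOf ω]
  rw [h2]
  exact HasLaw.comp ⟨hm.aemeasurable, rfl⟩ h.hasLaw_entries

end Tridiagonal

/-! ### The minors of the random Jacobi matrix -/

theorem isSymm_jacobiMinor (a b : ℕ → ℝ) (n : ℕ) : (jacobiMinor a b n).IsSymm := by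
  ext i j
  rw [Matrix.transpose_apply]
  by_cases hij : i = j
  · rw [hij]
  · have h : (i : ℕ) ≠ j := fun h => hij (Fin.ext h)
    unfold jacobiMinor
    split_ifs <;> first | omega | rfl

section Minors

variable {Ω : Type*} [MeasurableSpace Ω] {P : Measure Ω} {β : ℝ} {a b : ℕ → Ω → ℝ}

theorem IsBetaHermiteJacobi.law_diag_scaled (hβ : 0 < β) (h : IsBetaHermiteJacobi β P a b) {n : ℕ}
    (hn : 0 < n) (k : ℕ) :
    HasLaw (fun ω => (√(n : ℝ))⁻¹ * a k ω) (gaussianReal 0 (2 / (n * β)).toNNReal) P := by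
  have h1 := gaussianReal_const_mul (h.law_diag k) (√(n : ℝ))⁻¹
  have hn' : (0 : ℝ) < n := Nat.cast_pos.2 hn
  convert h1 using 2
  · rw [mul_zero]
  · apply NNReal.eq
    rw [NNReal.coe_mul, Real.coe_toNNReal _ (by positivity), Real.coe_toNNReal _ (by positivity)]
    change _ = (√(n : ℝ))⁻¹ ^ 2 * _
    rw [inv_pow, Real.sq_sqrt hn'.le]
    field_simp

theorem IsBetaHermiteJacobi.law_offDiag_scaled (h : IsBetaHermiteJacobi β P a b) (n k : ℕ) :
    HasLaw (fun ω => (√(n : ℝ))⁻¹ * b k ω)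
      ((chiMeasure (((k : ℝ) + 1) * β)).map (fun x => x / √(n * β))) P := by
  have h1 : HasLaw (fun x : ℝ => (√(n : ℝ))⁻¹ * x)
      ((chiMeasure (((k : ℝ) + 1) * β)).map (fun x => x / √(n * β)))
      ((chiMeasure (((k : ℝ) + 1) * β)).map (fun x => x / √β)) := by
    refine ⟨by fun_prop, ?_⟩
    rw [Measure.map_map (by fun_prop) (by fun_prop)]
    congr 1
    funext x
    rw [Function.comp_apply, Real.sqrt_mul (Nat.cast_nonneg n), div_eq_mul_inv, div_eq_mul_inv,
      mul_inv]
    ring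
  exact h1.comp (h.law_offDiag k)

theorem smul_jacobiMinor_rev_apply (a b : ℕ → ℝ) (r : ℝ) {n : ℕ} (i j : Fin n) :
    (r • jacobiMinor a b n).submatrix Fin.rev Fin.rev i j =
      r * jacobiMinor a b n i.rev j.rev := rfl

/-- The reversed and scaled minors of the random Jacobi matrix are tridiagonal models. -/
theorem IsBetaHermiteJacobi.isBetaHermiteTridiagonal (hβ : 0 < β)
    (h : IsBetaHermiteJacobi β P a b) (n : ℕ) :
    IsBetaHermiteTridiagonal β n P fun ω =>
      ((√(n : ℝ))⁻¹ • jacobiMinor (fun k => a k ω) (fun k => b k ω) n).submatrix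
        Fin.rev Fin.rev := by
  have hdiag : ∀ (i j : Fin n) ω, (i : ℕ) = j → jacobiMinor (fun k => a k ω) (fun k => b k ω) n
      i.rev j.rev = a i.rev ω := fun i j ω hij => by
    rw [jacobiMinor, if_pos (by rw [Fin.val_rev, Fin.val_rev]; omega)]
  have hoff : ∀ (i j : Fin n) ω, (i : ℕ) + 1 = j →
      jacobiMinor (fun k => a k ω) (fun k => b k ω) n i.rev j.rev = b j.rev ω := fun i j ω hij => by
    rw [jacobiMinor, if_neg (by rw [Fin.val_rev, Fin.val_rev]; omega),
      if_neg (by rw [Fin.val_rev, Fin.val_rev]; omega),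
      if_pos (by rw [Fin.val_rev, Fin.val_rev]; omega)]
  refine ⟨fun ω => ?_, fun ω i j hij => ?_, fun i => ?_, fun i j hij => ?_, ?_⟩
  · ext i j
    rw [Matrix.transpose_apply, smul_jacobiMinor_rev_apply, smul_jacobiMinor_rev_apply,
      (isSymm_jacobiMinor _ _ n).apply]
  · rw [smul_jacobiMinor_rev_apply, jacobiMinor, if_neg (by rw [Fin.val_rev, Fin.val_rev]; omega),
      if_neg (by rw [Fin.val_rev, Fin.val_rev]; omega),
      if_neg (by rw [Fin.val_rev, Fin.val_rev]; omega), mul_zero]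
  · simp only [smul_jacobiMinor_rev_apply, hdiag i i _ rfl]
    exact h.law_diag_scaled hβ i.pos _
  · simp only [smul_jacobiMinor_rev_apply, hoff i j _ hij]
    have h1 := h.law_offDiag_scaled n (j.rev : ℕ)
    have h2 : (((j.rev : ℕ) : ℝ) + 1) = (n : ℝ) - ((i : ℝ) + 1) := by
      have h3 : (j.rev : ℕ) + 1 + (i + 1) = n := by rw [Fin.val_rev]; omega
      have h4 : ((j.rev : ℕ) : ℝ) + 1 + (i + 1) = n := by exact_mod_cast h3
      linarith
    rwa [h2] at h1
  · let g : UpperIndex n → ℕ ⊕ ℕ := fun s =>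
      if (s.1.1 : ℕ) = s.1.2 then Sum.inl (s.1.1.rev : ℕ) else Sum.inr (s.1.2.rev : ℕ)
    have hg : Function.Injective g := by
      rintro ⟨⟨i, j⟩, hs⟩ ⟨⟨i', j'⟩, hs'⟩ hgg
      simp only [g, Fin.val_rev] at hgg hs hs'
      rw [Subtype.mk.injEq, Prod.mk.injEq, Fin.ext_iff, Fin.ext_iff]
      split_ifs at hgg with h1 h2 h2
      · have := Sum.inl.inj hgg
        omega
      · have := Sum.inr.inj hgg
        omega
    have h1 := (h.indep.precomp hg).comp (fun _ x => (√(n : ℝ))⁻¹ * x)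
      fun _ => measurable_const_mul _
    convert h1 using 1
    funext s ω
    obtain ⟨⟨i, j⟩, hs⟩ := s
    simp only [smul_jacobiMinor_rev_apply, Function.comp_apply, g]
    split_ifs with hij
    · rw [hdiag i j ω hij]
      rfl
    · rw [hoff i j ω (hs.resolve_left hij)]
      rfl

theorem orderedRoots_charpoly_minor {a b : ℕ → ℝ} (hb : ∀ k, 0 < b k) (n : ℕ) :
    orderedRoots n (√(n : ℝ) • ((√(n : ℝ))⁻¹ • jacobiMinor a b n).submatrix
      Fin.rev Fin.rev).charpoly = gaussNodes a b n := by
  rcases n.eq_zero_or_pos with rfl | hn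
  · exact Subsingleton.elim _ _
  have hn' : √(n : ℝ) ≠ 0 := (Real.sqrt_pos.2 (Nat.cast_pos.2 hn)).ne'
  have h1 : √(n : ℝ) • ((√(n : ℝ))⁻¹ • jacobiMinor a b n).submatrix Fin.rev Fin.rev =
      Matrix.reindex Fin.revPerm Fin.revPerm (jacobiMinor a b n) := by
    ext i j
    rw [Matrix.smul_apply, smul_jacobiMinor_rev_apply, smul_eq_mul, mul_inv_cancel_left₀ hn']
    rfl
  rw [h1, Matrix.charpoly_reindex, charpoly_jacobiMinor hb,
    orderedRoots_rootPoly (gaussNodes_spec hb n).1.monotone]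

/-- The random Jacobi matrix exists. -/
theorem exists_isBetaHermiteJacobi (hβ : 0 < β) :
    ∃ (Ω : Type) (_ : MeasurableSpace Ω) (P : Measure Ω) (a b : ℕ → Ω → ℝ),
      IsProbabilityMeasure P ∧ IsBetaHermiteJacobi β P a b := by
  let ν : ℕ ⊕ ℕ → Measure ℝ := Sum.elim (fun _ => gaussianReal 0 (2 / β).toNNReal)
    fun k => (chiMeasure (((k : ℝ) + 1) * β)).map (fun x => x / √β)
  have hν : ∀ i, IsProbabilityMeasure (ν i) := by
    rintro (k | k)
    · exact inferInstanceAs (IsProbabilityMeasure (gaussianReal _ _))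
    · have := isProbabilityMeasure_gammaMeasure (a := ((k : ℝ) + 1) * β / 2) (r := 1 / 2)
        (by positivity) (by norm_num)
      have : IsProbabilityMeasure (chiMeasure (((k : ℝ) + 1) * β)) :=
        Measure.isProbabilityMeasure_map (by fun_prop)
      exact Measure.isProbabilityMeasure_map (by fun_prop)
  obtain ⟨Ω, mΩ, P, X, -, hX, hind, hP⟩ := exists_hasLaw_indepFun (fun _ : ℕ ⊕ ℕ => ℝ) ν
  refine ⟨Ω, mΩ, P, fun k => X (Sum.inl k), fun k => X (Sum.inr k), hP, fun k => hX _,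
    fun k => hX _, ?_⟩
  convert hind using 1
  funext i
  cases i <;> rfl

theorem IsBetaHermiteJacobi.congr {a' b' : ℕ → Ω → ℝ} (h : IsBetaHermiteJacobi β P a b)
    (ha : ∀ k, a k =ᵐ[P] a' k) (hb : ∀ k, b k =ᵐ[P] b' k) : IsBetaHermiteJacobi β P a' b' :=
  ⟨fun k => (h.law_diag k).congr (ha k).symm, fun k => (h.law_offDiag k).congr (hb k).symm,
    h.indep.congr fun i => by
      cases i with
      | inl k => exact ha k
      | inr k => exact hb k⟩

end Minors

end BetaHermite

theorem mainTheorem7 (β : ℝ) (hβ : 0 < β) :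
    -- the random Jacobi matrix `J_β` exists
    (∃ (Ω : Type) (_ : MeasurableSpace Ω) (P : Measure Ω) (a b : ℕ → Ω → ℝ),
      IsProbabilityMeasure P ∧ BetaHermite.IsBetaHermiteJacobi β P a b) ∧
    -- and for every realization of `J_β` there is a random probability measure `μ` such that
    ∀ (Ω : Type*) [MeasurableSpace Ω] (P : Measure Ω) [IsProbabilityMeasure P]
      (a b : ℕ → Ω → ℝ), BetaHermite.IsBetaHermiteJacobi β P a b →
      ∃ μ : Ω → Measure ℝ, Measurable μ ∧ (∀ ω, IsProbabilityMeasure (μ ω)) ∧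
        -- almost surely `J_β` is self-adjoint and `μ` is its spectral measure at the
        -- first coordinate
        (∀ᵐ ω ∂P,
          IsSelfAdjoint (BetaHermite.jacobiOperator (fun k => a k ω) (fun k => b k ω)) ∧
          BetaHermite.IsSpectralMeasureAt
            (BetaHermite.jacobiOperator (fun k => a k ω) (fun k => b k ω))
            BetaHermite.firstVector (μ ω)) ∧
        -- almost surely `μ` has infinite support and finite moments
        (∀ᵐ ω ∂P, (μ ω).support.Infinite ∧ ∀ k : ℕ, Integrable (fun x : ℝ => x ^ k) (μ ω)) ∧
        -- up to reversal and scaling, the minors of `J_β` are the tridiagonal models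
        (∀ n : ℕ, BetaHermite.IsBetaHermiteTridiagonal β n P fun ω =>
          ((√(n : ℝ))⁻¹ • BetaHermite.jacobiMinor (fun k => a k ω) (fun k => b k ω) n).submatrix
            Fin.rev Fin.rev) ∧
        -- `p n` is the `n`-th orthonormal polynomial of `μ`
        ∃ p : ℕ → Ω → ℝ[X],
          (∀ᵐ ω ∂P, ∀ n (q : ℝ[X]),
            BetaHermite.IsOrthonormalPolynomial (μ ω) n q ↔ q = p n ω) ∧
          ∀ n : ℕ,
            -- almost surely `p n` has `n` distinct real zeros
            (∀ᵐ ω ∂P, (p n ω).roots.card = n ∧ (p n ω).roots.Nodup) ∧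
            -- the zeros are distributed as the eigenvalues of `√n T_n`
            (∀ (Ω' : Type*) [MeasurableSpace Ω'] (P' : Measure Ω') [IsProbabilityMeasure P']
              (T : Ω' → Matrix (Fin n) (Fin n) ℝ),
              BetaHermite.IsBetaHermiteTridiagonal β n P' T →
              IdentDistrib (fun ω => BetaHermite.orderedRoots n (p n ω))
                (fun ω' => BetaHermite.orderedRoots n (√(n : ℝ) • T ω').charpoly) P P') ∧
            -- and follow the joint density of the `n`-point `β`-Hermite ensemble
            HasLaw (fun ω => BetaHermite.orderedRoots n (p n ω))
              (BetaHermite.hermiteEnsemble β n) P := by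
  refine ⟨BetaHermite.exists_isBetaHermiteJacobi hβ, ?_⟩
  intro Ω _ P _ a b h
  have ham : ∀ k, AEMeasurable (a k) P := fun k => (h.law_diag k).aemeasurable
  have hbm : ∀ k, AEMeasurable (b k) P := fun k => (h.law_offDiag k).aemeasurable
  let a' : ℕ → Ω → ℝ := fun k => (ham k).mk (a k)
  let b' : ℕ → Ω → ℝ := fun k => (hbm k).mk (b k)
  have ha' : ∀ k, Measurable (a' k) := fun k => (ham k).measurable_mk
  have hb' : ∀ k, Measurable (b' k) := fun k => (hbm k).measurable_mk
  have h' : BetaHermite.IsBetaHermiteJacobi β P a' b' :=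
    h.congr (fun k => (ham k).ae_eq_mk) fun k => (hbm k).ae_eq_mk
  have heq : ∀ᵐ ω ∂P, (fun k => a k ω) = (fun k => a' k ω) ∧
      (fun k => b k ω) = fun k => b' k ω := by
    filter_upwards [ae_all_iff.2 fun k => (ham k).ae_eq_mk,
      ae_all_iff.2 fun k => (hbm k).ae_eq_mk] with ω h1 h2
    exact ⟨funext h1, funext h2⟩
  have hpos := h'.ae_pos hβ
  have hC := h'.ae_not_summable hβ
  obtain ⟨μ, hμm, hμp, hμ⟩ :=
    BetaHermite.exists_measurable_isOrthonormalizing ha' hb' hpos hC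
  have hminor := h.isBetaHermiteTridiagonal hβ
  have hroots : ∀ n, ∀ᵐ ω ∂P,
      BetaHermite.orderedRoots n
        (BetaHermite.onPoly (fun k => a' k ω) (fun k => b' k ω) n) =
      BetaHermite.gaussNodes (fun k => a' k ω) (fun k => b' k ω) n := fun n => by
    filter_upwards [hpos] with ω hω
    exact BetaHermite.orderedRoots_onPoly hω n
  refine ⟨μ, hμm, hμp, ?_, ?_, hminor,
    fun n ω => BetaHermite.onPoly (fun k => a' k ω) (fun k => b' k ω) n, ?_, fun n => ⟨?_, ?_, ?_⟩⟩
  · filter_upwards [heq, hpos, hC, hμ] with ω hω h1 h2 h3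
    rw [hω.1, hω.2]
    exact ⟨BetaHermite.isSelfAdjoint_jacobiOperator h1 h2, h3.isSpectralMeasureAt h1⟩
  · filter_upwards [hpos, hμ] with ω h1 h3
    exact ⟨h3.infinite_support h1, fun k => by simpa using h3.integrable (X ^ k)⟩
  · filter_upwards [hpos, hμ] with ω h1 h3 n q
    exact h3.isOrthonormalPolynomial_iff h1 n q
  · filter_upwards [hpos] with ω h1
    exact ⟨BetaHermite.card_roots_onPoly h1 n, BetaHermite.nodup_roots_onPoly h1 n⟩
  · intro Ω' _ P' _ T hT
    refine HasLaw.identDistrib (((hminor n).hasLaw_eigenvalues √(n : ℝ)).congr ?_)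
      (hT.hasLaw_eigenvalues √(n : ℝ))
    filter_upwards [heq, hpos, hroots n] with ω hω h1 h2
    rw [h2, hω.1, hω.2, BetaHermite.orderedRoots_charpoly_minor h1]
  · exact (BetaHermite.hasLaw_rootsOfCoeffs hβ ha' hb' h' n).congr (hroots n)
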